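/- Let $\mathcal M\subseteq B(H)$ and $\mathcal N\subseteq B(K)$ be von Neumann algebras, on arbitrary complex Hilbert spaces $H$, $K$, with separable preduals $\mathcal M_*$ and $\mathcal N_*$ (the norm-separable spaces of normal, i.e. $\sigma$-weakly continuous, functionals). Assume that $\mathcal N$ is properly infinite (its only finite central projection is $0$) and injective (there is a linear projection of norm at most one from $B(K)$ onto $\mathcal N$). Let $\alpha:\mathcal M\to\mathcal N$ be a linear map that is normal ($\varphi\circ\alpha\in\mathcal M_*$ for every $\varphi\in\mathcal N_*$) and completely bounded, that is, $$\|\alpha\|_{cb}:=\sup_{n\ge 1}\ \sup\{\|[\alpha(x_{ij})]\| : [x_{ij}]\in M_n(\mathcal M),\ \|[x_{ij}]\|\le 1\}<\infty ,$$ where $M_n(\mathcal M)\subseteq B(H^n)$ and $M_n(\mathcal N)\subseteq B(K^n)$ carry the operator norms. Then there exist a normal $*$-representation $\pi:\mathcal M\to\mathcal N$ (a normal $*$-homomorphism, which can be taken unital if $\mathcal M\neq 0$) and operators $R,S\in\mathcal N$ such that $$\alpha(a)=R\,\pi(a)\,S\quad\text{for all } a\in\mathcal M,\qquad\text{and}\qquad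 \|R\|\,\|S\|=\|\alpha\|_{cb}.$$ -/

import Mathlib

noncomputable section

namespace VonNeumannAlgebra

universe u v

variable {H : Type u} [NormedAddCommGroup H] [InnerProductSpace ℂ H] [CompleteSpace H]
variable {K : Type v} [NormedAddCommGroup K] [InnerProductSpace ℂ K] [CompleteSpace K]

/-- The underlying star-algebra of a von Neumann algebra `M ⊆ B(H)`, as a type. It carries the
operator norm and the star-algebra structure inherited from `B(H)`. -/
abbrev Elem (M : VonNeumannAlgebra H) : Type u := M.toStarSubalgebra

/-! ### Normal functionals, the predual, normal maps -/

/-- `φ` is a normal (i.e. σ-weakly continuous) linear functional on `M ⊆ B(H)`: there are square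
summable sequences `ξ`, `η` of vectors in `H` such that `φ a = ∑ₙ ⟪ηₙ, a ξₙ⟫` for all `a ∈ M`.
(Any such function is automatically linear and bounded.) -/
def IsNormalFunctional (M : VonNeumannAlgebra H) (φ : M.Elem → ℂ) : Prop :=
  ∃ ξ η : ℕ → H, Summable (fun n => ‖ξ n‖ ^ 2) ∧ Summable (fun n => ‖η n‖ ^ 2) ∧
    ∀ a : M.Elem, HasSum (fun n => inner ℂ (η n) ((a : H →L[ℂ] H) (ξ n))) (φ a)

/-- The predual `M_*` of `M`: the set of normal functionals inside the Banach space dual of `M`. -/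
def predual (M : VonNeumannAlgebra H) : Set (StrongDual ℂ M.Elem) :=
  {φ | M.IsNormalFunctional φ}

/-- The predual `M_*` is separable in its norm. -/
def HasSeparablePredual (M : VonNeumannAlgebra H) : Prop :=
  TopologicalSpace.IsSeparable M.predual

/-- `T : M → N` is normal, i.e. continuous for the σ-weak topologies: `φ ∘ T ∈ M_*` for every
`φ ∈ N_*`. -/
def IsNormalMap {M : VonNeumannAlgebra H} {N : VonNeumannAlgebra K} (T : M.Elem → N.Elem) : Prop :=
  ∀ φ : N.Elem → ℂ, N.IsNormalFunctional φ → M.IsNormalFunctional (φ ∘ T)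

/-! ### Completely bounded maps -/

/-- The bounded operator on the Hilbert space direct sum `Hⁿ` given by an `n × n` matrix of bounded
operators on `H`: `(x ξ)ᵢ = ∑ⱼ xᵢⱼ ξⱼ`. -/
def matrixOp {n : ℕ} (x : Matrix (Fin n) (Fin n) (H →L[ℂ] H)) :
    PiLp 2 (fun _ : Fin n => H) →L[ℂ] PiLp 2 (fun _ : Fin n => H) :=
  ((PiLp.continuousLinearEquiv 2 ℂ (fun _ : Fin n => H)).symm :
      (Fin n → H) →L[ℂ] PiLp 2 (fun _ : Fin n => H)) ∘L
    ContinuousLinearMap.pi fun i => ∑ j, x i j ∘L PiLp.proj 2 (fun _ : Fin n => H) j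

theorem matrixOp_apply {n : ℕ} (x : Matrix (Fin n) (Fin n) (H →L[ℂ] H))
    (ξ : PiLp 2 (fun _ : Fin n => H)) (i : Fin n) :
    matrixOp x ξ i = ∑ j, x i j (ξ j) := by
  simp [matrixOp]

/-- The norm on `Mₙ(M)` induced by `Mₙ(M) ⊆ Mₙ(B(H)) = B(Hⁿ)`. -/
def matrixNorm (M : VonNeumannAlgebra H) {n : ℕ} (x : Matrix (Fin n) (Fin n) M.Elem) : ℝ :=
  ‖matrixOp (x.map fun a => (a : H →L[ℂ] H))‖

/-- The completely bounded norm `‖α‖_cb = supₙ ‖αₙ‖`, where `αₙ : Mₙ(M) → Mₙ(N)` applies `α` to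
every entry and `‖αₙ‖` is its operator norm. It takes the value `∞` if `α` is not completely
bounded. -/
def cbNorm {M : VonNeumannAlgebra H} {N : VonNeumannAlgebra K} (α : M.Elem →ₗ[ℂ] N.Elem) :
    ENNReal :=
  ⨆ (n : ℕ) (x : Matrix (Fin n) (Fin n) M.Elem) (_ : M.matrixNorm x ≤ 1),
    ENNReal.ofReal (N.matrixNorm (x.map α))

/-- `α` is completely bounded. -/
def IsCompletelyBounded {M : VonNeumannAlgebra H} {N : VonNeumannAlgebra K}
    (α : M.Elem →ₗ[ℂ] N.Elem) : Prop :=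
  cbNorm α < ⊤

/-! ### Proper infiniteness and injectivity -/

/-- The projection `p` is finite in `N`: if `p` is Murray-von Neumann equivalent in `N` to a
subprojection `v v* ≤ p`, then this subprojection is `p` itself. -/
def IsFiniteProjection (N : VonNeumannAlgebra K) (p : N.Elem) : Prop :=
  ∀ v : N.Elem, star v * v = p → p * (v * star v) = v * star v → v * star v = p

/-- `N` is properly infinite: its only finite central projection is `0`. -/
def IsProperlyInfinite (N : VonNeumannAlgebra K) : Prop :=
  ∀ z : N.Elem, IsStarProjection z → (∀ a : N.Elem, z * a = a * z) →
    N.IsFiniteProjection z → z = 0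

/-- `N ⊆ B(K)` is injective: there is a linear projection of norm (at most) one from `B(K)`
onto `N`. -/
def IsInjective (N : VonNeumannAlgebra K) : Prop :=
  ∃ E : (K →L[ℂ] K) →L[ℂ] (K →L[ℂ] K),
    ‖E‖ ≤ 1 ∧ (∀ x, E x ∈ N) ∧ ∀ x ∈ N, E x = x

end VonNeumannAlgebra

end

/-! A completely bounded map is a corner of a representation on some large Hilbert space `L`.
Injectivity moves the corners into `N`, normality of `α` makes the non-normal part of the
representation irrelevant, and proper infiniteness together with separability fits what remains into
`K` itself, by operators of `N`.

Let `c` be the completely bounded norm. The Wittstock–Paulsen argument (`exists_kernel_extension`,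
by the M. Riesz extension theorem) makes `α` the off-diagonal entry of a positive kernel with
diagonal value `c` at the unit. Dilating it gives a representation of `M` of which `α` is a corner
between two multiples of isometries by `√c`. Since `N` contains isometries `s n` with orthogonal
ranges (`exists_isometry_seq`), the norm-one projection onto `N` can be turned into a completely
positive one (`exists_completelyPositive_projection`). Applying it to all corners and dilating again
gives `ρ` on `L` and operators `T i : K → L` with every corner in `N` (`exists_injective_dilation`).
The commutant of `N` then lifts to the commutant of `ρ` (`exists_commutant_lift`). From there on,
belonging to `N` means intertwining these lifts with the commutant.

Let `z` be the projection onto the normal part of `ρ`, spanned by the ranges of all intertwiners `H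
→ L`. A normal coefficient of `ρ` sees only this part (`inner_rep_eq`), so inserting `z` does not
change the corner `α`. The subspace generated by the `z T i` under `ρ` is generated by countably
many operators `K → L`, because the predual of `M` is separable. It therefore embeds into `ℓ²(K)`,
and by the isometries `s n` into `K`. An additional index whose corner is a vector state times `1`
makes the image large. A Cantor–Bernstein argument (`exists_isometry_range`) then makes the
embedding onto. If `V : L → K` is the resulting coisometry, then `π a = V ρ(a) V*`, `S = V z T (some
true)` and `R = (V z T (some false))*` lie in `N`, and `R` and `S` have norm at most `√c`. The
inequality `c ≤ ‖R‖ ‖S‖` holds for any such factorization. -/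

noncomputable section

set_option linter.unusedSectionVars false

open scoped ComplexOrder InnerProductSpace

/-! ### Amplified Hilbert spaces, equivariant partial isometries and Gram matrices. -/

namespace HilbertSpaceTools

open ContinuousLinearMap

variable {X Y : Type*} [NormedAddCommGroup X] [InnerProductSpace ℂ X] [CompleteSpace X]
  [NormedAddCommGroup Y] [InnerProductSpace ℂ Y] [CompleteSpace Y]

/-- The Hilbert space of square summable sequences in `X`. -/
abbrev Amp (X : Type*) [NormedAddCommGroup X] [InnerProductSpace ℂ X] : Type _ :=
  lp (fun _ : ℕ => X) 2

/-- The sequence with `x` at place `i` and `0` elsewhere. -/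
abbrev Amp.single (i : ℕ) (x : X) : Amp X := lp.single 2 i x

theorem Amp.summable_sq (f : Amp X) : Summable fun i => ‖f i‖ ^ 2 := by
  have h := (lp.memℓp f).summable (by norm_num)
  simpa using h

theorem Amp.norm_sq (f : Amp X) : ‖f‖ ^ 2 = ∑' i, ‖f i‖ ^ 2 := by
  have h := lp.norm_rpow_eq_tsum (p := 2) (by norm_num) f
  simpa using h

/-- A square summable sequence as an element of `Amp X`. -/
def Amp.mk (f : ℕ → X) (hf : Summable fun i => ‖f i‖ ^ 2) : Amp X :=
  ⟨f, memℓp_gen (by simpa using hf)⟩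

@[simp] theorem Amp.mk_apply (f : ℕ → X) (hf : Summable fun i => ‖f i‖ ^ 2) (i : ℕ) :
    Amp.mk f hf i = f i := rfl

theorem Amp.clm_ext {F : Type*} [NormedAddCommGroup F] [NormedSpace ℂ F] {f g : Amp X →L[ℂ] F}
    (h : ∀ i x, f (Amp.single i x) = g (Amp.single i x)) : f = g :=
  lp.ext_continuousLinearMap (by norm_num) fun i => by
    ext x
    exact h i x

/-- The diagonal operator `(xᵢ) ↦ (A xᵢ)`. -/
def diag (A : X →L[ℂ] X) : Amp X →L[ℂ] Amp X :=
  LinearMap.mkContinuous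
    { toFun := fun f => Amp.mk (fun i => A (f i)) <| by
        refine Summable.of_nonneg_of_le (fun i => by positivity) (fun i => ?_)
          ((Amp.summable_sq f).mul_left (‖A‖ ^ 2))
        rw [← mul_pow]
        gcongr
        exact A.le_opNorm _
      map_add' := fun f g => by ext i; simp
      map_smul' := fun c f => by ext i; simp } ‖A‖ <| by
    intro f
    rw [← sq_le_sq₀ (norm_nonneg _) (by positivity), Amp.norm_sq, mul_pow, Amp.norm_sq,
      ← tsum_mul_left]
    refine Summable.tsum_le_tsum (fun i => ?_) (Amp.summable_sq _)
      ((Amp.summable_sq f).mul_left _)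
    rw [← mul_pow]
    gcongr
    exact A.le_opNorm _

@[simp] theorem diag_apply (A : X →L[ℂ] X) (f : Amp X) (i : ℕ) : diag A f i = A (f i) := rfl

@[simp] theorem diag_single (A : X →L[ℂ] X) (i : ℕ) (x : X) :
    diag A (Amp.single i x) = Amp.single i (A x) := by
  ext j
  rcases eq_or_ne j i with rfl | h
  · simp
  · simp [h]

theorem adjoint_diag (A : X →L[ℂ] X) : adjoint (diag A) = diag (adjoint A) := by
  symm
  rw [ContinuousLinearMap.eq_adjoint_iff]
  intro f g
  rw [lp.inner_eq_tsum, lp.inner_eq_tsum]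
  simp [adjoint_inner_left]

theorem diag_one : diag (1 : X →L[ℂ] X) = 1 := by
  ext f i
  simp

theorem diag_comp (A B : X →L[ℂ] X) : diag A ∘L diag B = diag (A * B) := by
  ext f i
  simp

/-- Polar decomposition: the partial isometry `U` with `T* = U |T*|`, and its compatibility with
operators intertwined by `T`. -/
theorem exists_polar (T : X →L[ℂ] Y) : ∃ U : Y →L[ℂ] X,
    (∀ x, adjoint U (U (T x)) = T x) ∧ (∀ y, adjoint T y = 0 → U y = 0) ∧
    ∀ (A : X →L[ℂ] X) (B : Y →L[ℂ] Y), T ∘L A = B ∘L T → T ∘L adjoint A = adjoint B ∘L T →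
      U ∘L B = A ∘L U := by
  set S : Y →L[ℂ] Y := T ∘L adjoint T with hS
  have hS0 : 0 ≤ S := by
    rw [nonneg_iff_isPositive]
    exact isPositive_self_comp_adjoint T
  set P : Y →L[ℂ] Y := CFC.sqrt S with hP
  have hPP : P * P = S := CFC.sqrt_mul_sqrt_self S hS0
  have hP0 : 0 ≤ P := CFC.sqrt_nonneg S
  have hPsa : adjoint P = P := (nonneg_iff_isPositive P |>.1 hP0).isSelfAdjoint.adjoint_eq
  have hin : ∀ y y', ⟪P y, P y'⟫_ℂ = ⟪adjoint T y, adjoint T y'⟫_ℂ := fun y y' => by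
    have h1 : P (P y') = S y' := congrArg (fun g => g y') hPP
    rw [← adjoint_inner_right, hPsa, h1, adjoint_inner_left]
    rfl
  have hnorm : ∀ y, ‖P y‖ = ‖adjoint T y‖ := fun y => by
    rw [@norm_eq_sqrt_re_inner ℂ, @norm_eq_sqrt_re_inner ℂ _ _ _ _ (adjoint T y), hin]
  have hker : ∀ y, P y = 0 ↔ adjoint T y = 0 := fun y => by
    rw [← norm_eq_zero, hnorm, norm_eq_zero]
  let k : Submodule ℂ Y := LinearMap.ker (P : Y →ₗ[ℂ] Y)
  have hk : ∀ y : k, P y = 0 := fun y => y.2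
  have hort : ∀ (y : Y) (z : k), ⟪P y, (z : Y)⟫_ℂ = 0 := fun y z => by
    rw [← adjoint_inner_right, hPsa, hk, inner_zero_right]
  -- The range of the selfadjoint `P` plus its kernel is dense. So `U` is determined by `P y ↦ T* y`
  -- and by being zero on the kernel; it is bounded because the two summands are orthogonal and `‖P
  -- y‖ = ‖T* y‖`.
  let e : (Y × k) →ₗ[ℂ] Y := (P : Y →ₗ[ℂ] Y).coprod k.subtype
  let f : (Y × k) →ₗ[ℂ] X := (adjoint T : Y →ₗ[ℂ] X) ∘ₗ LinearMap.fst ℂ Y k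
  have he : ∀ y z, e (y, z) = P y + z := fun y z => rfl
  have hf : ∀ y z, f (y, z) = adjoint T y := fun y z => rfl
  have hdense : DenseRange e := by
    have h1 : (LinearMap.range e).topologicalClosure = ⊤ := by
      rw [Submodule.topologicalClosure_eq_top_iff, Submodule.eq_bot_iff]
      intro w hw
      rw [Submodule.mem_orthogonal] at hw
      have h2 : P w = 0 := by
        have := hw (e (P w, 0)) ⟨_, rfl⟩
        rw [he] at this
        simp only [ZeroMemClass.coe_zero, add_zero] at this
        rw [← adjoint_inner_right, hPsa] at this
        simpa using this
      have := hw (e (0, ⟨w, h2⟩)) ⟨_, rfl⟩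
      simpa [he] using this
    have := Submodule.dense_iff_topologicalClosure_eq_top.2 h1
    simpa [DenseRange] using! this
  have hbd : ∀ v, ‖f v‖ ≤ 1 * ‖e v‖ := by
    rintro ⟨y, z⟩
    rw [hf, he, one_mul, ← hnorm, ← sq_le_sq₀ (norm_nonneg _) (norm_nonneg _)]
    have := norm_add_sq_eq_norm_sq_add_norm_sq_of_inner_eq_zero (𝕜 := ℂ) _ _ (hort y z)
    nlinarith [sq_nonneg ‖(z : Y)‖]
  set U : Y →L[ℂ] X := f.extendOfNorm e with hU
  have hUe : ∀ (y : Y) (z : k), U (P y + z) = adjoint T y := fun y z =>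
    LinearMap.extendOfNorm_eq hdense ⟨1, hbd⟩ (y, z)
  have hind : ∀ {p : Y → Prop}, IsClosed {y | p y} → (∀ y (z : k), p (P y + z)) → ∀ y, p y := by
    intro p hc h y
    exact isClosed_property hdense hc (fun v => h v.1 v.2) y
  have hUU : ∀ y (z : k), adjoint U (U (P y + z)) = P y := by
    intro y z
    refine ext_inner_right ℂ fun w => ?_
    refine hind (p := fun w => ⟪adjoint U (U (P y + z)), w⟫_ℂ = ⟪P y, w⟫_ℂ)
      (isClosed_eq (by fun_prop) (by fun_prop)) (fun y' z' => ?_) w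
    rw [adjoint_inner_left, hUe, hUe, inner_add_right, hort, add_zero, hin]
  have hTU : ∀ y, adjoint T (y - adjoint U (U y)) = 0 := by
    refine hind (isClosed_eq (by fun_prop) (by fun_prop)) fun y z => ?_
    rw [hUU, add_sub_cancel_left, ← hker, hk]
  refine ⟨U, fun x => ?_, fun y hy => ?_, fun A B h1 h2 => ?_⟩
  · refine ext_inner_right ℂ fun w => ?_
    rw [← sub_eq_zero, ← inner_sub_left]
    have := hTU w
    have h3 : ⟪T x, w - adjoint U (U w)⟫_ℂ = 0 := by
      rw [← adjoint_inner_right, this, inner_zero_right]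
    rw [inner_sub_right, adjoint_inner_right] at h3
    rw [inner_sub_left, adjoint_inner_left, ← neg_eq_zero, neg_sub, h3]
  · have := hUe 0 ⟨y, (hker y).2 hy⟩
    simpa using this
  -- The relation for adjoints says that `T*` intertwines `B` and `A`. Hence `T T*` commutes with
  -- `B`, and so does its square root.
  · have h3 : adjoint T ∘L B = A ∘L adjoint T := by
      have := congrArg adjoint h2
      simpa [adjoint_comp] using this.symm
    have hc : Commute S B := by
      show (T ∘L adjoint T) ∘L B = B ∘L (T ∘L adjoint T)
      rw [comp_assoc, h3, ← comp_assoc, h1, comp_assoc]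
    have hcP : Commute P B := hc.cfcₙ_nnreal _
    have hcP' : ∀ y, P (B y) = B (P y) := fun y => congrArg (fun g => g y) hcP.eq
    ext y
    refine hind (p := fun y => (U ∘L B) y = (A ∘L U) y) (isClosed_eq (by fun_prop) (by fun_prop))
      (fun y z => ?_) y
    have hz : B z ∈ k := by
      show P (B z) = 0
      rw [hcP', hk, map_zero]
    have := hUe (B y) ⟨B z, hz⟩
    simp only [coe_comp, Function.comp_apply, map_add, hcP'] at this ⊢
    rw [this, ← map_add A, ← map_add U, hUe]
    exact congrArg (fun g => g y) h3

/-- The weights absorb arbitrary norms, so that countably many operators merge into one. As they are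
nonzero, the closed span of the ranges is not affected. -/
theorem summable_weighted_comp {V : Type*} [NormedAddCommGroup V] [NormedSpace ℂ V]
    (T : ℕ → X →L[ℂ] Y) (ev : ℕ → V →L[ℂ] X) (hev : ∀ i, ‖ev i‖ ≤ 1) :
    Summable fun i => (((1 / 2 : ℝ) ^ i / (1 + ‖T i‖) : ℝ) : ℂ) • (T i ∘L ev i) := by
  have hr0 : ∀ i, (0 : ℝ) < (1 / 2 : ℝ) ^ i / (1 + ‖T i‖) := fun i => by positivity
  refine Summable.of_norm_bounded (g := fun i => (1 / 2 : ℝ) ^ i)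
    (summable_geometric_of_lt_one (by norm_num) (by norm_num)) fun i => ?_
  have h1 : ‖T i ∘L ev i‖ ≤ ‖T i‖ := by
    refine (opNorm_comp_le _ _).trans ?_
    simpa using mul_le_mul_of_nonneg_left (hev i) (norm_nonneg (T i))
  rw [norm_smul, Complex.norm_real, Real.norm_of_nonneg (hr0 i).le, div_mul_eq_mul_div,
    div_le_iff₀ (by positivity)]
  gcongr
  linarith

/-- A weighted sum of operators, defined on the amplification. -/
theorem exists_weighted_row (T : ℕ → X →L[ℂ] Y) : ∃ (S : Amp X →L[ℂ] Y) (c : ℕ → ℂ),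
    (∀ i, c i ≠ 0) ∧ ∀ i x, S (Amp.single i x) = c i • T i x := by
  have hr0 : ∀ i, (0 : ℝ) < (1 / 2 : ℝ) ^ i / (1 + ‖T i‖) := fun i => by positivity
  let ev : ℕ → Amp X →L[ℂ] X := fun i => lp.evalCLM ℂ (fun _ : ℕ => X) 2 i
  have hev : ∀ i, ‖ev i‖ ≤ 1 := fun i => LinearMap.mkContinuous_norm_le _ zero_le_one _
  have hev1 : ∀ i j x, ev i (Amp.single j x) = (Amp.single j x) i := fun i j x => rfl
  have hG := summable_weighted_comp T ev hev
  refine ⟨∑' i, (((1 / 2 : ℝ) ^ i / (1 + ‖T i‖) : ℝ) : ℂ) • (T i ∘L ev i),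
    fun i => (((1 / 2 : ℝ) ^ i / (1 + ‖T i‖) : ℝ) : ℂ),
    fun i => Complex.ofReal_ne_zero.2 (hr0 i).ne', fun j x => ?_⟩
  refine (hG.hasSum.mapL (ContinuousLinearMap.apply ℂ Y (Amp.single j x))).unique ?_
  convert hasSum_single j (fun i hi => ?_) using 1
  · simp [hev1]
  · simp [hev1, hi]

/-- Countably many operators `T i : X → Y` embed the closed span of their ranges, compatibly with
the intertwined operators, into the amplification of `X`. -/
theorem exists_amp_embedding (T : ℕ → X →L[ℂ] Y) : ∃ U : Y →L[ℂ] Amp X,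
    (∀ y ∈ closure (Submodule.span ℂ {y | ∃ i x, y = T i x} : Set Y), adjoint U (U y) = y) ∧
    (∀ y, (∀ i, adjoint (T i) y = 0) → U y = 0) ∧
    ∀ (A : X →L[ℂ] X) (B : Y →L[ℂ] Y), (∀ i, T i ∘L A = B ∘L T i) →
      (∀ i, T i ∘L adjoint A = adjoint B ∘L T i) → U ∘L B = diag A ∘L U := by
  obtain ⟨S, c, hc0, hSs⟩ := exists_weighted_row T
  obtain ⟨U, h1, h2, h3⟩ := exists_polar S
  refine ⟨U, fun y hy => ?_, fun y hy => ?_, fun A B hA hB => ?_⟩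
  · refine closure_minimal (t := {y | adjoint U (U y) = y}) (fun y hy => ?_)
      (isClosed_eq (by fun_prop) (by fun_prop)) hy
    induction hy using Submodule.span_induction with
    | mem y hy =>
      obtain ⟨i, x, rfl⟩ := hy
      have := h1 (Amp.single i x)
      rw [hSs] at this
      simp only [map_smul] at this
      exact smul_right_injective _ (hc0 i) this
    | zero => simp
    | add y z _ _ hy hz => simp only [Set.mem_ofPred_eq, map_add] at *; rw [hy, hz]
    | smul a y _ hy => simp only [Set.mem_ofPred_eq, map_smul] at *; rw [hy]
  · refine h2 y ?_
    have : (innerSL ℂ y) ∘L S = 0 := by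
      refine Amp.clm_ext fun i x => ?_
      simp [hSs, ← adjoint_inner_left, hy]
    refine ext_inner_right ℂ fun f => ?_
    rw [adjoint_inner_left, inner_zero_left]
    exact congrArg (fun g => g f) this
  · have aux : ∀ (A : X →L[ℂ] X) (B : Y →L[ℂ] Y), (∀ i, T i ∘L A = B ∘L T i) →
        S ∘L diag A = B ∘L S := by
      intro A B hA
      refine Amp.clm_ext fun i x => ?_
      have := congrArg (fun g => g x) (hA i)
      simp only [coe_comp, Function.comp_apply] at this
      simp [hSs, this]
    refine h3 _ _ (aux A B hA) ?_
    rw [adjoint_diag]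
    exact aux _ _ hB

/-- Contractions `t i` with mutually orthogonal ranges add up to an operator on the
amplification. -/
theorem exists_row (t : ℕ → X →L[ℂ] Y) (ht : ∀ i, ‖t i‖ ≤ 1)
    (hort : ∀ i j, i ≠ j → adjoint (t i) ∘L t j = 0) :
    ∃ J : Amp X →L[ℂ] Y, (∀ i x, J (Amp.single i x) = t i x) ∧ ‖J‖ ≤ 1 := by
  let e : (ℕ →₀ X) →ₗ[ℂ] Amp X := Finsupp.lsum ℂ fun i => lp.lsingle (𝕜 := ℂ) (E := fun _ : ℕ => X) 2 i
  let f : (ℕ →₀ X) →ₗ[ℂ] Y := Finsupp.lsum ℂ fun i => (t i : X →ₗ[ℂ] Y)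
  have he : ∀ i x, e (Finsupp.single i x) = Amp.single i x := fun i x => by simp [e]
  have hf : ∀ i x, f (Finsupp.single i x) = t i x := fun i x => by simp [f]
  have hdense : DenseRange e := by
    intro g
    have hs := lp.hasSum_single (p := 2) (by norm_num) g
    refine mem_closure_of_tendsto hs (Filter.Eventually.of_forall fun s => ?_)
    refine ⟨∑ i ∈ s, Finsupp.single i (g i), ?_⟩
    simp [he]
  have hbd : ∀ v, ‖f v‖ ≤ 1 * ‖e v‖ := by
    intro v
    rw [one_mul, ← sq_le_sq₀ (norm_nonneg _) (norm_nonneg _)]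
    have h1 : ‖e v‖ ^ 2 = ∑ i ∈ v.support, ‖v i‖ ^ 2 := by
      have := lp.norm_sum_single (p := 2) (by norm_num) (fun i => v i) v.support
      simp only [ENNReal.toReal_ofNat, Real.rpow_ofNat] at this
      rw [← this]
      simp [e, Finsupp.sum]
    have h2 : f v = ∑ i ∈ v.support, t i (v i) := by simp [f, Finsupp.sum]
    have h3 : ‖f v‖ ^ 2 = ∑ i ∈ v.support, ‖t i (v i)‖ ^ 2 := by
      rw [h2]
      have : ((‖∑ i ∈ v.support, t i (v i)‖ ^ 2 : ℝ) : ℂ)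
          = ((∑ i ∈ v.support, ‖t i (v i)‖ ^ 2 : ℝ) : ℂ) := by
        push_cast
        have h4 := inner_self_eq_norm_sq_to_K (𝕜 := ℂ) (∑ i ∈ v.support, t i (v i))
        simp only [Complex.coe_algebraMap] at h4
        rw [← h4, sum_inner]
        refine Finset.sum_congr rfl fun i hi => ?_
        rw [inner_sum, Finset.sum_eq_single i]
        · simp
        · intro j _ hj
          rw [← adjoint_inner_right]
          have := congrArg (fun g => g (v j)) (hort i j (Ne.symm hj))
          simp only [coe_comp, Function.comp_apply, zero_apply] at this
          rw [this, inner_zero_right]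
        · intro h; exact absurd hi h
      exact_mod_cast this
    rw [h1, h3]
    gcongr with i _
    simpa only [one_mul] using (t i).le_of_opNorm_le (ht i) (v i)
  refine ⟨f.extendOfNorm e, fun i x => ?_, ?_⟩
  · rw [← he, LinearMap.extendOfNorm_eq hdense ⟨1, hbd⟩, hf]
  · exact LinearMap.opNorm_extendOfNorm_le hdense zero_le_one hbd

/-- Computes the initial projection of a row of partial isometries (`J = J'`), and shows with `b =
0` that two rows have orthogonal ranges. -/
theorem row_adjoint_comp_row {J J' : Amp X →L[ℂ] Y} {t t' : ℕ → X →L[ℂ] Y}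
    (hJ : ∀ i x, J (Amp.single i x) = t i x) (hJ' : ∀ i x, J' (Amp.single i x) = t' i x)
    (b : X →L[ℂ] X) (h : ∀ i j, adjoint (t i) ∘L t' j = if i = j then b else 0) :
    adjoint J ∘L J' = diag b := by
  refine Amp.clm_ext fun j x => ?_
  ext i
  refine ext_inner_left ℂ fun y => ?_
  rw [← lp.inner_single_left (G := fun _ : ℕ => X) i y, coe_comp, Function.comp_apply,
    adjoint_inner_right, hJ, hJ', ← adjoint_inner_right]
  have := congrArg (fun g => g x) (h i j)
  simp only [coe_comp, Function.comp_apply] at this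
  rw [this, diag_single, lp.single_apply]
  split_ifs with hij
  · subst hij; simp
  · simp [hij]

theorem row_comp_diag {J : Amp X →L[ℂ] Y} {t : ℕ → X →L[ℂ] Y}
    (hJ : ∀ i x, J (Amp.single i x) = t i x) {A : X →L[ℂ] X} {B : Y →L[ℂ] Y}
    (h : ∀ i, t i ∘L A = B ∘L t i) : J ∘L diag A = B ∘L J := by
  refine Amp.clm_ext fun i x => ?_
  have := congrArg (fun g => g x) (h i)
  simp only [coe_comp, Function.comp_apply] at this
  simp [hJ, this]

/-- The closed span of the ranges of a family of operators. -/
abbrev rangeSpan {ι : Type*} (T : ι → X →L[ℂ] Y) : Submodule ℂ Y :=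
  (Submodule.span ℂ {y | ∃ i x, y = T i x}).topologicalClosure

theorem apply_mem_rangeSpan {ι : Type*} (T : ι → X →L[ℂ] Y) (i : ι) (x : X) :
    T i x ∈ rangeSpan T :=
  Submodule.le_topologicalClosure _ (Submodule.subset_span ⟨i, x, rfl⟩)

theorem rangeSpan_le {ι : Type*} {T : ι → X →L[ℂ] Y} {V : Submodule ℂ Y}
    (hV : IsClosed (V : Set Y)) (h : ∀ i x, T i x ∈ V) : rangeSpan T ≤ V := by
  refine Submodule.topologicalClosure_minimal _ (Submodule.span_le.2 ?_) hV
  rintro _ ⟨i, x, rfl⟩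
  exact h i x

instance {ι : Type*} (T : ι → X →L[ℂ] Y) : CompleteSpace (rangeSpan T) :=
  (Submodule.isClosed_topologicalClosure _).completeSpace_coe

theorem mem_rangeSpan_orthogonal {ι : Type*} {T : ι → X →L[ℂ] Y} {w : Y} :
    w ∈ (rangeSpan T)ᗮ ↔ ∀ i, adjoint (T i) w = 0 := by
  constructor
  · intro hw i
    refine ext_inner_left ℂ fun x => ?_
    rw [adjoint_inner_right, inner_zero_right]
    exact hw _ (apply_mem_rangeSpan T i x)
  · intro h
    rw [Submodule.orthogonal_closure, Submodule.mem_orthogonal]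
    intro u hu
    induction hu using Submodule.span_induction with
    | mem u hu =>
      obtain ⟨i, x, rfl⟩ := hu
      rw [← adjoint_inner_right, h, inner_zero_right]
    | zero => simp
    | add u v _ _ hu hv => rw [inner_add_left, hu, hv, add_zero]
    | smul c u _ hu => rw [inner_smul_left, hu, mul_zero]

theorem mem_rangeSpan_iff {ι : Type*} {T : ι → X →L[ℂ] Y} {u : Y} :
    u ∈ rangeSpan T ↔ ∀ w, (∀ i, adjoint (T i) w = 0) → ⟪w, u⟫_ℂ = 0 := by
  rw [← Submodule.orthogonal_orthogonal (rangeSpan T), Submodule.mem_orthogonal]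
  simp only [mem_rangeSpan_orthogonal]

/-- The comparison tool of the whole proof: a subspace generated by countably many operators from
`X` is equivalent to a subspace of `ℓ²(X)`, equivariantly for everything that the generators
intertwine. -/
theorem exists_amp_partial_isometry (T : ℕ → X →L[ℂ] Y) : ∃ U : Y →L[ℂ] Amp X,
    adjoint U ∘L U = (rangeSpan T).starProjection ∧
    ∀ (A : X →L[ℂ] X) (B : Y →L[ℂ] Y), (∀ i, T i ∘L A = B ∘L T i) →
      (∀ i, T i ∘L adjoint A = adjoint B ∘L T i) → U ∘L B = diag A ∘L U := by
  obtain ⟨U, h1, h2, h3⟩ := exists_amp_embedding T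
  refine ⟨U, ?_, h3⟩
  ext y
  have hy : y = (rangeSpan T).starProjection y + (y - (rangeSpan T).starProjection y) := by abel
  have h4 : U (y - (rangeSpan T).starProjection y) = 0 :=
    h2 _ (mem_rangeSpan_orthogonal.1 (Submodule.sub_starProjection_mem_orthogonal y))
  calc adjoint U (U y) = adjoint U (U ((rangeSpan T).starProjection y)) := by
        conv_lhs => rw [hy, map_add, h4, add_zero]
    _ = _ := h1 _ (Submodule.starProjection_apply_mem (rangeSpan T) y)

/-- Families of operators with the same Gram matrices differ by an isometry. -/
theorem exists_isometry_of_gram {ι Z : Type*} [NormedAddCommGroup Z] [InnerProductSpace ℂ Z]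
    [CompleteSpace Z] {b : ι → X →L[ℂ] Y} {s : ι → X →L[ℂ] Z}
    (h : ∀ i j, adjoint (s i) ∘L s j = adjoint (b i) ∘L b j) (hb : rangeSpan b = ⊤) :
    ∃ S : Y →L[ℂ] Z, (∀ i, S ∘L b i = s i) ∧ adjoint S ∘L S = 1 := by
  let e : (ι →₀ X) →ₗ[ℂ] Y := Finsupp.lsum ℂ fun i => (b i : X →ₗ[ℂ] Y)
  let f : (ι →₀ X) →ₗ[ℂ] Z := Finsupp.lsum ℂ fun i => (s i : X →ₗ[ℂ] Z)
  have he : ∀ i x, e (Finsupp.single i x) = b i x := fun i x => by simp [e]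
  have hf : ∀ i x, f (Finsupp.single i x) = s i x := fun i x => by simp [f]
  have hin : ∀ v w, ⟪f v, f w⟫_ℂ = ⟪e v, e w⟫_ℂ := by
    intro v w
    induction v using Finsupp.induction_linear with
    | zero => simp
    | add v v' h1 h2 => rw [map_add, map_add, inner_add_left, inner_add_left, h1, h2]
    | single i x =>
      induction w using Finsupp.induction_linear with
      | zero => simp
      | add v v' h1 h2 => rw [map_add, map_add, inner_add_right, inner_add_right, h1, h2]
      | single j y =>
        rw [he, he, hf, hf, ← adjoint_inner_right, ← adjoint_inner_right]
        exact congrArg (fun g => ⟪x, g y⟫_ℂ) (h i j)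
  have hdense : DenseRange e := by
    have h1 : Submodule.span ℂ {y | ∃ i x, y = b i x} ≤ LinearMap.range e := by
      rw [Submodule.span_le]
      rintro _ ⟨i, x, rfl⟩
      exact ⟨_, he i x⟩
    have h2 := (Submodule.dense_iff_topologicalClosure_eq_top.2 hb).mono h1
    simpa [DenseRange] using! h2
  have hbd : ∀ v, ‖f v‖ ≤ 1 * ‖e v‖ := by
    intro v
    rw [@norm_eq_sqrt_re_inner ℂ, @norm_eq_sqrt_re_inner ℂ _ _ _ _ (e v), hin, one_mul]
  have hS : ∀ v, f.extendOfNorm e (e v) = f v := LinearMap.extendOfNorm_eq hdense ⟨1, hbd⟩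
  refine ⟨f.extendOfNorm e, fun i => ?_, ?_⟩
  · ext x
    have := hS (Finsupp.single i x)
    rw [he, hf] at this
    exact this
  · ext y
    refine ext_inner_left ℂ fun z => ?_
    rw [coe_comp, Function.comp_apply, adjoint_inner_right]
    change _ = ⟪z, y⟫_ℂ
    refine isClosed_property hdense (p := fun y => ⟪f.extendOfNorm e z, f.extendOfNorm e y⟫_ℂ
      = ⟪z, y⟫_ℂ) (isClosed_eq (by fun_prop) (by fun_prop)) (fun w => ?_) y
    refine isClosed_property hdense (p := fun z => ⟪f.extendOfNorm e z, f.extendOfNorm e (e w)⟫_ℂ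
      = ⟪z, e w⟫_ℂ) (isClosed_eq (by fun_prop) (by fun_prop)) (fun v => ?_) z
    rw [hS, hS, hin]

theorem clm_ext_of_rangeSpan {ι F : Type*} [NormedAddCommGroup F] [NormedSpace ℂ F]
    {b : ι → X →L[ℂ] Y} (hb : rangeSpan b = ⊤) {f g : Y →L[ℂ] F}
    (h : ∀ i, f ∘L b i = g ∘L b i) : f = g := by
  have h1 : rangeSpan b ≤ LinearMap.eqLocus (f : Y →ₗ[ℂ] F) (g : Y →ₗ[ℂ] F) :=
    rangeSpan_le (isClosed_eq f.continuous g.continuous) fun i x =>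
      show f (b i x) = g (b i x) from congrArg (fun k => k x) (h i)
  ext y
  exact h1 (hb ▸ Submodule.mem_top : y ∈ rangeSpan b)

end HilbertSpaceTools

end

/-! ### Double commutants, normal functionals and separable preduals. -/

noncomputable section

set_option linter.unusedSectionVars false

open scoped ComplexOrder InnerProductSpace

namespace VonNeumannAlgebra

open ContinuousLinearMap HilbertSpaceTools

universe u v

variable {H : Type u} [NormedAddCommGroup H] [InnerProductSpace ℂ H] [CompleteSpace H]
variable {K : Type v} [NormedAddCommGroup K] [InnerProductSpace ℂ K] [CompleteSpace K]

/-! ### Membership in a von Neumann algebra -/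

/-- The double commutant theorem, built into the definition of a von Neumann algebra here. It
reduces membership to equivariance under the commutant. -/
theorem mem_of_forall_commutant (M : VonNeumannAlgebra H) {x : H →L[ℂ] H}
    (h : ∀ y ∈ M.commutant, y * x = x * y) : x ∈ M := by
  rw [← commutant_commutant M, mem_commutant_iff]
  exact h

theorem commutant_comm {M : VonNeumannAlgebra H} {x y : H →L[ℂ] H} (hx : x ∈ M)
    (hy : y ∈ M.commutant) : x * y = y * x :=
  mem_commutant_iff.1 hy x hx

theorem adjoint_mem (M : VonNeumannAlgebra H) {x : H →L[ℂ] H} (hx : x ∈ M) : adjoint x ∈ M :=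
  star_mem (s := M) hx

theorem isClosed_coe (M : VonNeumannAlgebra H) : IsClosed (M : Set (H →L[ℂ] H)) := by
  rw [← centralizer_centralizer M]
  exact Set.isClosed_centralizer _

scoped instance (M : VonNeumannAlgebra H) : IsClosed (M.toStarSubalgebra : Set (H →L[ℂ] H)) :=
  M.isClosed_coe

/-- `‖a‖² - a* a` is of the form `d* d`. -/
theorem exists_defect (M : VonNeumannAlgebra H) {a : H →L[ℂ] H} (ha : a ∈ M) :
    ∃ d ∈ M, star d * d = algebraMap ℝ (H →L[ℂ] H) (‖a‖ ^ 2) - star a * a := by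
  set S := algebraMap ℝ (H →L[ℂ] H) (‖a‖ ^ 2) - star a * a with hS
  have h0 : 0 ≤ S := by
    have := IsSelfAdjoint.le_algebraMap_norm_self (a := star a * a) (IsSelfAdjoint.star_mul_self a)
    rw [CStarRing.norm_star_mul_self, ← pow_two] at this
    exact sub_nonneg.2 this
  refine ⟨CFC.sqrt S, ?_, ?_⟩
  · refine mem_of_forall_commutant M fun y hy => ?_
    have h1 : Commute S y := by
      refine Commute.sub_left (Algebra.commutes _ _) ?_
      exact commutant_comm (mul_mem (star_mem ha) ha) hy
    exact (h1.cfcₙ_nnreal _).eq.symm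
  · rw [(CFC.sqrt_nonneg S).isSelfAdjoint.star_eq, CFC.sqrt_mul_sqrt_self S h0]

/-! ### Normal functionals -/

theorem IsNormalFunctional.of_countable {M : VonNeumannAlgebra H} {ι : Type*} [Countable ι]
    [Infinite ι] {φ : M.Elem → ℂ} (ξ η : ι → H) (hξ : Summable fun i => ‖ξ i‖ ^ 2)
    (hη : Summable fun i => ‖η i‖ ^ 2)
    (h : ∀ a : M.Elem, HasSum (fun i => ⟪η i, (a : H →L[ℂ] H) (ξ i)⟫_ℂ) (φ a)) :
    M.IsNormalFunctional φ := by
  obtain ⟨e⟩ := nonempty_equiv_of_countable (α := ℕ) (β := ι)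
  exact ⟨ξ ∘ e, η ∘ e, (e.summable_iff (f := fun i => ‖ξ i‖ ^ 2)).2 hξ,
    (e.summable_iff (f := fun i => ‖η i‖ ^ 2)).2 hη,
    fun a => (e.hasSum_iff (f := fun i => ⟪η i, (a : H →L[ℂ] H) (ξ i)⟫_ℂ)).2 (h a)⟩

/-- Normal functionals are the vector coefficients of the amplified identity representation. This is
the link between normality and intertwining operators. -/
theorem isNormalFunctional_iff {M : VonNeumannAlgebra H} {φ : M.Elem → ℂ} :
    M.IsNormalFunctional φ ↔
      ∃ x y : Amp H, ∀ a : M.Elem, φ a = ⟪y, diag (a : H →L[ℂ] H) x⟫_ℂ := by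
  constructor
  · rintro ⟨ξ, η, hξ, hη, h⟩
    exact ⟨Amp.mk ξ hξ, Amp.mk η hη, fun a => (h a).unique (lp.hasSum_inner _ _)⟩
  · rintro ⟨x, y, h⟩
    refine ⟨fun i => x i, fun i => y i, Amp.summable_sq x, Amp.summable_sq y, fun a => ?_⟩
    rw [h a]
    exact lp.hasSum_inner y (diag (a : H →L[ℂ] H) x)

theorem diag_add (A B : H →L[ℂ] H) : diag (A + B) = diag A + diag B := by
  ext f i; simp

theorem diag_smul (c : ℂ) (A : H →L[ℂ] H) : diag (c • A) = c • diag A := by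
  ext f i; simp

theorem norm_diag_le (A : H →L[ℂ] H) : ‖diag A‖ ≤ ‖A‖ :=
  LinearMap.mkContinuous_norm_le _ (norm_nonneg _) _

/-- A normal functional as an element of the dual. -/
theorem IsNormalFunctional.exists_strongDual {M : VonNeumannAlgebra H} {φ : M.Elem → ℂ}
    (h : M.IsNormalFunctional φ) : ∃ f : StrongDual ℂ M.Elem, ∀ a, f a = φ a := by
  obtain ⟨x, y, hxy⟩ := isNormalFunctional_iff.1 h
  refine ⟨LinearMap.mkContinuous
    { toFun := φ
      map_add' := fun a b => by simp [hxy, diag_add]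
      map_smul' := fun c a => by simp [hxy, diag_smul] } (‖y‖ * ‖x‖)
    fun a => ?_, fun a => rfl⟩
  show ‖φ a‖ ≤ _
  rw [hxy]
  refine (norm_inner_le_norm _ _).trans ?_
  have h1 := (diag (a : H →L[ℂ] H)).le_of_opNorm_le (norm_diag_le _) x
  have h2 : ‖(a : H →L[ℂ] H)‖ = ‖a‖ := rfl
  rw [h2] at h1
  calc ‖y‖ * ‖diag (a : H →L[ℂ] H) x‖ ≤ ‖y‖ * (‖a‖ * ‖x‖) := by gcongr
    _ = ‖y‖ * ‖x‖ * ‖a‖ := by ring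

theorem IsNormalFunctional.sub {M : VonNeumannAlgebra H} {φ ψ : M.Elem → ℂ}
    (hφ : M.IsNormalFunctional φ) (hψ : M.IsNormalFunctional ψ) :
    M.IsNormalFunctional fun a => φ a - ψ a := by
  obtain ⟨ξ, η, hξ, hη, h⟩ := hφ
  obtain ⟨ξ', η', hξ', hη', h'⟩ := hψ
  refine IsNormalFunctional.of_countable (ι := ℕ ⊕ ℕ) (Sum.elim ξ ξ') (Sum.elim η (-η')) ?_ ?_ ?_
  · exact Summable.sum _ hξ hξ'
  · refine Summable.sum _ hη ?_
    simpa [Function.comp_def] using hη'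
  · intro a
    rw [sub_eq_add_neg]
    refine HasSum.sum (h a) ?_
    simpa [Function.comp_def] using (h' a).neg

theorem isNormalFunctional_inner (M : VonNeumannAlgebra H) (ξ η : H) :
    M.IsNormalFunctional fun a => ⟪η, (a : H →L[ℂ] H) ξ⟫_ℂ := by
  rw [isNormalFunctional_iff]
  refine ⟨Amp.single 0 ξ, Amp.single 0 η, fun a => ?_⟩
  rw [diag_single, lp.inner_single_left]
  simp

/-- A countable set which separates the normal functionals. -/
theorem HasSeparablePredual.exists_seq {M : VonNeumannAlgebra H} (hM : M.HasSeparablePredual) :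
    ∃ d : ℕ → M.Elem, ∀ φ : M.Elem → ℂ, M.IsNormalFunctional φ → (∀ n, φ (d n) = 0) →
      ∀ a, φ a = 0 := by
  obtain ⟨c, hc, hMc⟩ := hM
  have h0 : (0 : StrongDual ℂ M.Elem) ∈ M.predual :=
    ⟨0, 0, by simp [summable_zero], by simp [summable_zero], fun a => by simpa using hasSum_zero⟩
  have hne : c.Nonempty := closure_nonempty_iff.1 ⟨0, hMc h0⟩
  obtain ⟨f, rfl⟩ := hc.exists_eq_range hne
  -- `d n` is a contraction on which `f n` attains half of its norm. If `g` vanishes on every `d n`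
  -- and `‖g - f n‖ < ε / 3`, then `‖f n‖ ≤ 2ε / 3`, whence `‖g‖ ≤ ε`.
  have hd : ∀ n, ∃ a : M.Elem, ‖a‖ ≤ 1 ∧ ‖f n‖ / 2 ≤ ‖f n a‖ := by
    intro n
    rcases eq_or_ne (f n) 0 with h | h
    · exact ⟨0, by simp, by simp [h]⟩
    · obtain ⟨x, hx1, hx2⟩ := (f n).exists_lt_apply_of_lt_opNorm (half_lt_self (norm_pos_iff.2 h))
      exact ⟨x, hx1.le, hx2.le⟩
  choose d hd1 hd2 using hd
  refine ⟨d, fun φ hφ h0 a => ?_⟩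
  obtain ⟨g, hg⟩ := hφ.exists_strongDual
  have hgp : g ∈ M.predual := by
    have : (g : M.Elem → ℂ) = φ := funext hg
    show M.IsNormalFunctional g
    rw [this]; exact hφ
  have hg0 : g = 0 := by
    rw [← norm_eq_zero]
    refine le_antisymm (le_of_forall_pos_le_add fun ε hε => ?_) (norm_nonneg _)
    obtain ⟨_, ⟨n, rfl⟩, hn⟩ := Metric.mem_closure_iff.1 (hMc hgp) (ε / 3) (by positivity)
    rw [dist_eq_norm] at hn
    have h1 : ‖f n (d n)‖ ≤ ε / 3 := by
      have h2 : f n (d n) = -((g - f n) (d n)) := by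
        have : g (d n) = 0 := by rw [hg, h0]
        simp [this]
      rw [h2, norm_neg]
      calc _ ≤ ‖g - f n‖ * ‖d n‖ := (g - f n).le_opNorm _
        _ ≤ ε / 3 * 1 := by gcongr; exact hd1 n
        _ = ε / 3 := mul_one _
    have h3 : ‖g‖ ≤ ‖g - f n‖ + ‖f n‖ := by simpa using norm_add_le (g - f n) (f n)
    have := hd2 n
    linarith
  rw [← hg, hg0]; rfl

end VonNeumannAlgebra

end

/-! ### Isometries with orthogonal ranges in a properly infinite algebra. -/

noncomputable section

set_option linter.unusedSectionVars false

open scoped ComplexOrder InnerProductSpace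

namespace VonNeumannAlgebra

open ContinuousLinearMap HilbertSpaceTools

universe u v

variable {H : Type u} [NormedAddCommGroup H] [InnerProductSpace ℂ H] [CompleteSpace H]
variable {K : Type v} [NormedAddCommGroup K] [InnerProductSpace ℂ K] [CompleteSpace K]

theorem starProjection_mem (N : VonNeumannAlgebra K) (G : Submodule ℂ K) [G.HasOrthogonalProjection]
    (h : ∀ y ∈ N.commutant, ∀ g ∈ G, y g ∈ G) : G.starProjection ∈ N := by
  rw [IsStarProjection.mem_iff isStarProjection_starProjection]
  intro y hy
  rw [Submodule.range_starProjection]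
  exact fun g hg => h y hy g hg

/-- `z` is a central projection of `N` for which two copies of `zK` embed into `zK`. -/
structure IsDoubling (N : VonNeumannAlgebra K) (z : K →L[ℂ] K) : Prop where
  mem : z ∈ N
  mem_commutant : z ∈ N.commutant
  isStarProjection : IsStarProjection z
  exists_isometries : ∃ s ∈ N, ∃ t ∈ N, star s * s = z ∧ star t * t = z ∧ star s * t = 0

section Shift

variable {N : VonNeumannAlgebra K} {y v : K →L[ℂ] K}

theorem mul_eq_self_of_star_mul_self (hy : IsStarProjection y) (hv : star v * v = y) :
    v * y = v := by
  have h : star (v - v * y) * (v - v * y) = 0 := by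
    have h1 : star (v - v * y) * (v - v * y) = star v * v - star v * v * y - star y * (star v * v)
        + star y * (star v * v) * y := by
      rw [star_sub, star_mul]; noncomm_ring
    rw [h1, hv, hy.isSelfAdjoint.star_eq, hy.isIdempotentElem.eq, hy.isIdempotentElem.eq]
    abel
  exact (sub_eq_zero.1 (CStarRing.star_mul_self_eq_zero_iff _ |>.1 h)).symm

/-- The powers of a nonunitary isometry move its defect projection to orthogonal positions. -/
theorem star_pow_mul_pow_defect (hy : IsStarProjection y) (hv : star v * v = y) (hyv : y * v = v)
    (m n : ℕ) : star (v ^ m * (y - v * star v)) * (v ^ n * (y - v * star v)) =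
      if m = n then y - v * star v else 0 := by
  set e := y - v * star v with he
  have hvy := mul_eq_self_of_star_mul_self hy hv
  have hys := hy.isSelfAdjoint.star_eq
  have hyy := hy.isIdempotentElem.eq
  have hsvy : star v * y = star v := by
    have := congrArg star hyv; rwa [star_mul, hys] at this
  have hes : star e = e := by simp [he, hys]
  have hee : e * e = e := by
    have : e * e = y * y - y * v * star v - v * (star v * y) + v * (star v * v) * star v := by
      rw [he]; noncomm_ring
    rw [this, hyy, hyv, hsvy, hv, hvy, he]; abel
  have hye : y * e = e := by rw [he, mul_sub, hyy, ← mul_assoc, hyv]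
  have hev : e * v = 0 := by rw [he, sub_mul, hyv, mul_assoc, hv, hvy, sub_self]
  have hyn : ∀ n, y * (v ^ n * e) = v ^ n * e := fun n => by
    cases n with
    | zero => simpa using hye
    | succ n => rw [pow_succ', mul_assoc, ← mul_assoc, hyv]
  have key : ∀ m k, star (v ^ m) * (v ^ (m + k) * e) = v ^ k * e := by
    intro m k
    induction m with
    | zero => simp
    | succ m ih =>
      have h1 : v ^ (m + 1 + k) * e = v * (v ^ (m + k) * e) := by
        rw [show m + 1 + k = (m + k) + 1 by ring, pow_succ', mul_assoc]
      rw [h1, pow_succ', star_mul, mul_assoc, ← mul_assoc (star v), hv, hyn, ih]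
  have main : ∀ m n, m ≤ n → star (v ^ m * e) * (v ^ n * e) = if m = n then e else 0 := by
    intro m n hmn
    obtain ⟨k, rfl⟩ := Nat.exists_eq_add_of_le hmn
    rw [star_mul, mul_assoc, key, hes]
    cases k with
    | zero => simp [hee]
    | succ k => rw [pow_succ', mul_assoc, ← mul_assoc, hev]; simp
  rcases le_total m n with h | h
  · exact main m n h
  · have := congrArg star (main n m h)
    rw [star_mul, star_star] at this
    rw [this]
    simp only [eq_comm (a := n)]
    split_ifs <;> simp [hes]

end Shift

/-- A nonfinite central projection dominates a nonzero doubling central projection. -/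
theorem exists_isDoubling_le {N : VonNeumannAlgebra K} (hN : N.HasSeparablePredual)
    {y v : K →L[ℂ] K} (hyN : y ∈ N) (hyN' : y ∈ N.commutant) (hy : IsStarProjection y)
    (hvN : v ∈ N) (hv : star v * v = y) (hyv : y * v = v) (hne : v * star v ≠ y) :
    ∃ z, N.IsDoubling z ∧ z ≠ 0 ∧ y * z = z := by
  obtain ⟨d, hd⟩ := hN.exists_seq
  set e := y - v * star v with he
  have hpow := star_pow_mul_pow_defect hy hv hyv
  simp only [← he] at hpow
  have heN : e ∈ N := sub_mem hyN (mul_mem hvN (star_mem hvN))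
  have hee : star e * e = e := by simpa using hpow 0 0
  have hes : star e = e := by rw [← hee]; simp
  have he0 : e ≠ 0 := fun h => hne (sub_eq_zero.1 h).symm
  have hye : y * e = e := by
    rw [he, mul_sub, hy.isIdempotentElem.eq, ← mul_assoc, hyv]
  -- The closed span of the ranges of `d i * e` is the closure of `N e K`, since vector functionals
  -- are normal and `d` separates normal functionals. Its projection `z` is the central support of
  -- `e`.
  let T : ℕ → K →L[ℂ] K := fun i => (d i : K →L[ℂ] K) * e
  have hTN : ∀ i, T i ∈ N := fun i => mul_mem (d i).2 heN
  have hG : ∀ a ∈ N, ∀ x, a (e x) ∈ rangeSpan T := by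
    intro a ha x
    rw [mem_rangeSpan_iff]
    intro w hw
    refine hd (fun a => ⟪w, (a : K →L[ℂ] K) (e x)⟫_ℂ) (isNormalFunctional_inner N _ _)
      (fun n => ?_) ⟨a, ha⟩
    have : ⟪w, T n x⟫_ℂ = 0 := by rw [← adjoint_inner_left, hw, inner_zero_left]
    exact this
  have hinv : ∀ a : K →L[ℂ] K, (a ∈ N ∨ a ∈ N.commutant) → ∀ g ∈ rangeSpan T, a g ∈ rangeSpan T := by
    intro a ha g hg
    have : rangeSpan T ≤ (rangeSpan T).comap (a : K →ₗ[ℂ] K) := by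
      refine rangeSpan_le ?_ fun i x => ?_
      · exact IsClosed.preimage a.continuous (Submodule.isClosed_topologicalClosure _)
      · rcases ha with ha | ha
        · exact hG (a * d i) (mul_mem ha (d i).2) x
        · have h1 : a * T i = T i * a := (commutant_comm (hTN i) ha).symm
          have h2 : a (T i x) = T i (a x) := congrArg (fun g => g x) h1
          show a (T i x) ∈ rangeSpan T
          rw [h2]
          exact apply_mem_rangeSpan T i _
    exact this hg
  obtain ⟨U, hU, hUe⟩ := exists_amp_partial_isometry T
  set z := (rangeSpan T).starProjection with hz
  have hzN : z ∈ N := starProjection_mem N _ fun a ha => hinv a (Or.inr ha)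
  -- The span is invariant under both `N` and its commutant, so `z` is central.
  have hzN' : z ∈ N.commutant := starProjection_mem _ _ fun a ha =>
    hinv a (Or.inl (by rwa [commutant_commutant] at ha))
  have hUcomm : ∀ a ∈ N.commutant, U ∘L a = diag a ∘L U := fun a ha =>
    hUe a a (fun i => commutant_comm (hTN i) ha)
      (fun i => commutant_comm (hTN i) (adjoint_mem _ ha))
  have hdU : diag e ∘L U = U := by
    have := hUe e 1 (fun i => ?_) (fun i => ?_)
    · rw [← this]; rfl
    · show T i * e = T i
      simp only [T]
      rw [mul_assoc]
      nth_rewrite 1 [← hes]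
      rw [hee]
    · rw [← star_eq_adjoint, ← star_eq_adjoint, hes, star_one]
      show T i * e = T i
      simp only [T]
      rw [mul_assoc]
      nth_rewrite 1 [← hes]
      rw [hee]
  have htnorm : ∀ n, ‖v ^ n * e‖ ≤ 1 := by
    intro n
    have h1 : ‖v ^ n * e‖ * ‖v ^ n * e‖ = ‖e‖ := by
      rw [← CStarRing.norm_star_mul_self, hpow]; simp
    have h2 : ‖e‖ * ‖e‖ = ‖e‖ := by
      rw [← CStarRing.norm_star_mul_self, hee]
    have h3 : ‖e‖ ≤ 1 := by
      by_contra! h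
      nlinarith
    by_contra! h
    nlinarith
  have hort : ∀ (p : ℕ → ℕ), p.Injective → ∀ i j,
      adjoint (v ^ p i * e) ∘L (v ^ p j * e) = if i = j then e else 0 := by
    intro p hp i j
    have := hpow (p i) (p j)
    simp only [hp.eq_iff] at this
    exact this
  have hrow : ∀ (p : ℕ → ℕ), p.Injective → ∃ J : Amp K →L[ℂ] K,
      (∀ i x, J (Amp.single i x) = (v ^ p i * e) x) := by
    intro p hp
    obtain ⟨J, hJ, -⟩ := exists_row (fun i => v ^ p i * e) (fun i => htnorm _)
      (fun i j hij => by rw [hort p hp, if_neg hij])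
    exact ⟨J, hJ⟩
  -- `U` embeds `z K` into `ℓ²(e K)`. The rows made of the even and of the odd powers of `v` put
  -- `ℓ²(e K)` back into `K` in two orthogonal ways, which doubles `z`.
  have hp0 : Function.Injective fun n : ℕ => 2 * n := fun a b h => by simpa using h
  have hp1 : Function.Injective fun n : ℕ => 2 * n + 1 := fun a b h => by simpa using h
  obtain ⟨J, hJ⟩ := hrow _ hp0
  obtain ⟨J', hJ'⟩ := hrow _ hp1
  have hmem : ∀ (p : ℕ → ℕ) (J : Amp K →L[ℂ] K), (∀ i x, J (Amp.single i x) = (v ^ p i * e) x) →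
      J ∘L U ∈ N := by
    intro p J hJ
    refine mem_of_forall_commutant N fun a ha => ?_
    have h1 : J ∘L diag a = a ∘L J := row_comp_diag hJ fun i =>
      commutant_comm (mul_mem (pow_mem hvN _) heN) ha
    show a ∘L (J ∘L U) = (J ∘L U) ∘L a
    rw [← comp_assoc, ← h1, comp_assoc, ← hUcomm a ha, comp_assoc]
  have hss : ∀ (p : ℕ → ℕ), p.Injective → ∀ (J : Amp K →L[ℂ] K),
      (∀ i x, J (Amp.single i x) = (v ^ p i * e) x) → star (J ∘L U) * (J ∘L U) = z := by
    intro p hp J hJ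
    have h1 : adjoint J ∘L J = diag e := row_adjoint_comp_row hJ hJ e (hort p hp)
    show adjoint (J ∘L U) ∘L (J ∘L U) = z
    rw [adjoint_comp, comp_assoc, ← comp_assoc (adjoint J), h1, hdU, hU]
  refine ⟨z, ⟨hzN, hzN', isStarProjection_starProjection, J ∘L U, hmem _ J hJ, J' ∘L U,
    hmem _ J' hJ', hss _ hp0 J hJ, hss _ hp1 J' hJ', ?_⟩, ?_, ?_⟩
  · have h1 : adjoint J ∘L J' = diag 0 := row_adjoint_comp_row hJ hJ' 0 fun i j => by
      rw [ite_self]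
      have := hpow (2 * i) (2 * j + 1)
      rw [if_neg (by omega)] at this
      exact this
    have h2 : diag (0 : K →L[ℂ] K) = 0 := by ext f i; simp
    show adjoint (J ∘L U) ∘L (J' ∘L U) = 0
    rw [adjoint_comp, comp_assoc, ← comp_assoc (adjoint J), h1, h2]
    simp
  · intro h0
    apply he0
    ext x
    have h1 : z (e x) = e x := Submodule.starProjection_eq_self_iff.2 (hG 1 (one_mem N) x)
    rw [← h1, h0]; rfl
  · ext x
    have h1 : rangeSpan T ≤ LinearMap.eqLocus (y : K →ₗ[ℂ] K) LinearMap.id := by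
      refine rangeSpan_le (isClosed_eq y.continuous continuous_id) fun i x => ?_
      show y (T i x) = T i x
      have : y * T i = T i := by
        simp only [T]
        rw [← mul_assoc, ← commutant_comm (d i).2 hyN', mul_assoc, hye]
      exact congrArg (fun g => g x) this
    exact h1 (Submodule.starProjection_apply_mem _ x)

/-- Take a maximal orthogonal family of nonzero doubling central projections. If its supremum were
not `1`, the complement would be a nonzero, hence nonfinite, central projection and would dominate a
further doubling one. The partial isometries over the members of the family then glue, being carried
by orthogonal central projections. -/
theorem exists_isometry_pair {N : VonNeumannAlgebra K} (hN : N.HasSeparablePredual)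
    (hinf : N.IsProperlyInfinite) :
    ∃ s ∈ N, ∃ t ∈ N, star s * s = 1 ∧ star t * t = 1 ∧ star s * t = 0 := by
  let 𝒮 : Set (Set (K →L[ℂ] K)) :=
    {B | (∀ z ∈ B, N.IsDoubling z ∧ z ≠ 0) ∧ B.Pairwise fun z z' => z * z' = 0}
  obtain ⟨B, hB⟩ : ∃ B, Maximal (· ∈ 𝒮) B := by
    refine zorn_subset 𝒮 fun c hc hchain => ⟨⋃₀ c, ⟨?_, ?_⟩, fun s hs => Set.subset_sUnion_of_mem hs⟩
    · rintro z ⟨s, hs, hz⟩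
      exact (hc hs).1 z hz
    · rw [Set.pairwise_sUnion hchain.directedOn]
      exact fun s hs => (hc hs).2
  have hB1 := hB.prop.1
  have hB2 := hB.prop.2
  let b : B → K →L[ℂ] K := fun z => z
  have hb : ∀ z : B, N.IsDoubling (b z) := fun z => (hB1 z z.2).1
  have hbs : ∀ z : B, star (b z) = b z := fun z => (hb z).isStarProjection.isSelfAdjoint.star_eq
  have hbb : ∀ z : B, b z * b z = b z := fun z => (hb z).isStarProjection.isIdempotentElem.eq
  have hbcomm : ∀ a : K →L[ℂ] K, (a ∈ N ∨ a ∈ N.commutant) → ∀ z, a * b z = b z * a := by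
    intro a ha z
    rcases ha with ha | ha
    · exact commutant_comm ha (hb z).mem_commutant
    · exact (commutant_comm (hb z).mem ha).symm
  have hG : rangeSpan b = ⊤ := by
    by_contra hne
    have hinv : ∀ a : K →L[ℂ] K, (a ∈ N ∨ a ∈ N.commutant) →
        ∀ g ∈ rangeSpan b, a g ∈ rangeSpan b := by
      intro a ha g hg
      have : rangeSpan b ≤ (rangeSpan b).comap (a : K →ₗ[ℂ] K) := by
        refine rangeSpan_le ?_ fun z x => ?_
        · exact IsClosed.preimage a.continuous (Submodule.isClosed_topologicalClosure _)
        · have h2 : a (b z x) = b z (a x) := congrArg (fun g => g x) (hbcomm a ha z)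
          show a (b z x) ∈ rangeSpan b
          rw [h2]
          exact apply_mem_rangeSpan b z _
      exact this hg
    set p := (rangeSpan b).starProjection with hp
    have hpN : p ∈ N := starProjection_mem N _ fun a ha => hinv a (Or.inr ha)
    have hpN' : p ∈ N.commutant := starProjection_mem _ _ fun a ha =>
      hinv a (Or.inl (by rwa [commutant_commutant] at ha))
    have hps : IsStarProjection p := isStarProjection_starProjection
    have hy : IsStarProjection (1 - p) := hps.one_sub
    have hyN : 1 - p ∈ N := sub_mem (one_mem N) hpN
    have hyN' : 1 - p ∈ N.commutant := sub_mem (one_mem _) hpN'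
    have hpb : ∀ z : B, (1 - p) * b z = 0 := by
      intro z
      ext x
      have : p (b z x) = b z x := Submodule.starProjection_eq_self_iff.2 (apply_mem_rangeSpan b z x)
      show b z x - p (b z x) = 0
      rw [this, sub_self]
    have hy0 : 1 - p ≠ 0 := by
      intro h0
      apply hne
      rw [eq_top_iff]
      intro x _
      have h1 : p x = x := by
        rw [← sub_eq_zero.1 h0]; rfl
      exact Submodule.starProjection_eq_self_iff.1 h1
    have hnf := mt (hinf ⟨1 - p, hyN⟩
      ⟨Subtype.ext hy.isIdempotentElem.eq, Subtype.ext hy.isSelfAdjoint.star_eq⟩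
      (fun a => Subtype.ext (commutant_comm a.2 hyN').symm))
      (fun h => hy0 (congrArg Subtype.val h))
    simp only [IsFiniteProjection, not_forall] at hnf
    obtain ⟨⟨v, hvN⟩, h1, h2, h3⟩ := hnf
    replace h1 : star v * v = 1 - p := congrArg Subtype.val h1
    replace h2 : (1 - p) * (v * star v) = v * star v := congrArg Subtype.val h2
    replace h3 : v * star v ≠ 1 - p := fun h => h3 (Subtype.ext h)
    have hvy := mul_eq_self_of_star_mul_self hy h1
    have hyv : (1 - p) * v = v := by
      calc (1 - p) * v = (1 - p) * (v * (1 - p)) := by rw [hvy]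
        _ = (1 - p) * (v * star v) * v := by rw [← h1]; noncomm_ring
        _ = v * (star v * v) := by rw [h2, mul_assoc]
        _ = v := by rw [h1, hvy]
    obtain ⟨z, hz, hz0, hyz⟩ := exists_isDoubling_le hN hyN hyN' hy hvN h1 hyv h3
    have hzb : ∀ w : B, z * b w = 0 := by
      intro w
      rw [← hyz, mul_assoc, hbcomm z (Or.inl hz.mem), ← mul_assoc, hpb, zero_mul]
    have hzB : z ∈ B := by
      have : insert z B ∈ 𝒮 := by
        refine ⟨?_, ?_⟩
        · rintro w (rfl | hw)
          · exact ⟨hz, hz0⟩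
          · exact hB1 w hw
        · refine hB2.insert fun w hw _ => ⟨hzb ⟨w, hw⟩, ?_⟩
          have := hbcomm z (Or.inl hz.mem) ⟨w, hw⟩
          rw [hzb ⟨w, hw⟩] at this
          exact this.symm
      exact hB.le_of_ge this (Set.subset_insert z B) (Set.mem_insert z B)
    apply hz0
    rw [← hz.isStarProjection.isIdempotentElem.eq]
    exact hzb ⟨z, hzB⟩
  choose s hsN t htN hss htt hst using fun z => (hb z).exists_isometries
  -- For `i ≠ j` the central projections `b i` and `b j` can be moved next to each other inside
  -- `star (s i) * s j`, where their product vanishes. So the `s z` have the Gram matrix of the `b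
  -- z` and extend to one isometry.
  have hgram : ∀ (s : B → K →L[ℂ] K), (∀ z, s z ∈ N) → (∀ z, star (s z) * s z = b z) →
      ∀ i j, adjoint (s i) ∘L s j = adjoint (b i) ∘L b j := by
    intro s hsN hss i j
    show star (s i) * s j = star (b i) * b j
    rcases eq_or_ne i j with rfl | hij
    · rw [hss, hbs, hbb]
    · have h0 : b i * b j = 0 := hB2 i.2 j.2 (fun h => hij (Subtype.ext h))
      have h1 : ∀ z, s z * b z = s z := fun z =>
        mul_eq_self_of_star_mul_self (hb z).isStarProjection (hss z)
      rw [hbs, h0]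
      have h2 : star (s i) = b i * star (s i) := by
        have := congrArg star (h1 i)
        rw [star_mul, hbs] at this
        exact this.symm
      rw [h2, mul_assoc, ← h1 j, hbcomm _ (Or.inl (hsN j)), ← mul_assoc (star (s i)),
        hbcomm _ (Or.inl (star_mem (hsN i))), mul_assoc, ← mul_assoc, h0, zero_mul]
  have hglue : ∀ (s : B → K →L[ℂ] K), (∀ z, s z ∈ N) → (∀ z, star (s z) * s z = b z) →
      ∃ S ∈ N, star S * S = 1 ∧ ∀ z, S * b z = s z := by
    intro s hsN hss
    obtain ⟨S, hS1, hS2⟩ := exists_isometry_of_gram (hgram s hsN hss) hG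
    refine ⟨S, mem_of_forall_commutant N fun a ha => ?_, hS2, hS1⟩
    refine clm_ext_of_rangeSpan hG fun z => ?_
    show a * S * b z = S * a * b z
    have h1 : S * b z = s z := hS1 z
    rw [mul_assoc, mul_assoc, h1, hbcomm a (Or.inr ha), ← mul_assoc, h1,
      commutant_comm (hsN z) ha]
  obtain ⟨S, hSN, hS, hSb⟩ := hglue s hsN hss
  obtain ⟨T, hTN, hT, hTb⟩ := hglue t htN htt
  refine ⟨S, hSN, T, hTN, hS, hT, ?_⟩
  have h0 : ∀ j, star S * t j = 0 := by
    intro j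
    have h1 : star (t j) * S = 0 := by
      refine clm_ext_of_rangeSpan hG fun i => ?_
      show star (t j) * S * b i = 0 * b i
      rw [zero_mul, mul_assoc, hSb]
      rcases eq_or_ne i j with rfl | hij
      · have := congrArg star (hst i)
        simpa using this
      · have h1 := mul_eq_self_of_star_mul_self (hb j).isStarProjection (htt j)
        have h2 := mul_eq_self_of_star_mul_self (hb i).isStarProjection (hss i)
        have h0 : b j * b i = 0 := hB2 j.2 i.2 (fun h => hij (Subtype.ext h).symm)
        rw [← h1, ← h2, star_mul, hbs, mul_assoc, hbcomm _ (Or.inl (hsN i)),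
          ← mul_assoc (star (t j)), hbcomm _ (Or.inl (star_mem (htN j))), mul_assoc, ← mul_assoc,
          h0, zero_mul]
    have := congrArg star h1
    simpa using this
  refine clm_ext_of_rangeSpan hG fun j => ?_
  show star S * T * b j = 0 * b j
  rw [zero_mul, mul_assoc, hTb, h0]

/-- A properly infinite von Neumann algebra with separable predual contains a sequence of
isometries with mutually orthogonal ranges. -/
theorem exists_isometry_seq {N : VonNeumannAlgebra K} (hN : N.HasSeparablePredual)
    (hinf : N.IsProperlyInfinite) :
    ∃ s : ℕ → K →L[ℂ] K, (∀ n, s n ∈ N) ∧ ∀ i j, star (s i) * s j = if i = j then 1 else 0 := by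
  obtain ⟨s, hs, t, ht, hss, htt, hst⟩ := exists_isometry_pair hN hinf
  have hts : star t * s = 0 := by
    have := congrArg star hst
    simpa using this
  have key : ∀ m k, star (t ^ m) * t ^ (m + k) = t ^ k := by
    intro m k
    induction m with
    | zero => simp
    | succ m ih =>
      rw [show m + 1 + k = (m + k) + 1 by ring, pow_succ', pow_succ', star_mul, mul_assoc,
        ← mul_assoc (star t), htt, one_mul, ih]
  have main : ∀ m n, m ≤ n → star (t ^ m * s) * (t ^ n * s) = if m = n then 1 else 0 := by
    intro m n hmn
    obtain ⟨k, rfl⟩ := Nat.exists_eq_add_of_le hmn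
    rw [star_mul, mul_assoc, ← mul_assoc (star (t ^ m)), key]
    cases k with
    | zero => simp [hss]
    | succ k => rw [pow_succ', mul_assoc, ← mul_assoc, hst]; simp
  -- After cancelling the common power of `t`, a factor `star s * t` or its adjoint remains, and it
  -- is zero.
  refine ⟨fun n => t ^ n * s, fun n => mul_mem (pow_mem ht n) hs, fun i j => ?_⟩
  rcases le_total i j with h | h
  · exact main i j h
  · have := congrArg star (main j i h)
    rw [star_mul, star_star] at this
    rw [this]
    simp only [eq_comm (a := j)]
    split_ifs <;> simp

end VonNeumannAlgebra

end

noncomputable section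

set_option linter.unusedSectionVars false

open scoped ComplexOrder InnerProductSpace

namespace VonNeumannAlgebra

open ContinuousLinearMap HilbertSpaceTools

universe u v

variable {H : Type u} [NormedAddCommGroup H] [InnerProductSpace ℂ H] [CompleteSpace H]
variable {K : Type v} [NormedAddCommGroup K] [InnerProductSpace ℂ K] [CompleteSpace K]

/-! ### Contractive projections onto a von Neumann algebra -/

/-- A contractive projection onto `N` commutes with left multiplication by projections of `N`. -/
theorem map_projection_mul (N : VonNeumannAlgebra K) (E : (K →L[ℂ] K) →ₗ[ℝ] (K →L[ℂ] K))
    (hE : ∀ x, ‖E x‖ ≤ ‖x‖) (hEN : ∀ x, E x ∈ N) (hfix : ∀ x ∈ N, E x = x) {p : K →L[ℂ] K}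
    (hp : IsStarProjection p) (hpN : p ∈ N) (x : K →L[ℂ] K) : E (p * x) = p * E x := by
  have key : ∀ p : K →L[ℂ] K, IsStarProjection p → p ∈ N → ∀ x, (1 - p) * E (p * x) = 0 := by
    intro p hp hpN x
    have hp1 := hp.one_sub
    set c := (1 - p) * E (p * x) with hc
    have hcN : c ∈ N := mul_mem (sub_mem (one_mem N) hpN) (hEN _)
    have hpc : (1 - p) * c = c := by rw [hc, ← mul_assoc, hp1.isIdempotentElem.eq]
    have hpc0 : p * c = 0 := by
      rw [hc, ← mul_assoc, mul_sub, mul_one, hp.isIdempotentElem.eq, sub_self, zero_mul]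
    have hcp0 : star c * p = 0 := by
      have := congrArg star hpc0
      rwa [star_mul, hp.isSelfAdjoint.star_eq, star_zero] at this
    have hn1 : ‖1 - p‖ ≤ 1 := by
      have h1 : ‖1 - p‖ * ‖1 - p‖ = ‖1 - p‖ := by
        rw [← CStarRing.norm_star_mul_self, hp1.isSelfAdjoint.star_eq, hp1.isIdempotentElem.eq]
      by_contra! h
      nlinarith
    -- Tomiyama's trick. Adding `l • c` to `p * x` raises the squared norm by at most `l² ‖c‖²`, as
    -- the ranges are orthogonal, while `(1 - p) E` sends the sum to `(1 + l) • c`. The quadratic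
    -- terms cancel, and a large `l` forces `c = 0`.
    have main : ∀ l : ℝ, (1 + 2 * l) * ‖c‖ ^ 2 ≤ ‖p * x‖ ^ 2 := by
      intro l
      set w := p * x + l • c with hw
      have h1 : star w * w = star (p * x) * (p * x) + (l ^ 2) • (star c * c) := by
        have e1 : star (p * x) * c = 0 := by
          rw [star_mul, hp.isSelfAdjoint.star_eq, mul_assoc, hpc0, mul_zero]
        have e2 : star c * (p * x) = 0 := by rw [← mul_assoc, hcp0, zero_mul]
        rw [hw, star_add, star_smul, (star_trivial l : star l = l), add_mul, mul_add, mul_add,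
          mul_smul_comm, e1, smul_mul_assoc, e2, smul_mul_smul_comm]
        simp [pow_two]
      have h2 : ‖w‖ ^ 2 ≤ ‖p * x‖ ^ 2 + l ^ 2 * ‖c‖ ^ 2 := by
        rw [pow_two ‖w‖, ← CStarRing.norm_star_mul_self, h1]
        refine (norm_add_le _ _).trans ?_
        rw [CStarRing.norm_star_mul_self, norm_smul, CStarRing.norm_star_mul_self,
          Real.norm_of_nonneg (sq_nonneg l), pow_two ‖p * x‖, pow_two ‖c‖]
      have h3 : (1 - p) * E w = (1 + l) • c := by
        rw [hw, map_add, map_smul, hfix c hcN, mul_add, mul_smul_comm, hpc, ← hc, add_smul,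
          one_smul]
      have h4 : ‖(1 + l) • c‖ ≤ ‖w‖ := by
        rw [← h3]
        refine (norm_mul_le _ _).trans ?_
        calc ‖1 - p‖ * ‖E w‖ ≤ 1 * ‖w‖ := by gcongr; exact hE w
          _ = ‖w‖ := one_mul _
      have h5 : ‖(1 + l) • c‖ ^ 2 = (1 + l) ^ 2 * ‖c‖ ^ 2 := by
        rw [norm_smul, mul_pow, Real.norm_eq_abs, sq_abs]
      have h6 : ‖(1 + l) • c‖ ^ 2 ≤ ‖w‖ ^ 2 := by gcongr
      nlinarith
    by_contra h0
    have hpos : 0 < ‖c‖ ^ 2 := by have := norm_pos_iff.2 h0; positivity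
    have := main (‖p * x‖ ^ 2 / ‖c‖ ^ 2)
    have h7 : ‖p * x‖ ^ 2 / ‖c‖ ^ 2 * ‖c‖ ^ 2 = ‖p * x‖ ^ 2 := div_mul_cancel₀ _ hpos.ne'
    nlinarith [sq_nonneg ‖p * x‖]
  have h1 : E (p * x) = p * E (p * x) := by
    have := key p hp hpN x
    rwa [sub_mul, one_mul, sub_eq_zero] at this
  have h2 : p * E ((1 - p) * x) = 0 := by
    have := key (1 - p) hp.one_sub (sub_mem (one_mem N) hpN) x
    rwa [sub_sub_cancel] at this
  rw [h1, ← sub_eq_zero, ← mul_sub, ← map_sub, ← neg_eq_zero, ← mul_neg, ← map_neg, neg_sub]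
  rwa [sub_mul, one_mul] at h2

/-- A unital contractive map on operators is positive. -/
theorem inner_map_nonneg (E : (K →L[ℂ] K) →L[ℂ] (K →L[ℂ] K)) (hE : ‖E‖ ≤ 1) (hE1 : E 1 = 1)
    {h : K →L[ℂ] K} (hh : 0 ≤ h) (ξ : K) : 0 ≤ ⟪ξ, E h ξ⟫_ℂ := by
  rcases eq_or_ne ξ 0 with rfl | hξ
  · simp
  have hm : 0 < ‖ξ‖ ^ 2 := by have := norm_pos_iff.2 hξ; positivity
  set m := ‖ξ‖ ^ 2 with hmdef
  have hsa : star h = h := ((nonneg_iff_isPositive h).1 hh).isSelfAdjoint.star_eq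
  have hg : ∀ x, ‖⟪ξ, E x ξ⟫_ℂ‖ ≤ ‖x‖ * m := by
    intro x
    have h1 : ‖E x ξ‖ ≤ ‖x‖ * ‖ξ‖ := by
      refine (E x).le_of_opNorm_le ?_ ξ
      simpa using E.le_of_opNorm_le hE x
    calc _ ≤ ‖ξ‖ * ‖E x ξ‖ := norm_inner_le_norm _ _
      _ ≤ ‖ξ‖ * (‖x‖ * ‖ξ‖) := by gcongr
      _ = _ := by rw [hmdef]; ring
  have hone : ⟪ξ, (1 : K →L[ℂ] K) ξ⟫_ℂ = (m : ℂ) := by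
    have := inner_self_eq_norm_sq_to_K (𝕜 := ℂ) ξ
    rw [hmdef]; push_cast; exact this
  set g := ⟪ξ, E h ξ⟫_ℂ with hgdef
  rw [Complex.nonneg_iff]
  constructor
  -- Positivity gives `‖‖h‖ - h‖ ≤ ‖h‖`. Contractivity then keeps `g` within distance `‖h‖ m` of
  -- `‖h‖ m`, so its real part is nonnegative.
  · have h1 : ‖algebraMap ℝ (K →L[ℂ] K) ‖h‖ - h‖ ≤ ‖h‖ := by
      have h2 : 0 ≤ algebraMap ℝ (K →L[ℂ] K) ‖h‖ - h :=
        sub_nonneg.2 (IsSelfAdjoint.le_algebraMap_norm_self (hsa : IsSelfAdjoint h))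
      have h3 : algebraMap ℝ (K →L[ℂ] K) ‖h‖ - h ≤ algebraMap ℝ (K →L[ℂ] K) ‖h‖ :=
        sub_le_self _ hh
      refine (CStarAlgebra.norm_le_norm_of_nonneg_of_le h2 h3).trans ?_
      rw [Algebra.algebraMap_eq_smul_one, norm_smul, norm_norm]
      exact mul_le_of_le_one_right (norm_nonneg _) ContinuousLinearMap.norm_id_le
    have h2 := (hg _).trans (mul_le_mul_of_nonneg_right h1 hm.le)
    have h3 : ⟪ξ, E (algebraMap ℝ (K →L[ℂ] K) ‖h‖ - h) ξ⟫_ℂ = ((‖h‖ * m : ℝ) : ℂ) - g := by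
      have : algebraMap ℝ (K →L[ℂ] K) ‖h‖ = ((‖h‖ : ℝ) : ℂ) • (1 : K →L[ℂ] K) := by
        rw [Algebra.algebraMap_eq_smul_one]; rfl
      rw [this, map_sub, map_smul, hE1, sub_apply, inner_sub_right, smul_apply, inner_smul_right,
        hone]
      push_cast; rfl
    rw [h3] at h2
    have h4 := (Complex.re_le_norm _).trans h2
    simp only [Complex.sub_re, Complex.ofReal_re] at h4
    linarith
  -- The norm of `1 + i t h` exceeds `1` only to second order in `t`, whereas a nonzero imaginary
  -- part of `g` would contribute to first order. The contradiction comes from `t = - Im g · m / (q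
  -- + 1)`.
  · have key : ∀ t : ℝ, -(2 * m * g.im * t) ≤ t ^ 2 * (m ^ 2 * ‖h‖ ^ 2) := by
      intro t
      set w : K →L[ℂ] K := 1 + (Complex.I * t) • h with hw
      have h1 : star w * w = 1 + ((t : ℂ) ^ 2) • (star h * h) := by
        rw [hw, star_add, star_one, star_smul, hsa, add_mul, one_mul, mul_add, mul_one,
          smul_mul_smul_comm]
        have : star (Complex.I * t) = -(Complex.I * t) := by simp
        rw [this]
        have h2 : -(Complex.I * (t : ℂ)) * (Complex.I * t) = (t : ℂ) ^ 2 := by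
          linear_combination (-(t : ℂ) ^ 2) * Complex.I_sq
        rw [h2, neg_smul]
        abel
      have h2 : ‖w‖ ^ 2 ≤ 1 + t ^ 2 * ‖h‖ ^ 2 := by
        rw [pow_two, ← CStarRing.norm_star_mul_self, h1]
        refine (norm_add_le _ _).trans ?_
        rw [norm_smul, CStarRing.norm_star_mul_self, norm_pow, Complex.norm_real, Real.norm_eq_abs,
          sq_abs, pow_two ‖h‖]
        gcongr
        exact ContinuousLinearMap.norm_id_le
      have h3 : ⟪ξ, E w ξ⟫_ℂ = m + Complex.I * t * g := by
        rw [hw, map_add, map_smul, hE1, add_apply, inner_add_right, smul_apply, inner_smul_right,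
          hone]
      have h4 := (Complex.abs_re_le_norm _).trans (hg w)
      rw [h3] at h4
      have h5 : (m + Complex.I * t * g).re = m - t * g.im := by simp [sub_eq_add_neg]
      rw [h5] at h4
      have h6 : (m - t * g.im) ^ 2 ≤ (‖w‖ * m) ^ 2 := sq_le_sq' (by linarith [abs_le.1 h4]) (abs_le.1 h4).2
      have h7 : (‖w‖ * m) ^ 2 ≤ (1 + t ^ 2 * ‖h‖ ^ 2) * m ^ 2 := by
        rw [mul_pow]; gcongr
      nlinarith [sq_nonneg (t * g.im)]
    by_contra hb
    have hb' : g.im ≠ 0 := fun h => hb h.symm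
    set q := m ^ 2 * ‖h‖ ^ 2 with hq
    have hq0 : 0 ≤ q := by positivity
    have h1 := key (-(g.im * (m / (q + 1))))
    have hb2 : 0 < g.im ^ 2 := by positivity
    have h2 : g.im ^ 2 * (2 * m * (m / (q + 1))) ≤ g.im ^ 2 * ((m / (q + 1)) ^ 2 * q) := by
      nlinarith
    have h3 := le_of_mul_le_mul_left h2 hb2
    have h4 : (m / (q + 1)) ^ 2 * q = m * (m / (q + 1)) * (q / (q + 1)) := by
      field_simp
    have h5 : q / (q + 1) ≤ 1 := by rw [div_le_one (by positivity)]; linarith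
    have h6 : 0 < m * (m / (q + 1)) := by positivity
    nlinarith

/-- An injective von Neumann algebra containing a sequence of isometries with orthogonal ranges is
the range of a completely positive projection. -/
theorem exists_completelyPositive_projection {N : VonNeumannAlgebra K} (hN : N.IsInjective)
    {s : ℕ → K →L[ℂ] K} (hsN : ∀ n, s n ∈ N)
    (hs : ∀ i j, star (s i) * s j = if i = j then 1 else 0) :
    ∃ F : (K →L[ℂ] K) →ₗ[ℂ] (K →L[ℂ] K), (∀ x, F x ∈ N) ∧ (∀ x ∈ N, F x = x) ∧
      ∀ (ι : Type) [Fintype ι] (x : ι → ι → K →L[ℂ] K),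
        (∀ ξ : ι → K, 0 ≤ ∑ i, ∑ j, ⟪ξ i, x i j (ξ j)⟫_ℂ) →
        ∀ ξ : ι → K, 0 ≤ ∑ i, ∑ j, ⟪ξ i, F (x i j) (ξ j)⟫_ℂ := by
  obtain ⟨E, hE, hEN, hfix⟩ := hN
  have hss : ∀ i, star (s i) * s i = 1 := fun i => by rw [hs, if_pos rfl]
  have hEle : ∀ x, ‖E x‖ ≤ ‖x‖ := fun x => by simpa using E.le_of_opNorm_le hE x
  have hleft : ∀ p : K →L[ℂ] K, IsStarProjection p → p ∈ N → ∀ x, E (p * x) = p * E x :=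
    fun p hp hpN x => map_projection_mul N ((E : (K →L[ℂ] K) →ₗ[ℂ] (K →L[ℂ] K)).restrictScalars ℝ)
      hEle hEN hfix hp hpN x
  have hright : ∀ p : K →L[ℂ] K, IsStarProjection p → p ∈ N → ∀ x, E (x * p) = E x * p := by
    intro p hp hpN x
    -- Right multiplication reduces to left multiplication for the map `x ↦ E(x*)*`.
    let E' : (K →L[ℂ] K) →ₗ[ℝ] (K →L[ℂ] K) :=
      { toFun := fun x => star (E (star x))
        map_add' := fun x y => by simp
        map_smul' := fun c x => by
          have : star (c • x) = (c : ℂ) • star x := by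
            rw [star_smul, star_trivial]; rfl
          rw [this, map_smul, star_smul]
          simp }
    have h1 := map_projection_mul N E' (fun x => by
        show ‖star (E (star x))‖ ≤ _
        rw [norm_star]; exact (hEle _).trans (norm_star x).le)
      (fun x => star_mem (hEN _)) (fun x hx => by
        show star (E (star x)) = x
        rw [hfix _ (star_mem hx), star_star]) hp hpN (star x)
    have h2 : star (E (star (p * star x))) = p * star (E (star (star x))) := h1
    have h3 := congrArg star h2
    simpa [hp.isSelfAdjoint.star_eq] using h3
  have hproj : ∀ i, IsStarProjection (s i * star (s i)) := fun i =>
    ⟨by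
      show s i * star (s i) * (s i * star (s i)) = _
      rw [mul_assoc, ← mul_assoc (star (s i)), hss, one_mul], IsSelfAdjoint.mul_star_self _⟩
  have hprojN : ∀ i, s i * star (s i) ∈ N := fun i => mul_mem (hsN i) (star_mem (hsN i))
  -- The matrix unit `s i * star (s j)` is twice a product of three projections of `N`, the middle
  -- one projecting onto the range of `s i + s j`. Hence `E` is a bimodule map over all matrix
  -- units.
  have hpart : ∀ i j, i ≠ j → ∃ q : K →L[ℂ] K, IsStarProjection q ∧ q ∈ N ∧
      s i * star (s j) = (2 : ℂ) • ((s i * star (s i)) * (q * (s j * star (s j)))) := by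
    intro i j hij
    refine ⟨(2⁻¹ : ℂ) • ((s i + s j) * star (s i + s j)), ⟨?_, ?_⟩, ?_, ?_⟩
    · have h1 : star (s i + s j) * (s i + s j) = (2 : ℂ) • (1 : K →L[ℂ] K) := by
        rw [star_add, add_mul, mul_add, mul_add, hss, hss, hs, hs, if_neg hij, if_neg hij.symm,
          two_smul]
        abel
      show (2⁻¹ : ℂ) • ((s i + s j) * star (s i + s j)) * ((2⁻¹ : ℂ) • ((s i + s j) * star (s i + s j))) = _
      rw [smul_mul_smul_comm, mul_assoc, ← mul_assoc (star (s i + s j)), h1, smul_mul_assoc,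
        one_mul, mul_smul_comm, smul_smul]
      norm_num
    · rw [isSelfAdjoint_iff, star_smul, star_mul, star_star]
      simp
    · exact N.toStarSubalgebra.smul_mem
        (mul_mem (add_mem (hsN i) (hsN j)) (star_mem (add_mem (hsN i) (hsN j)))) _
    · have h1 : star (s i) * (s i + s j) = 1 := by
        rw [mul_add, hss, hs, if_neg hij, add_zero]
      have h2 : star (s i + s j) * s j = 1 := by
        rw [star_add, add_mul, hss, hs, if_neg hij, zero_add]
      rw [smul_mul_assoc, mul_smul_comm, smul_smul]
      have h3 : s i * star (s i) * ((s i + s j) * star (s i + s j) * (s j * star (s j)))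
          = s i * (star (s i) * (s i + s j)) * (star (s i + s j) * s j) * star (s j) := by
        noncomm_ring
      rw [h3, h1, h2]
      norm_num
  have hEl : ∀ i j x, E (s i * star (s j) * x) = s i * star (s j) * E x := by
    intro i j x
    rcases eq_or_ne i j with rfl | hij
    · exact hleft _ (hproj i) (hprojN i) x
    · obtain ⟨q, hq, hqN, h⟩ := hpart i j hij
      rw [h, smul_mul_assoc, map_smul, mul_assoc, hleft _ (hproj i) (hprojN i),
        mul_assoc q, hleft q hq hqN, hleft _ (hproj j) (hprojN j), smul_mul_assoc]
      simp only [mul_assoc]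
  have hEr : ∀ i j x, E (x * (s i * star (s j))) = E x * (s i * star (s j)) := by
    intro i j x
    rcases eq_or_ne i j with rfl | hij
    · exact hright _ (hproj i) (hprojN i) x
    · obtain ⟨q, hq, hqN, h⟩ := hpart i j hij
      rw [h, mul_smul_comm, map_smul, ← mul_assoc, ← mul_assoc, hright _ (hproj j) (hprojN j),
        hright q hq hqN, hright _ (hproj i) (hprojN i), mul_smul_comm]
      simp only [mul_assoc]
  have hE1 : E 1 = 1 := hfix 1 (one_mem N)
  let F : (K →L[ℂ] K) →ₗ[ℂ] (K →L[ℂ] K) :=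
    { toFun := fun x => star (s 0) * E (s 0 * x * star (s 0)) * s 0
      map_add' := fun x y => by simp only [mul_add, add_mul, map_add]
      map_smul' := fun c x => by
        simp only [mul_smul_comm, smul_mul_assoc, map_smul, RingHom.id_apply] }
  have hF : ∀ x, F x = star (s 0) * E (s 0 * x * star (s 0)) * s 0 := fun x => rfl
  -- By bimodularity any pair of isometries may replace `s 0` in the definition of `F`. So `E`,
  -- applied to an operator matrix compressed into `K` by the `s i`, acts as `F` on every entry.
  have hFij : ∀ i j x, star (s i) * E (s i * x * star (s j)) * s j = F x := by
    intro i j x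
    have h1 : s i * x * star (s j)
        = s i * star (s 0) * (s 0 * x * star (s 0) * (s 0 * star (s j))) := by
      have : s i * star (s 0) * (s 0 * x * star (s 0) * (s 0 * star (s j)))
        = s i * (star (s 0) * s 0) * x * (star (s 0) * s 0) * star (s j) := by noncomm_ring
      rw [this, hss, mul_one, mul_one]
    rw [h1, hEl, hEr, hF]
    have : star (s i) * (s i * star (s 0) * (E (s 0 * x * star (s 0)) * (s 0 * star (s j)))) * s j
      = (star (s i) * s i) * star (s 0) * E (s 0 * x * star (s 0)) * s 0 * (star (s j) * s j) := by
      noncomm_ring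
    rw [this, hss, hss, one_mul, mul_one]
  refine ⟨F, fun x => mul_mem (mul_mem (star_mem (hsN 0)) (hEN _)) (hsN 0), fun x hx => ?_,
    fun ι _ x hx ξ => ?_⟩
  · rw [hF, hfix _ (mul_mem (mul_mem (hsN 0) hx) (star_mem (hsN 0)))]
    have : star (s 0) * (s 0 * x * star (s 0)) * s 0
      = (star (s 0) * s 0) * x * (star (s 0) * s 0) := by noncomm_ring
    rw [this, hss, one_mul, mul_one]
  · classical
    let k : ι → ℕ := fun i => (Fintype.equivFin ι i : ℕ)
    have hk : Function.Injective k := Fin.val_injective.comp (Fintype.equivFin ι).injective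
    have hsk : ∀ i j, star (s (k i)) * s (k j) = if i = j then 1 else 0 := by
      intro i j
      rw [hs]
      simp only [hk.eq_iff]
    -- The matrix `x` is carried to one operator `Z` on `K`. Positivity of `E Z` is then positivity
    -- of the matrix with entries `F (x i j)`.
    let Z : K →L[ℂ] K := ∑ i, ∑ j, s (k i) * x i j * star (s (k j))
    have hcomp : ∀ a b, star (s (k a)) * Z * s (k b) = x a b := by
      intro a b
      have : ∀ i j, star (s (k a)) * (s (k i) * x i j * star (s (k j))) * s (k b)
          = (star (s (k a)) * s (k i)) * x i j * (star (s (k j)) * s (k b)) := fun i j => by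
        noncomm_ring
      simp only [Z, Finset.mul_sum, Finset.sum_mul, this, hsk]
      simp
    have hZ : 0 ≤ Z := by
      have h0 : ∀ y, 0 ≤ ⟪y, Z y⟫_ℂ := by
        intro y
        convert hx (fun i => star (s (k i)) y) using 1
        rw [show Z y = ∑ i, ∑ j, (s (k i) * x i j * star (s (k j))) y by simp [Z], inner_sum]
        refine Finset.sum_congr rfl fun a _ => ?_
        rw [inner_sum]
        refine Finset.sum_congr rfl fun b _ => ?_
        exact (adjoint_inner_left (s (k a)) (x a b (star (s (k b)) y)) y).symm
      rw [nonneg_iff_isPositive, isPositive_iff_complex]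
      intro y
      have h1 := Complex.nonneg_iff.1 (h0 y)
      have e : ⟪Z y, y⟫_ℂ = ⟪y, Z y⟫_ℂ := by
        rw [← inner_conj_symm]
        exact Complex.conj_eq_iff_im.2 h1.2.symm
      rw [e]
      exact ⟨Complex.ext (by simp) (by simpa using h1.2), h1.1⟩
    have h1 := inner_map_nonneg E hE hE1 hZ (∑ i, s (k i) (ξ i))
    have h2 : ∀ a b, star (s (k a)) * E Z * s (k b) = F (x a b) := by
      intro a b
      rw [← hFij (k a) (k b), ← hcomp a b]
      have e1 : s (k a) * (star (s (k a)) * Z * s (k b)) * star (s (k b))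
        = s (k a) * star (s (k a)) * (Z * (s (k b) * star (s (k b)))) := by noncomm_ring
      rw [e1, hEl, hEr]
      have e2 : star (s (k a)) * (s (k a) * star (s (k a)) * (E Z * (s (k b) * star (s (k b)))))
          * s (k b) = (star (s (k a)) * s (k a)) * star (s (k a)) * E Z * s (k b)
            * (star (s (k b)) * s (k b)) := by noncomm_ring
      rw [e2, hss, hss, one_mul, mul_one]
    convert h1 using 1
    rw [sum_inner]
    refine Finset.sum_congr rfl fun a _ => ?_
    rw [map_sum, inner_sum]
    refine Finset.sum_congr rfl fun b _ => ?_
    rw [← adjoint_inner_right, ← h2]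
    rfl

end VonNeumannAlgebra

end

noncomputable section

set_option linter.unusedSectionVars false

open scoped ComplexOrder InnerProductSpace

namespace VonNeumannAlgebra

open ContinuousLinearMap HilbertSpaceTools

universe u v

variable {H : Type u} [NormedAddCommGroup H] [InnerProductSpace ℂ H] [CompleteSpace H]
variable {K : Type v} [NormedAddCommGroup K] [InnerProductSpace ℂ K] [CompleteSpace K]

/-! ### Matrices acting on tuples of vectors -/

/-- The action of a scalar matrix on a tuple of vectors. -/
def matAct {n : ℕ} (C : Matrix (Fin n) (Fin n) ℂ) (f : Fin n → H) : Fin n → H :=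
  fun i => ∑ j, C i j • f j

theorem matAct_mul {n : ℕ} (C D : Matrix (Fin n) (Fin n) ℂ) (f : Fin n → H) :
    matAct (C * D) f = matAct C (matAct D f) := by
  funext i
  simp only [matAct, Matrix.mul_apply, Finset.sum_smul, Finset.smul_sum, mul_smul]
  exact Finset.sum_comm

theorem matAct_one {n : ℕ} (f : Fin n → H) : matAct 1 f = f := by
  funext i
  simp [matAct, Matrix.one_apply]

/-- A change of variables: evaluating `β` at `C f` and `D g` is evaluating the congruent matrix `C*
β D` at `f` and `g`. -/
theorem inner_matAct {n : ℕ} (C D : Matrix (Fin n) (Fin n) ℂ)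
    (β : Fin n → Fin n → H →L[ℂ] H) (f g : Fin n → H) :
    ∑ i, ∑ j, ⟪matAct C f i, β i j (matAct D g j)⟫_ℂ
      = ∑ k, ∑ l, ⟪f k, (∑ i, ∑ j, (star (C i k) * D j l) • β i j) (g l)⟫_ℂ := by
  have h1 : ∀ i j, ⟪matAct C f i, β i j (matAct D g j)⟫_ℂ
      = ∑ k, ∑ l, star (C i k) * D j l * ⟪f k, β i j (g l)⟫_ℂ := by
    intro i j
    simp only [matAct, sum_inner, map_sum, inner_sum, map_smul, inner_smul_left, inner_smul_right,
      Complex.star_def, Finset.mul_sum]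
    rw [Finset.sum_comm]
    refine Finset.sum_congr rfl fun k _ => Finset.sum_congr rfl fun l _ => ?_
    ring
  have h2 : ∀ k l, ⟪f k, (∑ i, ∑ j, (star (C i k) * D j l) • β i j) (g l)⟫_ℂ
      = ∑ i, ∑ j, star (C i k) * D j l * ⟪f k, β i j (g l)⟫_ℂ := by
    intro k l
    simp only [_root_.sum_apply, _root_.smul_apply, inner_sum,
      inner_smul_right]
  simp only [h1, h2]
  calc _ = ∑ i, ∑ k, ∑ j, ∑ l, star (C i k) * D j l * ⟪f k, β i j (g l)⟫_ℂ :=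
        Finset.sum_congr rfl fun i _ => Finset.sum_comm
    _ = ∑ k, ∑ i, ∑ j, ∑ l, star (C i k) * D j l * ⟪f k, β i j (g l)⟫_ℂ := Finset.sum_comm
    _ = ∑ k, ∑ i, ∑ l, ∑ j, star (C i k) * D j l * ⟪f k, β i j (g l)⟫_ℂ :=
        Finset.sum_congr rfl fun k _ => Finset.sum_congr rfl fun i _ => Finset.sum_comm
    _ = _ := Finset.sum_congr rfl fun k _ => Finset.sum_comm

theorem sum_norm_matAct {n : ℕ} (C : Matrix (Fin n) (Fin n) ℂ) (f : Fin n → H) :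
    ((∑ i, ‖matAct C f i‖ ^ 2 : ℝ) : ℂ) = ∑ k, ∑ l, (C.conjTranspose * C) k l * ⟪f k, f l⟫_ℂ := by
  have := inner_matAct C C (fun i j => if i = j then 1 else 0) f f
  have h1 : ∀ i, ∑ j, ⟪matAct C f i, (if i = j then (1 : H →L[ℂ] H) else 0) (matAct C f j)⟫_ℂ
      = ((‖matAct C f i‖ ^ 2 : ℝ) : ℂ) := by
    intro i
    rw [Finset.sum_eq_single i]
    · rw [if_pos rfl]
      push_cast
      exact inner_self_eq_norm_sq_to_K (𝕜 := ℂ) _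
    · intro j _ hj
      rw [if_neg hj.symm]; simp
    · simp
  simp only [h1] at this
  rw [Complex.ofReal_sum, this]
  refine Finset.sum_congr rfl fun k _ => Finset.sum_congr rfl fun l _ => ?_
  have h2 : ∑ i, ∑ j, (star (C i k) * C j l) • (if i = j then (1 : H →L[ℂ] H) else 0)
      = (C.conjTranspose * C) k l • (1 : H →L[ℂ] H) := by
    rw [Matrix.mul_apply, Finset.sum_smul]
    refine Finset.sum_congr rfl fun i _ => ?_
    simp
  rw [← inner_smul_right]
  exact congrArg (fun T : H →L[ℂ] H => ⟪f k, T (f l)⟫_ℂ) h2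

theorem inner_matrixOp {n : ℕ} (x : Matrix (Fin n) (Fin n) (H →L[ℂ] H)) (f g : Fin n → H) :
    ⟪WithLp.toLp 2 f, matrixOp x (WithLp.toLp 2 g)⟫_ℂ = ∑ k, ∑ l, ⟪f k, x k l (g l)⟫_ℂ := by
  rw [PiLp.inner_apply]
  refine Finset.sum_congr rfl fun k _ => ?_
  rw [matrixOp_apply, inner_sum]

/-- A scalar matrix with positive numerical range has an approximate Cholesky factorization. -/
theorem exists_conjTranspose_mul_self {n : ℕ} (t : Matrix (Fin n) (Fin n) ℂ)
    (ht : ∀ x : Fin n → ℂ, 0 ≤ (∑ i, ∑ j, t i j * (star (x i) * x j)).re) {ε : ℝ} (hε : 0 < ε) :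
    ∃ C D : Matrix (Fin n) (Fin n) ℂ, D * C = 1 ∧ C * D = 1 ∧
      C.conjTranspose * C = (2⁻¹ : ℂ) • (t + t.conjTranspose) + (ε : ℂ) • 1 := by
  set T := (2⁻¹ : ℂ) • (t + t.conjTranspose) with hT
  have hTh : T.IsHermitian := by
    rw [Matrix.IsHermitian, hT, Matrix.conjTranspose_smul, Matrix.conjTranspose_add,
      Matrix.conjTranspose_conjTranspose, add_comm]
    simp
  have hp : T.PosSemidef := by
    refine .of_dotProduct_mulVec_nonneg hTh fun x => ?_
    have e1 : star x ⬝ᵥ t.mulVec x = ∑ i, ∑ j, t i j * (star (x i) * x j) := by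
      simp only [dotProduct, Matrix.mulVec, Finset.mul_sum]
      refine Finset.sum_congr rfl fun i _ => Finset.sum_congr rfl fun j _ => ?_
      simp only [Pi.star_apply]
      ring
    have e2 : star x ⬝ᵥ t.conjTranspose.mulVec x = star (star x ⬝ᵥ t.mulVec x) := by
      rw [Matrix.star_dotProduct, Matrix.star_mulVec, ← Matrix.dotProduct_mulVec,
        Matrix.conjTranspose_conjTranspose]
    rw [hT, Matrix.smul_mulVec, Matrix.add_mulVec, dotProduct_smul, dotProduct_add, e2, e1]
    have e3 : ∀ z : ℂ, (2⁻¹ : ℂ) • (z + star z) = ((z.re : ℝ) : ℂ) := by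
      intro z
      rw [Complex.star_def, Complex.add_conj, smul_eq_mul]
      push_cast
      ring
    rw [e3]
    exact_mod_cast ht x
  -- The shift by `ε` makes the factor invertible, so that it can be divided out later.
  have hpd : (T + (ε : ℂ) • 1).PosDef := by
    refine Matrix.PosDef.posSemidef_add hp ?_
    have : ((ε : ℂ) • (1 : Matrix (Fin n) (Fin n) ℂ)) = Matrix.diagonal fun _ => (ε : ℂ) := by
      rw [Matrix.smul_one_eq_diagonal]
    rw [this]
    exact Matrix.PosDef.diagonal fun _ => by exact_mod_cast hε
  have hex : ∃ C : Matrix (Fin n) (Fin n) ℂ, IsUnit C ∧ T + (ε : ℂ) • 1 = C.conjTranspose * C := by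
    open scoped MatrixOrder in
    exact CStarAlgebra.isStrictlyPositive_iff_eq_star_mul_self.mp hpd.isStrictlyPositive
  obtain ⟨C, hC, hCT⟩ := hex
  obtain ⟨⟨C, D, h1, h2⟩, rfl⟩ := hC
  exact ⟨C, D, h2, h1, hCT.symm⟩

theorem re_sum_symm {n : ℕ} (t : Matrix (Fin n) (Fin n) ℂ) (f : Fin n → H) (ε : ℝ) :
    (∑ k, ∑ l, ((2⁻¹ : ℂ) • (t + t.conjTranspose) + (ε : ℂ) • 1) k l * ⟪f k, f l⟫_ℂ).re
      = (∑ k, ∑ l, t k l * ⟪f k, f l⟫_ℂ).re + ε * ∑ k, ‖f k‖ ^ 2 := by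
  have h1 : ∀ k l, ((2⁻¹ : ℂ) • (t + t.conjTranspose) + (ε : ℂ) • 1) k l * ⟪f k, f l⟫_ℂ
      = 2⁻¹ * (t k l * ⟪f k, f l⟫_ℂ) + 2⁻¹ * star (t l k * ⟪f l, f k⟫_ℂ)
        + (if k = l then ((ε * ‖f k‖ ^ 2 : ℝ) : ℂ) else 0) := by
    intro k l
    have h0 : star (t l k * ⟪f l, f k⟫_ℂ) = star (t l k) * ⟪f k, f l⟫_ℂ := by
      rw [star_mul', ← inner_conj_symm (f k)]
      rfl
    rw [h0]
    simp only [Matrix.add_apply, Matrix.smul_apply, Matrix.conjTranspose_apply, smul_eq_mul,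
      Matrix.one_apply]
    split_ifs with h
    · subst h
      have : ⟪f k, f k⟫_ℂ = (‖f k‖ : ℂ) ^ 2 := inner_self_eq_norm_sq_to_K (𝕜 := ℂ) (f k)
      rw [this]
      push_cast
      ring
    · ring
  simp only [h1, Finset.sum_add_distrib, ← Finset.mul_sum, Finset.sum_ite_eq, Finset.mem_univ,
    if_true]
  rw [Finset.sum_comm (f := fun k l => star (t l k * ⟪f l, f k⟫_ℂ))]
  simp only [← star_sum]
  rw [Complex.add_re, Complex.add_re]
  have h2 : ∀ z : ℂ, (2⁻¹ * z).re = 2⁻¹ * z.re := fun z => by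
    rw [show (2⁻¹ : ℂ) = ((2⁻¹ : ℝ) : ℂ) by push_cast; rfl, Complex.re_ofReal_mul]
  rw [h2, h2, Complex.star_def, Complex.conj_re, ← Complex.ofReal_sum, Complex.ofReal_re,
    ← Finset.mul_sum]
  ring

theorem sum_norm_matAct_eq {n : ℕ} {C t : Matrix (Fin n) (Fin n) ℂ} {ε : ℝ}
    (hC : C.conjTranspose * C = (2⁻¹ : ℂ) • (t + t.conjTranspose) + (ε : ℂ) • 1) (f : Fin n → H) :
    ∑ i, ‖matAct C f i‖ ^ 2 = (∑ k, ∑ l, t k l * ⟪f k, f l⟫_ℂ).re + ε * ∑ k, ‖f k‖ ^ 2 := by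
  rw [← re_sum_symm, ← hC, ← sum_norm_matAct, Complex.ofReal_re]

/-- Put `f = T g`. The bound by a sum of squares is the form in which positivity of a two-by-two
block matrix delivers contractivity. -/
theorem opNorm_le_one_of_re_inner {X : Type*} [NormedAddCommGroup X] [InnerProductSpace ℂ X]
    (T : X →L[ℂ] X) (h : ∀ f g, 2 * (⟪f, T g⟫_ℂ).re ≤ ‖f‖ ^ 2 + ‖g‖ ^ 2) : ‖T‖ ≤ 1 := by
  refine T.opNorm_le_bound zero_le_one fun g => ?_
  have h1 := h (T g) g
  have h2 : (⟪T g, T g⟫_ℂ).re = ‖T g‖ ^ 2 := by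
    have : ⟪T g, T g⟫_ℂ = ((‖T g‖ ^ 2 : ℝ) : ℂ) := by
      push_cast; exact inner_self_eq_norm_sq_to_K (𝕜 := ℂ) (T g)
    rw [this, Complex.ofReal_re]
  rw [one_mul]
  refine le_of_sq_le_sq ?_ (norm_nonneg _)
  linarith

/-- The Wittstock–Paulsen inequality for a completely bounded map. -/
theorem re_sum_inner_nonneg {M : VonNeumannAlgebra H} {N : VonNeumannAlgebra K}
    (α : M.Elem →ₗ[ℂ] N.Elem) {c : ℝ}
    (hc : ∀ (n : ℕ) (x : Matrix (Fin n) (Fin n) M.Elem), M.matrixNorm x ≤ 1 →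
      N.matrixNorm (x.map α) ≤ c) {h₀ : H} (hh₀ : ‖h₀‖ = 1) {n : ℕ}
    (t₁ t₂ : Matrix (Fin n) (Fin n) ℂ) (B : Matrix (Fin n) (Fin n) M.Elem)
    (h : ∀ f g : Fin n → H, 0 ≤ (∑ i, ∑ j, t₁ i j * ⟪f i, f j⟫_ℂ).re
      + (∑ i, ∑ j, t₂ i j * ⟪g i, g j⟫_ℂ).re
      + (∑ i, ∑ j, ⟪f i, (B i j : H →L[ℂ] H) (g j)⟫_ℂ).re) {e : Fin n → K}
    (he : Orthonormal ℂ e) :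
    0 ≤ c * (∑ i, t₁ i i).re + c * (∑ i, t₂ i i).re
      + (∑ i, ∑ j, ⟪e i, (α (B i j) : K →L[ℂ] K) (e j)⟫_ℂ).re := by
  have hc0 : 0 ≤ c := (norm_nonneg _).trans (hc 0 0 (by
    have : matrixOp (H := H) (n := 0) (Matrix.map 0 fun a : M.Elem => (a : H →L[ℂ] H)) = 0 := by
      ext f i
      exact i.elim0
    show ‖_‖ ≤ _
    rw [this]; simp))
  have hx : ∀ x : Fin n → ℂ, ∀ i j, ⟪x i • h₀, x j • h₀⟫_ℂ = star (x i) * x j := by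
    intro x i j
    have : ⟪h₀, h₀⟫_ℂ = 1 := by
      rw [inner_self_eq_norm_sq_to_K, hh₀]; simp
    rw [inner_smul_left, inner_smul_right, this, mul_one, Complex.star_def]
  -- Testing with `f i = x i • h₀` and `g = 0` isolates the scalar matrix `t₁`; this is where a unit
  -- vector of `H` is needed.
  have hp1 : ∀ x : Fin n → ℂ, 0 ≤ (∑ i, ∑ j, t₁ i j * (star (x i) * x j)).re := by
    intro x
    have := h (fun i => x i • h₀) 0
    simpa [hx] using this
  have hp2 : ∀ x : Fin n → ℂ, 0 ≤ (∑ i, ∑ j, t₂ i j * (star (x i) * x j)).re := by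
    intro x
    have := h 0 (fun i => x i • h₀)
    simpa [hx] using this
  refine le_of_forall_pos_le_add fun δ hδ => ?_
  have hden : 0 < 2 * c * n + 1 := by positivity
  -- The two regularizations cost `2 c n ε` in the traces, which must stay below `δ`.
  set ε := δ / (2 * c * n + 1) with hε
  have hε0 : 0 < ε := by positivity
  have hεδ : 2 * c * n * ε ≤ δ := by
    have : ε * (2 * c * n + 1) = δ := div_mul_cancel₀ _ hden.ne'
    nlinarith
  obtain ⟨C₁, D₁, hDC1, hCD1, hC1⟩ := exists_conjTranspose_mul_self t₁ hp1 hε0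
  obtain ⟨C₂, D₂, hDC2, hCD2, hC2⟩ := exists_conjTranspose_mul_self t₂ hp2 hε0
  -- `W` is one half of `D₁* B D₂`. Dividing by the square roots of the diagonal blocks turns the
  -- hypothesis into contractivity of `W`. The factor one half appears because the form contains
  -- only one of the two off-diagonal blocks.
  let W : Matrix (Fin n) (Fin n) M.Elem := .of fun k l =>
    (2⁻¹ : ℂ) • ∑ i, ∑ j, (star (D₁ i k) * D₂ j l) • B i j
  have hWc : ∀ k l, (2 : ℂ) • W k l = ∑ i, ∑ j, (star (D₁ i k) * D₂ j l) • B i j := by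
    intro k l
    have : W k l = (2⁻¹ : ℂ) • ∑ i, ∑ j, (star (D₁ i k) * D₂ j l) • B i j := rfl
    rw [this, smul_smul]
    norm_num
  have hW : M.matrixNorm W ≤ 1 := by
    refine opNorm_le_one_of_re_inner _ fun f g => ?_
    obtain ⟨f, rfl⟩ := (WithLp.toLp_surjective 2) f
    obtain ⟨g, rfl⟩ := (WithLp.toLp_surjective 2) g
    rw [inner_matrixOp, PiLp.norm_sq_eq_of_L2, PiLp.norm_sq_eq_of_L2]
    have h1 := inner_matAct D₁ D₂ (fun i j => (B i j : H →L[ℂ] H)) f g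
    have h2 : ∀ k l, ⟪f k, (W k l : H →L[ℂ] H) (g l)⟫_ℂ = 2⁻¹ *
        ⟪f k, (∑ i, ∑ j, (star (D₁ i k) * D₂ j l) • (B i j : H →L[ℂ] H)) (g l)⟫_ℂ := by
      intro k l
      rw [← inner_smul_right, ← smul_apply]
      simp [W]
    have h3 := h (-matAct D₁ f) (matAct D₂ g)
    have h4 := sum_norm_matAct_eq hC1 (matAct D₁ f)
    have h5 := sum_norm_matAct_eq hC2 (matAct D₂ g)
    rw [← matAct_mul, hCD1, matAct_one] at h4
    rw [← matAct_mul, hCD2, matAct_one] at h5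
    simp only [Pi.neg_apply, inner_neg_left, inner_neg_right, neg_neg, Finset.sum_neg_distrib,
      Complex.neg_re, h1] at h3
    simp only [Matrix.map_apply, h2, ← Finset.mul_sum]
    rw [show (2⁻¹ : ℂ) = ((2⁻¹ : ℝ) : ℂ) by push_cast; rfl, Complex.re_ofReal_mul]
    have h6 : 0 ≤ ε * ∑ k, ‖matAct D₁ f k‖ ^ 2 := by positivity
    have h7 : 0 ≤ ε * ∑ k, ‖matAct D₂ g k‖ ^ 2 := by positivity
    linarith
  have hαW := hc n W hW
  have key : ∑ i, ∑ j, ⟪e i, (α (B i j) : K →L[ℂ] K) (e j)⟫_ℂ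
      = 2 * ⟪WithLp.toLp 2 (matAct C₁ e), matrixOp ((W.map α).map fun a => (a : K →L[ℂ] K))
          (WithLp.toLp 2 (matAct C₂ e))⟫_ℂ := by
    have h1 := inner_matAct D₁ D₂ (fun i j => (α (B i j) : K →L[ℂ] K)) (matAct C₁ e) (matAct C₂ e)
    rw [← matAct_mul, ← matAct_mul, hDC1, hDC2, matAct_one] at h1
    rw [h1, inner_matrixOp, Finset.mul_sum]
    refine Finset.sum_congr rfl fun k _ => ?_
    rw [Finset.mul_sum]
    refine Finset.sum_congr rfl fun l _ => ?_
    rw [← inner_smul_right, ← smul_apply]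
    have h2 := congrArg (fun a => ((α a : N.Elem) : K →L[ℂ] K)) (hWc k l)
    have h3 : ∑ i, ∑ j, (star (D₁ i k) * D₂ j l) • (α (B i j) : K →L[ℂ] K)
        = (2 : ℂ) • (α (W k l) : K →L[ℂ] K) := by
      simp only [map_sum, map_smul] at h2
      rw [show (2 : ℂ) • (α (W k l) : K →L[ℂ] K) = (((2 : ℂ) • α (W k l) : N.Elem) : K →L[ℂ] K)
        from rfl, h2]
      simp
    rw [h3]
    rfl
  -- Orthonormality of `e` turns the squared norm of `C e` into a trace.
  have htr : ∀ {C t : Matrix (Fin n) (Fin n) ℂ}, C.conjTranspose * C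
        = (2⁻¹ : ℂ) • (t + t.conjTranspose) + (ε : ℂ) • 1 →
      ‖WithLp.toLp 2 (matAct C e)‖ ^ 2 = (∑ i, t i i).re + ε * n := by
    intro C t hC
    rw [PiLp.norm_sq_eq_of_L2]
    rw [sum_norm_matAct_eq hC]
    have : ∀ k l, t k l * ⟪e k, e l⟫_ℂ = if k = l then t k k else 0 := by
      intro k l
      rw [orthonormal_iff_ite.1 he]
      split_ifs with hkl
      · rw [hkl, mul_one]
      · rw [mul_zero]
    simp [this, he.1]
  set F := WithLp.toLp 2 (matAct C₁ e)
  set G := WithLp.toLp 2 (matAct C₂ e)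
  set X := matrixOp ((W.map α).map fun a => (a : K →L[ℂ] K))
  have hb : ‖⟪F, X G⟫_ℂ‖ ≤ c * (‖F‖ * ‖G‖) := by
    refine (norm_inner_le_norm _ _).trans ?_
    have := X.le_of_opNorm_le hαW G
    calc ‖F‖ * ‖X G‖ ≤ ‖F‖ * (c * ‖G‖) := by gcongr
      _ = _ := by ring
  have hb2 := (abs_le.1 ((Complex.abs_re_le_norm _).trans hb)).1
  rw [key, show (2 : ℂ) = ((2 : ℝ) : ℂ) by push_cast; rfl, Complex.re_ofReal_mul]
  have h1 := htr hC1
  have h2 := htr hC2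
  have h3 : 2 * (‖F‖ * ‖G‖) ≤ ‖F‖ ^ 2 + ‖G‖ ^ 2 := by nlinarith [sq_nonneg (‖F‖ - ‖G‖)]
  have h4 : c * (2 * (‖F‖ * ‖G‖)) ≤ c * (‖F‖ ^ 2 + ‖G‖ ^ 2) := by gcongr
  rw [h1, h2] at h4
  nlinarith

end VonNeumannAlgebra

end

noncomputable section

set_option linter.unusedSectionVars false

open scoped ComplexOrder InnerProductSpace

namespace VonNeumannAlgebra

open ContinuousLinearMap HilbertSpaceTools

universe u v

variable {H : Type u} [NormedAddCommGroup H] [InnerProductSpace ℂ H] [CompleteSpace H]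
variable {K : Type v} [NormedAddCommGroup K] [InnerProductSpace ℂ K] [CompleteSpace K]

/-! ### Extension of the off-diagonal block to a positive kernel -/

/-- The vector functional `a ↦ ⟪η, a ξ⟫` on `M`. -/
def vectorFunctional (M : VonNeumannAlgebra H) (η ξ : H) : M.Elem →ₗ[ℂ] ℂ where
  toFun a := ⟪η, (a : H →L[ℂ] H) ξ⟫_ℂ
  map_add' a b := by simp
  map_smul' c a := by simp

@[simp]
theorem vectorFunctional_apply (M : VonNeumannAlgebra H) (η ξ : H) (a : M.Elem) :
    M.vectorFunctional η ξ a = ⟪η, (a : H →L[ℂ] H) ξ⟫_ℂ := rfl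

theorem lsum_eq_sum {A B : Type*} [AddCommGroup A] [Module ℂ A] {S : Finset B} {n : ℕ}
    (σ : Fin n ≃ S) (φ : (Bool × B) × (Bool × B) → A →ₗ[ℂ] ℂ) (z : (Bool × B) × (Bool × B) →₀ A)
    (hz : z.support ⊆ (Finset.univ ×ˢ S) ×ˢ (Finset.univ ×ˢ S)) :
    Finsupp.lsum ℂ φ z = ∑ i : Bool, ∑ j : Bool, ∑ k, ∑ l,
      φ ((i, σ k), (j, σ l)) (z ((i, σ k), (j, σ l))) := by
  have hS : ∀ F : B → ℂ, ∑ b ∈ S, F b = ∑ k, F (σ k) := by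
    intro F
    rw [← Finset.sum_coe_sort, ← σ.sum_comp]
  rw [Finsupp.lsum_apply, Finsupp.sum_of_support_subset _ hz _ (by simp), Finset.sum_product,
    Finset.sum_product]
  simp only [Finset.sum_product, hS]
  refine Finset.sum_congr rfl fun i _ => ?_
  rw [Finset.sum_comm]

/-- Paulsen's off-diagonal trick, by M. Riesz extension. On matrices over `M` with scalar diagonal
blocks and zero lower block, the functional "`c` times the traces plus the coefficients of `α`" is
positive by `re_sum_inner_nonneg`. Scalar diagonals dominate every matrix, so it extends positively;
its values on single entries form the kernel. -/
theorem exists_kernel_extension {M : VonNeumannAlgebra H} {N : VonNeumannAlgebra K}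
    (α : M.Elem →ₗ[ℂ] N.Elem) {c : ℝ}
    (hc : ∀ (n : ℕ) (x : Matrix (Fin n) (Fin n) M.Elem), M.matrixNorm x ≤ 1 →
      N.matrixNorm (x.map α) ≤ c) {h₀ : H} (hh₀ : ‖h₀‖ = 1) {B : Type*} [DecidableEq B] {e : B → K}
    (he : Orthonormal ℂ e) :
    ∃ s : Bool × B → Bool × B → M.Elem →ₗ[ℂ] ℂ,
      (∀ (n : ℕ) (x : Fin n → Bool × B) (a : Fin n → M.Elem),
        0 ≤ ∑ p, ∑ q, s (x p) (x q) (star (a p) * a q)) ∧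
      (∀ i b b', s (i, b) (i, b') 1 = if b = b' then (c : ℂ) else 0) ∧
      ∀ b b' a, s (false, b) (true, b') a = ⟪e b, (α a : K →L[ℂ] K) (e b')⟫_ℂ := by
  have h00 : ⟪h₀, h₀⟫_ℂ = 1 := by
    rw [inner_self_eq_norm_sq_to_K, hh₀]; simp
  let V := (Bool × B) × (Bool × B) →₀ M.Elem
  let g : (Bool × B → H) → V →ₗ[ℂ] ℂ := fun h =>
    Finsupp.lsum ℂ fun p => M.vectorFunctional (h p.1) (h p.2)
  have hg : ∀ h x y a, g h (Finsupp.single (x, y) a) = ⟪h x, (a : H →L[ℂ] H) (h y)⟫_ℂ :=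
    fun h x y a => Finsupp.lsum_single ℂ _ _ _
  -- Only the values on `P` matter. There a diagonal entry is a scalar multiple of `1`, and the
  -- vector state of `h₀` reads off the scalar.
  let φ : (Bool × B) × (Bool × B) → M.Elem →ₗ[ℂ] ℂ := fun p =>
    match p with
    | ((false, b), (true, b')) => (N.vectorFunctional (e b) (e b')).comp α
    | ((true, _), (false, _)) => 0
    | ((true, b), (true, b')) => if b = b' then (c : ℂ) • M.vectorFunctional h₀ h₀ else 0
    | ((false, b), (false, b')) => if b = b' then (c : ℂ) • M.vectorFunctional h₀ h₀ else 0
  let f₀ : V →ₗ[ℂ] ℂ := Finsupp.lsum ℂ φ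
  have hf₀ : ∀ p a, f₀ (Finsupp.single p a) = φ p a := fun p a => Finsupp.lsum_single ℂ _ _ _
  let re : (V →ₗ[ℂ] ℂ) → V →ₗ[ℝ] ℝ := fun f => Complex.reLm.comp (f.restrictScalars ℝ)
  have hre : ∀ f z, re f z = (f z).re := fun f z => rfl
  let cone : PointedCone ℝ V := ⨅ h, (PointedCone.positive ℝ ℝ).comap (re (g h))
  have hcone : ∀ z, z ∈ cone ↔ ∀ h, 0 ≤ (g h z).re := by
    intro z
    simp only [cone, Submodule.mem_iInf, PointedCone.mem_comap, PointedCone.mem_positive, hre]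
  let P : Submodule ℂ V :=
    { carrier := {z | (∀ i b b', ∃ t : ℂ, z ((i, b), (i, b')) = t • 1) ∧
        ∀ b b', z ((true, b), (false, b')) = 0}
      add_mem' := by
        rintro z w ⟨h1, h2⟩ ⟨h3, h4⟩
        refine ⟨fun i b b' => ?_, fun b b' => ?_⟩
        · obtain ⟨t, ht⟩ := h1 i b b'
          obtain ⟨t', ht'⟩ := h3 i b b'
          exact ⟨t + t', by rw [Finsupp.add_apply, ht, ht', add_smul]⟩
        · rw [Finsupp.add_apply, h2, h4, add_zero]
      zero_mem' := ⟨fun i b b' => ⟨0, (zero_smul ℂ _).symm⟩, fun b b' => rfl⟩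
      smul_mem' := by
        rintro r z ⟨h1, h2⟩
        refine ⟨fun i b b' => ?_, fun b b' => ?_⟩
        · obtain ⟨t, ht⟩ := h1 i b b'
          exact ⟨r * t, by rw [Finsupp.smul_apply, ht, smul_smul]⟩
        · rw [Finsupp.smul_apply, h2, smul_zero] }
  have hP : ∀ z, z ∈ P ↔ (∀ i b b', ∃ t : ℂ, z ((i, b), (i, b')) = t • 1) ∧
        ∀ b b', z ((true, b), (false, b')) = 0 := fun z => Iff.rfl
  have hpos : ∀ z ∈ P, z ∈ cone → 0 ≤ (f₀ z).re := by
    intro z hzP hzc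
    obtain ⟨h1, h2⟩ := (hP z).1 hzP
    choose t ht using h1
    let S : Finset B := z.support.image (fun p => p.1.2) ∪ z.support.image (fun p => p.2.2)
    have hS : z.support ⊆ (Finset.univ ×ˢ S) ×ˢ (Finset.univ ×ˢ S) := by
      intro p hp
      simp only [Finset.mem_product, Finset.mem_univ, true_and, S, Finset.mem_union,
        Finset.mem_image]
      exact ⟨Or.inl ⟨p, hp, rfl⟩, Or.inr ⟨p, hp, rfl⟩⟩
    let σ : Fin S.card ≃ S := S.equivFin.symm
    have hσ : ∀ k l, ((σ k : B) = σ l) ↔ k = l := fun k l => by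
      rw [Subtype.coe_inj, σ.injective.eq_iff]
    have main := re_sum_inner_nonneg (N := N) α hc hh₀ (n := S.card)
      (.of fun k l => t false (σ k) (σ l)) (.of fun k l => t true (σ k) (σ l))
      (.of fun k l => z ((false, σ k), (true, σ l))) ?_ (e := fun k => e (σ k))
      (he.comp _ (Subtype.val_injective.comp σ.injective))
    · have e1 : ∀ i k l, ⟪h₀, ((z ((i, (σ k : B)), (i, (σ l : B))) : M.Elem) : H →L[ℂ] H) h₀⟫_ℂ
          = t i (σ k) (σ l) := by
        intro i k l
        rw [ht]
        show ⟪h₀, t i (σ k) (σ l) • h₀⟫_ℂ = _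
        rw [inner_smul_right, h00, mul_one]
      rw [show f₀ z = _ from lsum_eq_sum σ φ z hS]
      simp only [Fintype.sum_bool, φ, hσ]
      have e2 : ∀ i, ∑ k, ∑ l, (if k = l then (c : ℂ) • M.vectorFunctional h₀ h₀ else 0)
          (z ((i, (σ k : B)), (i, (σ l : B)))) = c * ∑ k, t i (σ k) (σ k) := by
        intro i
        rw [Finset.mul_sum]
        refine Finset.sum_congr rfl fun k _ => ?_
        rw [Finset.sum_eq_single k]
        · simp [e1]
        · intro l _ hl
          rw [if_neg hl.symm]; rfl
        · simp
      rw [e2, e2]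
      simp only [LinearMap.zero_apply, Finset.sum_const_zero, add_zero, Complex.add_re,
        Complex.re_ofReal_mul]
      simp only [Matrix.of_apply] at main
      simp only [LinearMap.comp_apply, vectorFunctional_apply]
      linarith
    · intro f f'
      let h : Bool × B → H := fun p =>
        if hb : p.2 ∈ S then (if p.1 then f' (σ.symm ⟨p.2, hb⟩) else f (σ.symm ⟨p.2, hb⟩)) else 0
      have hh : ∀ i k, h (i, σ k) = if i then f' k else f k := by
        intro i k
        simp [h]
      have h3 := (hcone z).1 hzc h
      rw [show g h z = _ from lsum_eq_sum σ _ z hS] at h3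
      simp only [Fintype.sum_bool, vectorFunctional_apply, hh, h2, ht, if_true, Bool.false_eq_true,
        if_false] at h3
      have e1 : ∀ (r : ℂ) (x y : H), ⟪x, (((r • 1 : M.Elem)) : H →L[ℂ] H) y⟫_ℂ = r * ⟪x, y⟫_ℂ :=
        fun r x y => by
          show ⟪x, r • y⟫_ℂ = _
          rw [inner_smul_right]
      have e2 : ∀ (x y : H), ⟪x, ((0 : M.Elem) : H →L[ℂ] H) y⟫_ℂ = 0 := fun x y => by
          show ⟪x, (0 : H)⟫_ℂ = _
          rw [inner_zero_right]
      simp only [e1, e2, Finset.sum_const_zero, add_zero, Complex.add_re] at h3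
      simp only [Matrix.of_apply]
      linarith
  have hone : ∀ (r : ℝ) (x : Bool × B), Finsupp.single (x, x) ((r : ℂ) • (1 : M.Elem)) ∈ P := by
    intro r x
    refine (hP _).2 ⟨fun i b b' => ?_, fun b b' => ?_⟩
    · rw [Finsupp.single_apply]
      split_ifs
      · exact ⟨r, rfl⟩
      · exact ⟨0, by simp⟩
    · rw [Finsupp.single_apply, if_neg]
      intro h
      simp only [Prod.mk.injEq] at h
      have h1 := h.1.symm.trans h.2
      simp at h1
  have hdense : ∀ y : V, ∃ x ∈ P, x + y ∈ cone := by
    intro y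
    induction y using Finsupp.induction_linear with
    | zero => exact ⟨0, P.zero_mem, by rw [add_zero]; exact cone.zero_mem⟩
    | add y y' h h' =>
      obtain ⟨x, hx, hxy⟩ := h
      obtain ⟨x', hx', hxy'⟩ := h'
      exact ⟨x + x', P.add_mem hx hx', by rw [add_add_add_comm]; exact cone.add_mem hxy hxy'⟩
    -- An entry `a` at `(x, y)` is dominated by `‖a‖ / 2` at `(x, x)` and at `(y, y)`, by the
    -- arithmetic–geometric mean inequality.
    | single p a =>
      obtain ⟨x, y⟩ := p
      refine ⟨_, P.add_mem (hone (‖a‖ / 2) x) (hone (‖a‖ / 2) y), ?_⟩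
      rw [hcone]
      intro h
      rw [map_add, map_add, hg, hg, hg]
      have e1 : ∀ w : H, ⟪w, (((((‖a‖ / 2 : ℝ) : ℂ) • 1 : M.Elem)) : H →L[ℂ] H) w⟫_ℂ
          = ((‖a‖ / 2 * ‖w‖ ^ 2 : ℝ) : ℂ) := fun w => by
        show ⟪w, ((‖a‖ / 2 : ℝ) : ℂ) • w⟫_ℂ = _
        rw [inner_smul_right, inner_self_eq_norm_sq_to_K]
        push_cast; rfl
      rw [e1, e1, Complex.add_re, Complex.add_re, Complex.ofReal_re, Complex.ofReal_re]
      have h1 : ‖⟪h x, (a : H →L[ℂ] H) (h y)⟫_ℂ‖ ≤ ‖h x‖ * (‖a‖ * ‖h y‖) :=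
        (norm_inner_le_norm _ _).trans
          (mul_le_mul_of_nonneg_left ((a : H →L[ℂ] H).le_opNorm _) (norm_nonneg _))
      have h2 := (abs_le.1 ((Complex.abs_re_le_norm _).trans h1)).1
      nlinarith [mul_nonneg (norm_nonneg a) (sq_nonneg (‖h x‖ - ‖h y‖))]
  obtain ⟨s, hsP, hscone⟩ := riesz_extension cone
    ⟨P.restrictScalars ℝ, (re f₀).comp (P.restrictScalars ℝ).subtype⟩
    (fun x hx => hpos x x.2 hx) (fun y => by
      obtain ⟨x, hx, h⟩ := hdense y
      exact ⟨⟨x, hx⟩, h⟩)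
  have hsP' : ∀ z ∈ P, s z = (f₀ z).re := fun z hz => hsP ⟨z, hz⟩
  let sC : V →ₗ[ℂ] ℂ := Module.Dual.extendRCLike (𝕜 := ℂ) s
  have hsC : ∀ z, sC z = (s z : ℂ) - Complex.I * (s (Complex.I • z) : ℂ) :=
    fun z => Module.Dual.extendRCLike_apply s z
  have hsCP : ∀ z ∈ P, sC z = f₀ z := by
    intro z hz
    rw [hsC, hsP' z hz, hsP' _ (P.smul_mem _ hz), map_smul]
    apply Complex.ext <;> simp
  refine ⟨fun x y => sC.comp (Finsupp.lsingle (x, y)), fun n x a => ?_, fun i b b' => ?_,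
    fun b b' a => ?_⟩
  · let z : V := ∑ p, ∑ q, Finsupp.single (x p, x q) (star (a p) * a q)
    have hz : ∑ p, ∑ q, (sC.comp (Finsupp.lsingle (x p, x q))) (star (a p) * a q) = sC z := by
      simp only [z, map_sum]
      rfl
    rw [hz]
    have hgz : ∀ h, 0 ≤ g h z := by
      intro h
      have : g h z = ⟪∑ p, (a p : H →L[ℂ] H) (h (x p)), ∑ p, (a p : H →L[ℂ] H) (h (x p))⟫_ℂ := by
        rw [sum_inner]
        simp only [z, map_sum, hg, inner_sum]
        refine Finset.sum_congr rfl fun p _ => Finset.sum_congr rfl fun q _ => ?_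
        exact adjoint_inner_right (a p : H →L[ℂ] H) _ _
      have h5 : g h z = ((‖∑ p, (a p : H →L[ℂ] H) (h (x p))‖ ^ 2 : ℝ) : ℂ) := by
        rw [this]
        push_cast
        exact inner_self_eq_norm_sq_to_K (𝕜 := ℂ) _
      rw [h5]
      exact Complex.zero_le_real.2 (sq_nonneg _)
    have h1 : z ∈ cone := (hcone z).2 fun h => (Complex.nonneg_iff.1 (hgz h)).1
    have him : ∀ h, (g h z).im = 0 := fun h => (Complex.nonneg_iff.1 (hgz h)).2.symm
    -- All forms of `z` are real, so both `i z` and `-i z` lie in the cone and `s` vanishes on them.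
    -- The complexified functional therefore takes a nonnegative real value at `z`.
    have h2 : Complex.I • z ∈ cone := (hcone _).2 fun h => by
      rw [map_smul]; simp [him]
    have h3 : -(Complex.I • z) ∈ cone := (hcone _).2 fun h => by
      rw [map_neg, map_smul]; simp [him]
    have h4 : s (Complex.I • z) = 0 :=
      le_antisymm (by have := hscone _ h3; rw [map_neg] at this; linarith) (hscone _ h2)
    rw [hsC, h4]
    have := hscone _ h1
    simpa using this
  · show sC (Finsupp.single _ _) = _
    have h1 : Finsupp.single ((i, b), (i, b')) (1 : M.Elem) ∈ P := by
      refine (hP _).2 ⟨fun j d d' => ?_, fun d d' => ?_⟩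
      · rw [Finsupp.single_apply]
        split_ifs
        · exact ⟨1, by simp⟩
        · exact ⟨0, by simp⟩
      · rw [Finsupp.single_apply, if_neg]
        intro h
        simp only [Prod.mk.injEq] at h
        have h1 := h.1.1.symm.trans h.2.1
        simp at h1
    rw [hsCP _ h1, hf₀]
    cases i <;> simp only [φ] <;> split_ifs <;> simp [hh₀]
  · show sC (Finsupp.single _ _) = _
    have h1 : Finsupp.single ((false, b), (true, b')) a ∈ P := by
      refine (hP _).2 ⟨fun j d d' => ⟨0, ?_⟩, fun d d' => ?_⟩
      · rw [Finsupp.single_apply, if_neg, zero_smul]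
        intro h
        simp only [Prod.mk.injEq] at h
        have h1 := h.1.1.trans h.2.1.symm
        simp at h1
      · rw [Finsupp.single_apply, if_neg]
        intro h
        simp only [Prod.mk.injEq] at h
        have h1 := h.1.1
        simp at h1
    rw [hsCP _ h1, hf₀]
    rfl

end VonNeumannAlgebra

end

noncomputable section

set_option linter.unusedSectionVars false

open scoped ComplexOrder InnerProductSpace

namespace VonNeumannAlgebra

open ContinuousLinearMap HilbertSpaceTools

universe u v

variable {H : Type u} [NormedAddCommGroup H] [InnerProductSpace ℂ H] [CompleteSpace H]
variable {K : Type v} [NormedAddCommGroup K] [InnerProductSpace ℂ K] [CompleteSpace K]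

/-! ### Dilation of positive kernels -/

section Kolmogorov

universe w₁ w₂

variable {X : Type w₁} {V : Type w₂} {L : Type*} [NormedAddCommGroup V] [InnerProductSpace ℂ V] [CompleteSpace V]
variable [NormedAddCommGroup L] [InnerProductSpace ℂ L] [CompleteSpace L]

theorem inner_self_eq_ofReal {W : Type*} [NormedAddCommGroup W] [InnerProductSpace ℂ W] (x : W) :
    ⟪x, x⟫_ℂ = ((‖x‖ ^ 2 : ℝ) : ℂ) := by
  push_cast
  exact inner_self_eq_norm_sq_to_K (𝕜 := ℂ) x

theorem eq_of_adjoint_comp {W : Type*} [NormedAddCommGroup W] [InnerProductSpace ℂ W]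
    {T : X → V →L[ℂ] L} (hT : rangeSpan T = ⊤) {A B : W →L[ℂ] L}
    (h : ∀ x, adjoint (T x) ∘L A = adjoint (T x) ∘L B) : A = B := by
  ext w
  rw [← sub_eq_zero]
  have h1 : A w - B w ∈ (rangeSpan T)ᗮ := by
    rw [mem_rangeSpan_orthogonal]
    intro x
    rw [map_sub, sub_eq_zero]
    exact congrArg (fun f => f w) (h x)
  rw [hT, Submodule.top_orthogonal_eq_bot] at h1
  exact h1

/-- A bounded operator is determined by its values on a total family, provided that the family of
values is dominated in the sense of Gram matrices. -/
theorem exists_clm_of_gram {L' : Type*} [NormedAddCommGroup L']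
    [InnerProductSpace ℂ L'] [CompleteSpace L'] {T : X → V →L[ℂ] L} {T' T'' : X → V →L[ℂ] L'}
    (hT : rangeSpan T = ⊤) (C : ℝ)
    (h : ∀ x y, adjoint (T' x) ∘L T' y + adjoint (T'' x) ∘L T'' y
      = ((C ^ 2 : ℝ) : ℂ) • (adjoint (T x) ∘L T y)) :
    ∃ S : L →L[ℂ] L', ∀ x, S ∘L T x = T' x := by
  let e : (X →₀ V) →ₗ[ℂ] L := Finsupp.lsum ℂ fun i => (T i : V →ₗ[ℂ] L)
  let f : (X →₀ V) →ₗ[ℂ] L' := Finsupp.lsum ℂ fun i => (T' i : V →ₗ[ℂ] L')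
  let f' : (X →₀ V) →ₗ[ℂ] L' := Finsupp.lsum ℂ fun i => (T'' i : V →ₗ[ℂ] L')
  have he : ∀ i x, e (Finsupp.single i x) = T i x := fun i x => by simp [e]
  have hf : ∀ i x, f (Finsupp.single i x) = T' i x := fun i x => by simp [f]
  have hf' : ∀ i x, f' (Finsupp.single i x) = T'' i x := fun i x => by simp [f']
  have hin : ∀ v w, ⟪f v, f w⟫_ℂ + ⟪f' v, f' w⟫_ℂ = ((C ^ 2 : ℝ) : ℂ) * ⟪e v, e w⟫_ℂ := by
    intro v w
    induction v using Finsupp.induction_linear with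
    | zero => simp
    | add v v' h1 h2 =>
      simp only [map_add, inner_add_left]
      linear_combination h1 + h2
    | single i x =>
      induction w using Finsupp.induction_linear with
      | zero => simp
      | add v v' h1 h2 =>
        simp only [map_add, inner_add_right]
        linear_combination h1 + h2
      | single j y =>
        rw [he, he, hf, hf, hf', hf', ← adjoint_inner_right, ← adjoint_inner_right,
          ← adjoint_inner_right, ← inner_smul_right, ← inner_add_right]
        exact congrArg (fun g => ⟪x, g y⟫_ℂ) (h i j)
  have hdense : DenseRange e := by
    have h1 : Submodule.span ℂ {y | ∃ i x, y = T i x} ≤ LinearMap.range e := by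
      rw [Submodule.span_le]
      rintro _ ⟨i, x, rfl⟩
      exact ⟨_, he i x⟩
    have h2 := (Submodule.dense_iff_topologicalClosure_eq_top.2 hT).mono h1
    simpa [DenseRange] using! h2
  have hbd : ∀ v, ‖f v‖ ≤ |C| * ‖e v‖ := by
    intro v
    refine le_of_sq_le_sq ?_ (by positivity)
    have h1 := hin v v
    simp only [inner_self_eq_ofReal] at h1
    have h2 : ‖f v‖ ^ 2 + ‖f' v‖ ^ 2 = C ^ 2 * ‖e v‖ ^ 2 := by exact_mod_cast h1
    rw [mul_pow, sq_abs]
    nlinarith [sq_nonneg ‖f' v‖]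
  refine ⟨f.extendOfNorm e, fun i => ?_⟩
  ext x
  have := LinearMap.extendOfNorm_eq hdense ⟨_, hbd⟩ (Finsupp.single i x)
  rw [he, hf] at this
  exact this

/-- The kernel is the Gram kernel of the point evaluations' adjoints in its reproducing kernel
Hilbert space. Positivity over the complex numbers already contains hermitian symmetry, by
polarization with `η` and `i η`. -/
theorem exists_kolmogorov (k : X → X → V →L[ℂ] V)
    (hk : ∀ (n : ℕ) (x : Fin n → X) (ξ : Fin n → V), 0 ≤ ∑ p, ∑ q, ⟪ξ p, k (x p) (x q) (ξ q)⟫_ℂ) :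
    ∃ (L : Type (max w₁ w₂)) (_ : NormedAddCommGroup L) (_ : InnerProductSpace ℂ L) (_ : CompleteSpace L)
      (T : X → V →L[ℂ] L), (∀ x y, adjoint (T x) ∘L T y = k x y) ∧ rangeSpan T = ⊤ := by
  have hherm : ∀ x y, adjoint (k y x) = k x y := by
    intro x y
    have h1 : ∀ (x : X) (ξ : V), (⟪ξ, k x x ξ⟫_ℂ).im = 0 := by
      intro x ξ
      have := hk 1 (fun _ => x) (fun _ => ξ)
      simp only [Fin.sum_univ_one] at this
      exact (Complex.nonneg_iff.1 this).2.symm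
    have h2 : ∀ ξ η, (⟪ξ, k x y η⟫_ℂ).im + (⟪η, k y x ξ⟫_ℂ).im = 0 := by
      intro ξ η
      have := (Complex.nonneg_iff.1 (hk 2 ![x, y] ![ξ, η])).2
      simp only [Fin.sum_univ_two, Matrix.cons_val_zero, Matrix.cons_val_one, Complex.add_im,
        h1] at this
      linarith
    ext η
    refine ext_inner_left ℂ fun ξ => ?_
    rw [adjoint_inner_right, ← inner_conj_symm]
    have h3 := h2 ξ η
    have h4 := h2 ξ (Complex.I • η)
    rw [map_smul, inner_smul_right, inner_smul_left] at h4
    simp only [Complex.mul_im, Complex.I_re, Complex.I_im, Complex.conj_I, Complex.neg_re,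
      Complex.neg_im] at h4
    apply Complex.ext
    · rw [Complex.conj_re]; linarith
    · rw [Complex.conj_im]; linarith
  let 𝒦 : Matrix X X (V →L[ℂ] V) := .of k
  have hpos : 𝒦.PosSemidef := by
    have hiff := (RKHS.posSemidef_tfae (𝕜 := ℂ) (K := 𝒦)).out 0 2
    refine hiff.2 ⟨?_, fun vv => ?_⟩
    · ext1 x y
      exact hherm x y
    · let σ := vv.support.equivFin.symm
      have hS : ∀ F : X → ℂ, ∑ b ∈ vv.support, F b = ∑ k, F (σ k) := by
        intro F
        rw [← Finset.sum_coe_sort, ← σ.sum_comp]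
      have h1 := hk vv.support.card (fun p => σ p) (fun p => vv (σ p))
      have h2 : (vv.sum fun x w => vv.sum fun x' w' => ⟪𝒦 x' x w, w'⟫_ℂ)
          = star (∑ p, ∑ q, ⟪vv (σ p), k (σ p) (σ q) (vv (σ q))⟫_ℂ) := by
        simp only [Finsupp.sum, hS, star_sum]
        rw [Finset.sum_comm]
        refine Finset.sum_congr rfl fun p _ => Finset.sum_congr rfl fun q _ => ?_
        exact (inner_conj_symm _ _).symm
      rw [h2]
      exact (Complex.nonneg_iff.1 h1).1
  have : Fact 𝒦.PosSemidef := ⟨hpos⟩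
  refine ⟨RKHS.OfKernel 𝒦, inferInstance, inferInstance, inferInstance,
    RKHS.kerFun (RKHS.OfKernel 𝒦), fun x y => ?_, ?_⟩
  · rw [← RKHS.kernel_apply, RKHS.OfKernel.kernel_ofKernel]
    rfl
  · have := RKHS.kerFun_dense (𝕜 := ℂ) (RKHS.OfKernel 𝒦)
    rw [← this, rangeSpan]
    congr 3
    ext y
    exact ⟨fun ⟨i, x, h⟩ => ⟨i, x, h.symm⟩, fun ⟨i, x, h⟩ => ⟨i, x, h.symm⟩⟩

end Kolmogorov

end VonNeumannAlgebra

end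

noncomputable section

set_option linter.unusedSectionVars false

open scoped ComplexOrder InnerProductSpace

namespace VonNeumannAlgebra

open ContinuousLinearMap HilbertSpaceTools

universe u v w₁ w₂ w₃

variable {H : Type u} [NormedAddCommGroup H] [InnerProductSpace ℂ H] [CompleteSpace H]
variable {K : Type v} [NormedAddCommGroup K] [InnerProductSpace ℂ K] [CompleteSpace K]

/-! ### Stinespring dilations -/

section Stinespring

variable {ι : Type w₁} {V : Type w₂} {L : Type w₃} [NormedAddCommGroup V] [InnerProductSpace ℂ V]
variable [CompleteSpace V]
variable [NormedAddCommGroup L] [InnerProductSpace ℂ L] [CompleteSpace L]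

theorem exists_elem_defect {M : VonNeumannAlgebra H} (a : M.Elem) :
    ∃ d : M.Elem, star d * d = ((‖a‖ ^ 2 : ℝ) : ℂ) • 1 - star a * a := by
  obtain ⟨d, hd, h⟩ := M.exists_defect a.2
  refine ⟨⟨d, hd⟩, Subtype.ext ?_⟩
  show star d * d = ((‖a‖ ^ 2 : ℝ) : ℂ) • (1 : H →L[ℂ] H) - star (a : H →L[ℂ] H) * a
  rw [h, Algebra.algebraMap_eq_smul_one]
  rfl

/-- Dilate the kernel `(a, i), (b, j) ↦ Φ i j (a* b)`. Left multiplication by `m` is bounded on the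
dilation space because `‖m‖² - m* m = d* d`: the Gram matrices of the vectors multiplied by `m` and
by `d` add up to `‖m‖²` times the original one. Nothing makes `ρ` normal. -/
theorem exists_stinespring {M : VonNeumannAlgebra H} (Φ : ι → ι → M.Elem →ₗ[ℂ] (V →L[ℂ] V))
    (hΦ : ∀ (n : ℕ) (i : Fin n → ι) (a : Fin n → M.Elem) (ξ : Fin n → V),
      0 ≤ ∑ p, ∑ q, ⟪ξ p, Φ (i p) (i q) (star (a p) * a q) (ξ q)⟫_ℂ) :
    ∃ (L : Type (max u w₁ w₂)) (_ : NormedAddCommGroup L) (_ : InnerProductSpace ℂ L)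
      (_ : CompleteSpace L) (T : ι → V →L[ℂ] L) (ρ : M.Elem →⋆ₐ[ℂ] (L →L[ℂ] L)),
      (∀ i j a, adjoint (T i) ∘L ρ a ∘L T j = Φ i j a) ∧
      rangeSpan (fun p : M.Elem × ι => ρ p.1 ∘L T p.2) = ⊤ := by
  obtain ⟨L, _, _, _, T, hT, htot⟩ := exists_kolmogorov
    (fun x y : M.Elem × ι => Φ x.2 y.2 (star x.1 * y.1))
    (fun n x ξ => hΦ n (fun p => (x p).2) (fun p => (x p).1) ξ)
  have hex : ∀ m : M.Elem, ∃ S : L →L[ℂ] L, ∀ x : M.Elem × ι, S ∘L T x = T (m * x.1, x.2) := by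
    intro m
    obtain ⟨d, hd⟩ := exists_elem_defect m
    refine exists_clm_of_gram (T' := fun x : M.Elem × ι => T (m * x.1, x.2))
      (T'' := fun x => T (d * x.1, x.2)) htot ‖m‖ fun x y => ?_
    rw [hT, hT, hT, ← map_add, ← map_smul]
    congr 1
    have e : ∀ b : M.Elem, star (b * x.1) * (b * y.1) = star x.1 * (star b * b) * y.1 := fun b => by
      rw [star_mul]; noncomm_ring
    simp only
    rw [e, e, ← add_mul, ← mul_add, hd, add_sub_cancel, mul_smul_comm, mul_one, smul_mul_assoc]
  choose S hS using hex
  have hone : ∀ (a : M.Elem) (i : ι), S a ∘L T (1, i) = T (a, i) := fun a i => by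
    rw [hS]; simp
  have hadd : ∀ a b i, T (a + b, i) = T (a, i) + T (b, i) := fun a b i =>
    eq_of_adjoint_comp htot fun x => by
      rw [comp_add, hT, hT, hT, ← map_add]; simp only [mul_add]
  have hsmul : ∀ (c : ℂ) a i, T (c • a, i) = c • T (a, i) := fun c a i =>
    eq_of_adjoint_comp htot fun x => by
      rw [comp_smul, hT, hT, ← map_smul]; simp only [mul_smul_comm]
  let ρ : M.Elem →⋆ₐ[ℂ] (L →L[ℂ] L) :=
    { toFun := S
      map_one' := clm_ext_of_rangeSpan htot fun x => by rw [hS, one_mul]; rfl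
      map_mul' := fun a b => clm_ext_of_rangeSpan htot fun x => by
        rw [hS, mul_assoc]
        show _ = S a ∘L (S b ∘L T x)
        rw [hS, hS]
      map_zero' := clm_ext_of_rangeSpan htot fun x => by
        rw [hS, zero_mul, zero_comp, ← zero_smul ℂ (0 : M.Elem), hsmul, zero_smul]
      map_add' := fun a b => clm_ext_of_rangeSpan htot fun x => by
        rw [hS, add_comp, hS, hS, add_mul, hadd]
      commutes' := fun c => clm_ext_of_rangeSpan htot fun x => by
        rw [hS, Algebra.algebraMap_eq_smul_one, smul_mul_assoc, one_mul, hsmul,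
          Algebra.algebraMap_eq_smul_one, smul_comp]
        rfl
      map_star' := fun a => clm_ext_of_rangeSpan htot fun y => eq_of_adjoint_comp htot fun x => by
        rw [hS, hT]
        show _ = adjoint (T x) ∘L adjoint (S a) ∘L T y
        rw [← comp_assoc, ← adjoint_comp, hS, hT, star_mul, mul_assoc] }
  have hρ : ∀ a, ρ a = S a := fun a => rfl
  refine ⟨L, inferInstance, inferInstance, inferInstance, fun i => T (1, i), ρ, fun i j a => ?_, ?_⟩
  · rw [hρ, hone, hT]; simp
  · have : (fun p : M.Elem × ι => ρ p.1 ∘L T (1, p.2)) = T := by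
      funext p
      rw [hρ, hone]
    rw [this, htot]

/-- Arveson's commutant lifting. All Gram operators of the total family `ρ(a) T i` commute with `y`,
so the defect argument also bounds `ρ(a) T i ξ ↦ ρ(a) T i y ξ`, and this map commutes with `ρ`. -/
theorem exists_commutant_lift {M : VonNeumannAlgebra H} {T : ι → V →L[ℂ] L}
    {ρ : M.Elem →⋆ₐ[ℂ] (L →L[ℂ] L)}
    (htot : rangeSpan (fun p : M.Elem × ι => ρ p.1 ∘L T p.2) = ⊤) {W : VonNeumannAlgebra V}
    (hW : ∀ i j a, adjoint (T i) ∘L ρ a ∘L T j ∈ W) {y : V →L[ℂ] V} (hy : y ∈ W.commutant) :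
    ∃ σ : L →L[ℂ] L, (∀ i, σ ∘L T i = T i ∘L y) ∧ (∀ i, adjoint σ ∘L T i = T i ∘L adjoint y) ∧
      ∀ a, σ ∘L ρ a = ρ a ∘L σ := by
  have hgram : ∀ x z : M.Elem × ι, adjoint (ρ x.1 ∘L T x.2) ∘L (ρ z.1 ∘L T z.2)
      = adjoint (T x.2) ∘L ρ (star x.1 * z.1) ∘L T z.2 := by
    intro x z
    rw [adjoint_comp, map_mul, map_star]
    rfl
  have hcomm : ∀ y ∈ W.commutant, ∀ x z : M.Elem × ι,
      adjoint (ρ x.1 ∘L T x.2) ∘L (ρ z.1 ∘L T z.2) * y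
        = y * (adjoint (ρ x.1 ∘L T x.2) ∘L (ρ z.1 ∘L T z.2)) := by
    intro y hy x z
    rw [hgram]
    exact commutant_comm (hW _ _ _) hy
  have hex : ∀ y ∈ W.commutant, ∃ S : L →L[ℂ] L, ∀ x : M.Elem × ι,
      S ∘L (ρ x.1 ∘L T x.2) = (ρ x.1 ∘L T x.2) ∘L y := by
    intro y hy
    obtain ⟨d, hd, h⟩ := W.commutant.exists_defect hy
    refine exists_clm_of_gram (T' := fun x : M.Elem × ι => (ρ x.1 ∘L T x.2) ∘L y)
      (T'' := fun x => (ρ x.1 ∘L T x.2) ∘L d) htot ‖y‖ fun x z => ?_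
    have e : ∀ b ∈ W.commutant,
        adjoint ((ρ x.1 ∘L T x.2) ∘L b) ∘L ((ρ z.1 ∘L T z.2) ∘L b)
        = star b * b * (adjoint (ρ x.1 ∘L T x.2) ∘L (ρ z.1 ∘L T z.2)) := by
      intro b hb
      rw [mul_assoc, ← hcomm b hb, adjoint_comp]
      rfl
    rw [e y hy, e d hd, h, ← add_mul, add_sub_cancel, Algebra.algebraMap_eq_smul_one,
      smul_mul_assoc, one_mul]
    rfl
  obtain ⟨σ, hσ⟩ := hex y hy
  obtain ⟨τ, hτ⟩ := hex (adjoint y) (W.commutant.adjoint_mem hy)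
  have hadj : adjoint σ = τ := by
    refine clm_ext_of_rangeSpan htot fun z => eq_of_adjoint_comp htot fun x => ?_
    rw [hτ, ← comp_assoc, ← adjoint_comp, hσ, adjoint_comp]
    exact (hcomm _ (W.commutant.adjoint_mem hy) x z).symm
  have h1 : ∀ i, ρ 1 ∘L T i = T i := fun i => by rw [map_one]; rfl
  refine ⟨σ, fun i => ?_, fun i => ?_, fun a => ?_⟩
  · have := hσ (1, i)
    simpa only [h1] using this
  · have := hτ (1, i)
    rw [hadj]
    simpa only [h1] using this
  · refine clm_ext_of_rangeSpan htot fun x => ?_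
    have h2 : ∀ x : M.Elem × ι, ρ a ∘L (ρ x.1 ∘L T x.2) = ρ (a * x.1) ∘L T x.2 := fun x => by
      rw [map_mul]; rfl
    rw [comp_assoc, h2, comp_assoc, hσ, ← comp_assoc (ρ a), h2]
    exact hσ (a * x.1, x.2)

/-- The map `a ↦ R* ρ(a) R'`. -/
def corner {M : VonNeumannAlgebra H} (ρ : M.Elem →⋆ₐ[ℂ] (L →L[ℂ] L)) (R R' : V →L[ℂ] L) :
    M.Elem →ₗ[ℂ] (V →L[ℂ] V) where
  toFun a := adjoint R ∘L ρ a ∘L R'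
  map_add' a b := by rw [map_add, add_comp, comp_add]
  map_smul' r a := by rw [map_smul, smul_comp, comp_smul]; rfl

theorem corner_apply {M : VonNeumannAlgebra H} (ρ : M.Elem →⋆ₐ[ℂ] (L →L[ℂ] L))
    (R R' : V →L[ℂ] L) (a : M.Elem) : corner ρ R R' a = adjoint R ∘L ρ a ∘L R' := rfl

theorem inner_corner {M : VonNeumannAlgebra H} (ρ : M.Elem →⋆ₐ[ℂ] (L →L[ℂ] L))
    (R R' : V →L[ℂ] L) (a : M.Elem) (ξ η : V) : ⟪η, corner ρ R R' a ξ⟫_ℂ = ⟪R η, ρ a (R' ξ)⟫_ℂ := by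
  rw [corner_apply, coe_comp, Function.comp_apply, adjoint_inner_right]
  rfl

theorem sum_inner_corner_nonneg {M : VonNeumannAlgebra H} (ρ : M.Elem →⋆ₐ[ℂ] (L →L[ℂ] L))
    (R : ι → V →L[ℂ] L) (n : ℕ) (i : Fin n → ι) (a : Fin n → M.Elem) (ξ : Fin n → V) :
    0 ≤ ∑ p, ∑ q, ⟪ξ p, corner ρ (R (i p)) (R (i q)) (star (a p) * a q) (ξ q)⟫_ℂ := by
  have : ∑ p, ∑ q, ⟪ξ p, corner ρ (R (i p)) (R (i q)) (star (a p) * a q) (ξ q)⟫_ℂ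
      = ⟪∑ p, ρ (a p) (R (i p) (ξ p)), ∑ p, ρ (a p) (R (i p) (ξ p))⟫_ℂ := by
    rw [sum_inner]
    refine Finset.sum_congr rfl fun p _ => ?_
    rw [inner_sum]
    refine Finset.sum_congr rfl fun q _ => ?_
    have h1 : ρ (star (a p) * a q) = adjoint (ρ (a p)) ∘L ρ (a q) := by
      rw [map_mul, map_star]; rfl
    rw [inner_corner, h1, coe_comp, Function.comp_apply, adjoint_inner_right]
  rw [this, inner_self_eq_ofReal]
  have h2 := sq_nonneg ‖∑ p, ρ (a p) (R (i p) (ξ p))‖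
  exact Complex.zero_le_real.2 h2

end Stinespring

/-- A completely bounded map is a corner of a representation. -/
theorem exists_completelyBounded_dilation {M : VonNeumannAlgebra H} {N : VonNeumannAlgebra K}
    (α : M.Elem →ₗ[ℂ] N.Elem) {c : ℝ} (hc0 : 0 ≤ c)
    (hc : ∀ (n : ℕ) (x : Matrix (Fin n) (Fin n) M.Elem), M.matrixNorm x ≤ 1 →
      N.matrixNorm (x.map α) ≤ c) {h₀ : H} (hh₀ : ‖h₀‖ = 1) :
    ∃ (L : Type (max u v)) (_ : NormedAddCommGroup L) (_ : InnerProductSpace ℂ L)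
      (_ : CompleteSpace L) (R : Bool → K →L[ℂ] L) (ρ : M.Elem →⋆ₐ[ℂ] (L →L[ℂ] L)),
      (∀ i, adjoint (R i) ∘L R i = (c : ℂ) • 1) ∧ ∀ a, corner ρ (R false) (R true) a = α a := by
  classical
  obtain ⟨B, e, he⟩ := exists_hilbertBasis ℂ K
  obtain ⟨s, hs, hs1, hsα⟩ := exists_kernel_extension α hc hh₀ e.orthonormal
  -- The scalar kernel is regarded as a kernel of operators on `ℂ`, to which the dilation theorem
  -- applies.
  obtain ⟨Ψ, hΨ⟩ : ∃ Ψ : Bool × B → Bool × B → M.Elem →ₗ[ℂ] (ℂ →L[ℂ] ℂ),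
      ∀ x y a z, Ψ x y a z = s x y a * z :=
    ⟨fun x y => (LinearMap.toSpanSingleton ℂ (ℂ →L[ℂ] ℂ) 1).comp (s x y), fun x y a z => rfl⟩
  have hpos : ∀ (n : ℕ) (x : Fin n → Bool × B) (a : Fin n → M.Elem) (ξ : Fin n → ℂ),
      0 ≤ ∑ p, ∑ q, ⟪ξ p, Ψ (x p) (x q) (star (a p) * a q) (ξ q)⟫_ℂ := by
    intro n x a ξ
    have h1 := hs n x fun p => ξ p • a p
    refine le_of_le_of_eq h1 ?_
    refine Finset.sum_congr rfl fun p _ => Finset.sum_congr rfl fun q _ => ?_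
    rw [star_smul, smul_mul_smul_comm, map_smul, hΨ]
    show _ = s (x p) (x q) (star (a p) * a q) * ξ q * star (ξ p)
    rw [smul_eq_mul]
    ring
  obtain ⟨L, _, _, _, T, ρ, hT, -⟩ := exists_stinespring (V := ℂ) Ψ hpos
  have hTs : ∀ x y a, ⟪T x 1, ρ a (T y 1)⟫_ℂ = s x y a := by
    intro x y a
    have h1 := congrArg (fun f => ⟪(1 : ℂ), f 1⟫_ℂ) (hT x y a)
    simp only [coe_comp, Function.comp_apply, adjoint_inner_right] at h1
    rw [h1, hΨ]
    show s x y a * 1 * (starRingEnd ℂ) 1 = _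
    simp
  have htot : rangeSpan (fun b => toSpanSingleton ℂ (e b)) = ⊤ := by
    rw [eq_top_iff, ← e.dense_span]
    refine Submodule.topologicalClosure_mono (Submodule.span_mono ?_)
    rintro _ ⟨b, rfl⟩
    exact ⟨b, 1, by simp⟩
  have hcc : (((√c) ^ 2 : ℝ) : ℂ) = c := by rw [Real.sq_sqrt hc0]
  have hgram : ∀ i b b', adjoint (T (i, b)) ∘L T (i, b')
      = (c : ℂ) • (adjoint (toSpanSingleton ℂ (e b)) ∘L toSpanSingleton ℂ (e b')) := by
    intro i b b'
    ext
    refine ext_inner_left ℂ fun z => ?_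
    have h1 := (hTs (i, b) (i, b') 1).trans (hs1 i b b')
    rw [map_one ρ] at h1
    have hz : z = z • 1 := by simp
    rw [smul_apply, inner_smul_right, coe_comp, coe_comp, Function.comp_apply, Function.comp_apply,
      adjoint_inner_right, adjoint_inner_right, hz, map_smul, map_smul, inner_smul_left,
      inner_smul_left, toSpanSingleton_apply, toSpanSingleton_apply, one_smul, one_smul,
      orthonormal_iff_ite.1 e.orthonormal]
    rw [show ⟪T (i, b) 1, T (i, b') 1⟫_ℂ = _ from h1]
    split_ifs <;> ring
  -- The vectors `T (i, b) 1` have Gram matrix `c` times the identity, so mapping the Hilbert basis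
  -- onto them gives `√c` times an isometry.
  have hR : ∀ i : Bool, ∃ R : K →L[ℂ] L, (∀ b, R (e b) = T (i, b) 1) ∧
      adjoint R ∘L R = (c : ℂ) • 1 := by
    intro i
    obtain ⟨R, hR⟩ := exists_clm_of_gram (T' := fun b => T (i, b)) (T'' := fun _ => 0) htot (√c)
      (fun b b' => by rw [hcc, ← hgram i b b', comp_zero, add_zero])
    refine ⟨R, fun b => ?_, ?_⟩
    · rw [← hR b, coe_comp, Function.comp_apply, toSpanSingleton_apply, one_smul]
    · refine clm_ext_of_rangeSpan htot fun b' => eq_of_adjoint_comp htot fun b => ?_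
      rw [comp_assoc, hR, ← comp_assoc, ← adjoint_comp, hR, hgram, smul_comp, comp_smul]
      rfl
  choose R hR1 hR2 using hR
  refine ⟨L, inferInstance, inferInstance, inferInstance, R, ρ, hR2, fun a => ?_⟩
  · refine clm_ext_of_rangeSpan htot fun b' => eq_of_adjoint_comp htot fun b => ?_
    ext
    refine ext_inner_left ℂ fun z => ?_
    simp only [coe_comp, Function.comp_apply, adjoint_inner_right, toSpanSingleton_apply, one_smul,
      inner_smul_left]
    rw [inner_corner, hR1, hR1, hTs, hsα]

end VonNeumannAlgebra

end

/-! ### Dilations with corners in an injective algebra. -/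

noncomputable section

set_option linter.unusedSectionVars false

open scoped ComplexOrder InnerProductSpace

namespace VonNeumannAlgebra

open ContinuousLinearMap HilbertSpaceTools

universe u v w₁ w₂ w₃

variable {H : Type u} [NormedAddCommGroup H] [InnerProductSpace ℂ H] [CompleteSpace H]
variable {K : Type v} [NormedAddCommGroup K] [InnerProductSpace ℂ K] [CompleteSpace K]

/-- A case of the Schur product theorem: the sum is the squared norm of `∑ x p ⊗ ξ p`. -/
theorem sum_inner_mul_inner_nonneg {n : ℕ} (x : Fin n → H) (ξ : Fin n → K) :
    0 ≤ ∑ p, ∑ q, ⟪x p, x q⟫_ℂ * ⟪ξ p, ξ q⟫_ℂ := by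
  have : ∑ p, ∑ q, ⟪x p, x q⟫_ℂ * ⟪ξ p, ξ q⟫_ℂ
      = ⟪∑ p, TensorProduct.tmul ℂ (x p) (ξ p), ∑ p, TensorProduct.tmul ℂ (x p) (ξ p)⟫_ℂ := by
    rw [sum_inner]
    refine Finset.sum_congr rfl fun p _ => ?_
    rw [inner_sum]
    refine Finset.sum_congr rfl fun q _ => ?_
    rw [TensorProduct.inner_tmul]
  rw [this]
  set w := ∑ p, TensorProduct.tmul ℂ (x p) (ξ p)
  have h1 : 0 ≤ (⟪w, w⟫_ℂ).re := inner_self_nonneg (𝕜 := ℂ) (x := w)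
  have h2 : (⟪w, w⟫_ℂ).im = 0 := inner_self_im (𝕜 := ℂ) w
  exact Complex.nonneg_iff.2 ⟨h1, h2.symm⟩

/-- A completely bounded map into an injective algebra is a corner of a representation all of whose
relevant corners take values in the algebra. -/
theorem exists_injective_dilation {M : VonNeumannAlgebra H} {N : VonNeumannAlgebra K}
    (hN : N.IsInjective) {s : ℕ → K →L[ℂ] K} (hsN : ∀ n, s n ∈ N)
    (hs : ∀ i j, star (s i) * s j = if i = j then 1 else 0)
    (α : M.Elem →ₗ[ℂ] N.Elem) {c : ℝ} (hc0 : 0 ≤ c)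
    (hc : ∀ (n : ℕ) (x : Matrix (Fin n) (Fin n) M.Elem), M.matrixNorm x ≤ 1 →
      N.matrixNorm (x.map α) ≤ c) {h₀ : H} (hh₀ : ‖h₀‖ = 1) :
    ∃ (L : Type (max u v)) (_ : NormedAddCommGroup L) (_ : InnerProductSpace ℂ L)
      (_ : CompleteSpace L) (T : Option Bool → K →L[ℂ] L) (ρ : M.Elem →⋆ₐ[ℂ] (L →L[ℂ] L)),
      (∀ i j a, adjoint (T i) ∘L ρ a ∘L T j ∈ N) ∧
      (∀ i, adjoint (T (some i)) ∘L T (some i) = (c : ℂ) • 1) ∧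
      (∀ a, adjoint (T (some false)) ∘L ρ a ∘L T (some true) = α a) ∧
      (∀ a, adjoint (T none) ∘L ρ a ∘L T none = ⟪h₀, (a : H →L[ℂ] H) h₀⟫_ℂ • 1) ∧
      rangeSpan (fun p : M.Elem × Option Bool => ρ p.1 ∘L T p.2) = ⊤ := by
  obtain ⟨F, hFN, hFfix, hF⟩ := exists_completelyPositive_projection hN hsN hs
  obtain ⟨L₀, _, _, _, R, ρ₀, hR, hα⟩ := exists_completelyBounded_dilation α hc0 hc hh₀
  -- The index `none` receives nothing from `ρ₀`. Its only corner is the vector state of `h₀` times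
  -- `1`, added through `Ψ`; it will supply an isometry of `N` inside the normal part.
  let R' : Option Bool → K →L[ℂ] L₀ := fun i => i.elim 0 R
  have hF1 : F 1 = 1 := hFfix 1 (one_mem N)
  let Ψ : M.Elem →ₗ[ℂ] (K →L[ℂ] K) :=
    (LinearMap.toSpanSingleton ℂ (K →L[ℂ] K) 1).comp (M.vectorFunctional h₀ h₀)
  have hΨ : ∀ a, Ψ a = ⟪h₀, (a : H →L[ℂ] H) h₀⟫_ℂ • 1 := fun a => rfl
  -- `F` moves all corners into `N`, fixes `α` and the scalar diagonal, and preserves positivity of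
  -- the kernel.
  let Φ : Option Bool → Option Bool → M.Elem →ₗ[ℂ] (K →L[ℂ] K) := fun i j =>
    F.comp (corner ρ₀ (R' i) (R' j)) + if i = none ∧ j = none then Ψ else 0
  have hΦ0 : ∀ i j a, Φ i j a = F (corner ρ₀ (R' i) (R' j) a)
      + if i = none ∧ j = none then ⟪h₀, (a : H →L[ℂ] H) h₀⟫_ℂ • 1 else 0 := by
    intro i j a
    rw [show Φ i j a = F (corner ρ₀ (R' i) (R' j) a) +
      (if i = none ∧ j = none then Ψ else 0 : M.Elem →ₗ[ℂ] (K →L[ℂ] K)) a from rfl]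
    split_ifs
    · rw [hΨ]
    · rfl
  have hpos : ∀ (n : ℕ) (i : Fin n → Option Bool) (a : Fin n → M.Elem) (ξ : Fin n → K),
      0 ≤ ∑ p, ∑ q, ⟪ξ p, Φ (i p) (i q) (star (a p) * a q) (ξ q)⟫_ℂ := by
    intro n i a ξ
    have h1 := hF (Fin n) (fun p q => corner ρ₀ (R' (i p)) (R' (i q)) (star (a p) * a q))
      (sum_inner_corner_nonneg ρ₀ R' n i a) ξ
    have h2 := sum_inner_mul_inner_nonneg (fun p => (a p : H →L[ℂ] H) h₀)
      (fun p => if i p = none then ξ p else 0)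
    refine le_of_le_of_eq (add_nonneg h1 h2) ?_
    rw [← Finset.sum_add_distrib]
    refine Finset.sum_congr rfl fun p _ => ?_
    rw [← Finset.sum_add_distrib]
    refine Finset.sum_congr rfl fun q _ => ?_
    rw [hΦ0, add_apply, inner_add_right]
    congr 1
    have h3 : ⟪h₀, ((star (a p) * a q : M.Elem) : H →L[ℂ] H) h₀⟫_ℂ
        = ⟪(a p : H →L[ℂ] H) h₀, (a q : H →L[ℂ] H) h₀⟫_ℂ :=
      adjoint_inner_right (a p : H →L[ℂ] H) _ _
    by_cases hp : i p = none
    · by_cases hq : i q = none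
      · rw [if_pos hp, if_pos hq, if_pos ⟨hp, hq⟩, h3, smul_apply, inner_smul_right]
        rfl
      · rw [if_neg hq, if_neg (show ¬(i p = none ∧ i q = none) from fun h => hq h.2), inner_zero_right, mul_zero]
        simp
    · rw [if_neg hp, if_neg (show ¬(i p = none ∧ i q = none) from fun h => hp h.1), inner_zero_left, mul_zero]
      simp
  obtain ⟨L, _, _, _, T, ρ, hT, htot⟩ := exists_stinespring Φ hpos
  have h1 : ∀ i, adjoint (T i) ∘L T i = Φ i i 1 := fun i => by
    rw [← hT, map_one]; rfl
  refine ⟨L, inferInstance, inferInstance, inferInstance, T, ρ, fun i j a => ?_, fun i => ?_,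
    fun a => ?_, fun a => ?_, htot⟩
  · rw [hT, hΦ0]
    refine add_mem (hFN _) ?_
    split_ifs
    · exact N.toStarSubalgebra.smul_mem (one_mem N) _
    · exact zero_mem N
  · have h2 : corner ρ₀ (R' (some i)) (R' (some i)) 1 = (c : ℂ) • 1 := by
      rw [← hR i, corner_apply, map_one]; rfl
    rw [h1, hΦ0, h2, map_smul, hF1]
    simp
  · have h2 : corner ρ₀ (R' (some false)) (R' (some true)) a = α a := hα a
    rw [hT, hΦ0, h2, hFfix _ (α a).2]
    simp
  · have h2 : corner ρ₀ (R' none) (R' none) a = 0 := by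
      rw [corner_apply]
      show adjoint (0 : K →L[ℂ] L₀) ∘L _ = 0
      rw [map_zero, zero_comp]
    rw [hT, hΦ0, h2, map_zero, zero_add, if_pos ⟨rfl, rfl⟩]

end VonNeumannAlgebra

end

noncomputable section

set_option linter.unusedSectionVars false

open scoped ComplexOrder InnerProductSpace

namespace VonNeumannAlgebra

open ContinuousLinearMap HilbertSpaceTools

universe u v w₁ w₂ w₃

variable {H : Type u} [NormedAddCommGroup H] [InnerProductSpace ℂ H] [CompleteSpace H]
variable {K : Type v} [NormedAddCommGroup K] [InnerProductSpace ℂ K] [CompleteSpace K]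

/-! ### The normal part of a representation -/

section NormalPart

variable {M : VonNeumannAlgebra H}
variable {L : Type w₃} [NormedAddCommGroup L] [InnerProductSpace ℂ L] [CompleteSpace L]

theorem starProjection_comp_comm {G : Submodule ℂ L} [G.HasOrthogonalProjection] {B : L →L[ℂ] L}
    (h : ∀ g ∈ G, B g ∈ G) (h' : ∀ g ∈ G, adjoint B g ∈ G) :
    G.starProjection ∘L B = B ∘L G.starProjection := by
  ext x
  have h1 : B (x - G.starProjection x) ∈ Gᗮ := by
    rw [Submodule.mem_orthogonal]
    intro g hg
    rw [← adjoint_inner_left]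
    exact Submodule.inner_right_of_mem_orthogonal (h' g hg)
      (Submodule.sub_starProjection_mem_orthogonal x)
  have h2 : B (G.starProjection x) ∈ G := h _ (Submodule.starProjection_apply_mem _ _)
  show G.starProjection (B x) = B (G.starProjection x)
  have h3 : B x = B (G.starProjection x) + B (x - G.starProjection x) := by
    rw [← map_add]; congr 1; abel
  rw [h3, map_add, Submodule.starProjection_eq_self_iff.2 h2,
    (Submodule.starProjection_apply_eq_zero_iff _).2 h1, add_zero]

/-- The bounded operators intertwining the identity representation of `M` and `ρ`. -/
abbrev Intertwiner (ρ : M.Elem →⋆ₐ[ℂ] (L →L[ℂ] L)) :=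
  {T : H →L[ℂ] L // ∀ a : M.Elem, T ∘L (a : H →L[ℂ] H) = ρ a ∘L T}

/-- The closed span of the ranges of all operators intertwining the identity representation of `M`
and `ρ`. -/
abbrev normalPart (ρ : M.Elem →⋆ₐ[ℂ] (L →L[ℂ] L)) : Submodule ℂ L :=
  rangeSpan fun T : Intertwiner ρ => (T : H →L[ℂ] L)

variable {ρ : M.Elem →⋆ₐ[ℂ] (L →L[ℂ] L)}

theorem adjoint_rep (ρ : M.Elem →⋆ₐ[ℂ] (L →L[ℂ] L)) (a : M.Elem) :
    adjoint (ρ a) = ρ (star a) := by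
  rw [map_star]; rfl

theorem rangeSpan_apply_mem {ι V : Type*} [NormedAddCommGroup V] [InnerProductSpace ℂ V]
    [CompleteSpace V] {T : ι → V →L[ℂ] L} {B : L →L[ℂ] L} (h : ∀ i x, B (T i x) ∈ rangeSpan T) :
    ∀ g ∈ rangeSpan T, B g ∈ rangeSpan T := by
  have h1 : rangeSpan T ≤ (rangeSpan T).comap (B : L →ₗ[ℂ] L) :=
    rangeSpan_le ((Submodule.isClosed_topologicalClosure _).preimage B.continuous) h
  exact h1

theorem rep_mem_normalPart (a : M.Elem) : ∀ g ∈ normalPart ρ, ρ a g ∈ normalPart ρ :=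
  rangeSpan_apply_mem fun T x => by
    have := congrArg (fun f => f x) (T.2 a)
    rw [show ρ a ((T : H →L[ℂ] L) x) = (T : H →L[ℂ] L) ((a : H →L[ℂ] H) x) from this.symm]
    exact apply_mem_rangeSpan (fun T : Intertwiner ρ => (T : H →L[ℂ] L)) T _

/-- An intertwiner followed by `σ` is again an intertwiner. So the projection onto the normal part
commutes with the commutant of `ρ`, in particular with all lifts. -/
theorem commutant_mem_normalPart {σ : L →L[ℂ] L} (h : ∀ a, σ ∘L ρ a = ρ a ∘L σ) :
    ∀ g ∈ normalPart ρ, σ g ∈ normalPart ρ :=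
  rangeSpan_apply_mem fun T x =>
    apply_mem_rangeSpan (fun T : Intertwiner ρ => (T : H →L[ℂ] L))
      ⟨σ ∘L T, fun a => by rw [comp_assoc, T.2, ← comp_assoc, h, comp_assoc]⟩ x

/-- A vector in the closed span of a set is in the closed span of a countable subset. -/
theorem exists_countable_mem_closure_span {S : Set L} {ζ : L}
    (h : ζ ∈ (Submodule.span ℂ S).topologicalClosure) :
    ∃ S' ⊆ S, S'.Countable ∧ ζ ∈ (Submodule.span ℂ S').topologicalClosure := by
  obtain ⟨x, hx, hlim⟩ := mem_closure_iff_seq_limit.1 h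
  choose F hF1 hF2 using fun n => Submodule.mem_span_finite_of_mem_span (hx n)
  refine ⟨⋃ n, (F n : Set L), Set.iUnion_subset hF1,
    Set.countable_iUnion fun n => (F n).countable_toSet, ?_⟩
  refine mem_closure_iff_seq_limit.2 ⟨x, fun n => ?_, hlim⟩
  exact Submodule.span_mono (Set.subset_iUnion (fun n => (F n : Set L)) n) (hF2 n)

/-- Countably many vectors in the normal part are in the initial space of a single intertwining
partial isometry into `Amp H`. -/
theorem exists_amp_intertwiner (ζ : ℕ → L) (hζ : ∀ n, ζ n ∈ normalPart ρ) :
    ∃ U : L →L[ℂ] Amp H, ‖U‖ ≤ 1 ∧ (∀ n, adjoint U (U (ζ n)) = ζ n) ∧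
      ∀ a : M.Elem, U ∘L ρ a = diag (a : H →L[ℂ] H) ∘L U := by
  choose S hS1 hS2 hS3 using fun n => exists_countable_mem_closure_span (hζ n)
  have hS1' : ∀ n, ∀ y ∈ S n, ∃ T : Intertwiner ρ, ∃ x, y = (T : H →L[ℂ] L) x := fun n y hy =>
    hS1 n hy
  choose T x hTx using hS1'
  let I := (Σ n, S n)
  have hcount : Countable (Option I) := by
    have : ∀ n, Countable (S n) := fun n => (hS2 n).to_subtype
    infer_instance
  -- The added zero operator makes the index set nonempty, so that it can be enumerated by `ℕ`.
  let T' : Option I → Intertwiner ρ := fun o => o.elim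
    ⟨0, fun a => by rw [zero_comp, comp_zero]⟩ fun p => T p.1 p.2.1 p.2.2
  obtain ⟨f, hf⟩ := exists_surjective_nat (Option I)
  obtain ⟨U, hU1, hU2⟩ := exists_amp_partial_isometry fun n => (T' (f n) : H →L[ℂ] L)
  refine ⟨U, ?_, fun n => ?_, fun a => ?_⟩
  · have h1 : ‖U‖ * ‖U‖ ≤ 1 := by
      rw [← norm_adjoint_comp_self, hU1]
      exact Submodule.starProjection_norm_le _
    nlinarith [norm_nonneg U]
  · have h1 : ζ n ∈ rangeSpan fun n => (T' (f n) : H →L[ℂ] L) := by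
      refine Submodule.topologicalClosure_mono (Submodule.span_mono ?_) (hS3 n)
      intro y hy
      obtain ⟨k, hk⟩ := hf (some ⟨n, y, hy⟩)
      refine ⟨k, x n y hy, ?_⟩
      show y = (T' (f k) : H →L[ℂ] L) (x n y hy)
      rw [hk]
      exact hTx n y hy
    have h2 := congrArg (fun f => f (ζ n)) hU1
    exact h2.trans (Submodule.starProjection_eq_self_iff.2 h1)
  · refine hU2 _ _ (fun i => (T' (f i)).2 a) fun i => ?_
    rw [adjoint_rep]
    exact (T' (f i)).2 (star a)

/-- A partial isometry intertwining `ρ` with the amplification of the identity representation. -/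
theorem rep_adjoint_apply {U : L →L[ℂ] Amp H}
    (hU : ∀ a : M.Elem, U ∘L ρ a = diag (a : H →L[ℂ] H) ∘L U) (a : M.Elem) (x : Amp H) :
    ρ a (adjoint U x) = adjoint U (diag (a : H →L[ℂ] H) x) := by
  have h := congrArg adjoint (hU (star a))
  rw [adjoint_comp, adjoint_comp, adjoint_rep, star_star, adjoint_diag] at h
  have h2 : adjoint ((star a : M.Elem) : H →L[ℂ] H) = a := star_star (a : H →L[ℂ] H)
  rw [h2] at h
  exact congrArg (fun f => f x) h

/-- A partial isometry carries `ζ` into `ℓ²(H)`, where `ρ` becomes the amplified identity. -/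
theorem isNormalFunctional_of_mem_normalPart {ζ : L} (hζ : ζ ∈ normalPart ρ) (η : L) :
    M.IsNormalFunctional fun a => ⟪η, ρ a ζ⟫_ℂ := by
  obtain ⟨U, -, h1, h2⟩ := exists_amp_intertwiner (fun _ => ζ) (fun _ => hζ)
  rw [isNormalFunctional_iff]
  refine ⟨U ζ, U η, fun a => ?_⟩
  conv_lhs => rw [← h1 0]
  rw [rep_adjoint_apply h2, adjoint_inner_right]

/-- Direct sum of two operators. -/
def prodMap₂ {X Y : Type*} [NormedAddCommGroup X] [InnerProductSpace ℂ X] [NormedAddCommGroup Y]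
    [InnerProductSpace ℂ Y] (A : X →L[ℂ] X) (B : Y →L[ℂ] Y) :
    WithLp 2 (X × Y) →L[ℂ] WithLp 2 (X × Y) :=
  ((WithLp.prodContinuousLinearEquiv 2 ℂ X Y).symm : (X × Y) →L[ℂ] WithLp 2 (X × Y)) ∘L
    (A.prodMap B) ∘L (WithLp.prodContinuousLinearEquiv 2 ℂ X Y : WithLp 2 (X × Y) →L[ℂ] X × Y)

theorem adjoint_prodMap₂ {X Y : Type*} [NormedAddCommGroup X] [InnerProductSpace ℂ X]
    [CompleteSpace X] [NormedAddCommGroup Y] [InnerProductSpace ℂ Y] [CompleteSpace Y]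
    (A : X →L[ℂ] X) (B : Y →L[ℂ] Y) :
    adjoint (prodMap₂ A B) = prodMap₂ (adjoint A) (adjoint B) := by
  symm
  rw [eq_adjoint_iff]
  intro x y
  rw [WithLp.prod_inner_apply, WithLp.prod_inner_apply]
  show ⟪adjoint A x.fst, y.fst⟫_ℂ + ⟪adjoint B x.snd, y.snd⟫_ℂ
    = ⟪x.fst, A y.fst⟫_ℂ + ⟪x.snd, B y.snd⟫_ℂ
  rw [adjoint_inner_left, adjoint_inner_left]

/-- A vector orthogonal to the ranges of all operators intertwining `A` and `B` does not have
coefficients in common with `A`, unless they vanish. -/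
theorem inner_eq_zero_of_intertwiners {ι X : Type*} [Mul ι] [Star ι] [NormedAddCommGroup X]
    [InnerProductSpace ℂ X] [CompleteSpace X] {A : ι → X →L[ℂ] X} {B : ι → L →L[ℂ] L}
    (hA : ∀ a b x, A (a * b) x = A a (A b x)) (hB : ∀ a b x, B (a * b) x = B a (B b x))
    (hA' : ∀ a, adjoint (A a) = A (star a)) (hB' : ∀ a, adjoint (B a) = B (star a))
    {x y : X} {η ζ : L} (h : ∀ a, ⟪η, B a ζ⟫_ℂ = ⟪y, A a x⟫_ℂ)
    (hη : ∀ W : X →L[ℂ] L, (∀ a p, W (A a p) = B a (W p)) → ∀ p, ⟪η, W p⟫_ℂ = 0) (a : ι) :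
    ⟪η, B a ζ⟫_ℂ = 0 := by
  let D : ι → WithLp 2 (X × L) →L[ℂ] WithLp 2 (X × L) := fun a => prodMap₂ (A a) (B a)
  have hD : ∀ a p q, D a (WithLp.toLp 2 (p, q)) = WithLp.toLp 2 (A a p, B a q) :=
    fun a p q => rfl
  let T : ι → ℂ →L[ℂ] WithLp 2 (X × L) := fun a =>
    toSpanSingleton ℂ (D a (WithLp.toLp 2 (x, ζ)))
  have hT : ∀ a c, T a c = c • WithLp.toLp 2 (A a x, B a ζ) := fun a c => rfl
  let P := (rangeSpan T).starProjection
  have hDinv : ∀ a, ∀ g ∈ rangeSpan T, D a g ∈ rangeSpan T := by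
    intro a
    refine rangeSpan_apply_mem fun b c => ?_
    have : D a (T b c) = T (a * b) c := by
      rw [hT, hT, map_smul, hD, hA, hB]
    rw [this]
    exact apply_mem_rangeSpan T _ _
  have hadj : ∀ a, adjoint (D a) = D (star a) := by
    intro a
    have h1 := adjoint_prodMap₂ (A a) (B a)
    rw [hA', hB'] at h1
    exact h1
  have hPD : ∀ a w, P (D a w) = D a (P w) := fun a w =>
    congrArg (fun f => f w) (starProjection_comp_comm (hDinv a) (by
      rw [hadj]; exact hDinv _))
  have hinner : ∀ (p p' : X) (q q' : L), ⟪WithLp.toLp 2 (p, q), WithLp.toLp 2 (p', q')⟫_ℂ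
      = ⟪p, p'⟫_ℂ + ⟪q, q'⟫_ℂ := fun p p' q q' => WithLp.prod_inner_apply _ _
  have hperp : ∀ w, w ∈ (rangeSpan T)ᗮ ↔ ∀ a, ⟪WithLp.toLp 2 (A a x, B a ζ), w⟫_ℂ = 0 := by
    intro w
    rw [mem_rangeSpan_orthogonal]
    refine forall_congr' fun b => ⟨fun h => ?_, fun h => ?_⟩
    · have h1 := congrArg (fun c => ⟪(1 : ℂ), c⟫_ℂ) h
      simp only [adjoint_inner_right, inner_zero_right] at h1
      rwa [hT, one_smul] at h1
    · refine ext_inner_left ℂ fun c => ?_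
      rw [adjoint_inner_right, inner_zero_right, hT, inner_smul_left, h, mul_zero]
  have h1 : P (WithLp.toLp 2 (y, -η)) = 0 := by
    refine (Submodule.starProjection_apply_eq_zero_iff _).2 ((hperp _).2 fun b => ?_)
    rw [hinner, inner_neg_right, ← inner_conj_symm, ← h b, inner_conj_symm, add_neg_cancel]
  have h2 : P (WithLp.toLp 2 (y, 0)) = P (WithLp.toLp 2 (0, η)) := by
    have : (WithLp.toLp 2 (y, (0 : L)) : WithLp 2 (X × L))
        = WithLp.toLp 2 (y, -η) + WithLp.toLp 2 (0, η) := by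
      rw [← WithLp.toLp_add, Prod.mk_add_mk, add_zero, neg_add_cancel]
    rw [this, map_add, h1, zero_add]
  let W : X →L[ℂ] L := WithLp.sndL 2 ℂ X L ∘L P ∘L
    ((WithLp.prodContinuousLinearEquiv 2 ℂ X L).symm : (X × L) →L[ℂ] WithLp 2 (X × L)) ∘L
    ContinuousLinearMap.inl ℂ X L
  have hW : ∀ p, W p = (P (WithLp.toLp 2 (p, 0))).snd := fun p => rfl
  have hWint : ∀ b p, W (A b p) = B b (W p) := by
    intro b p
    have h3 : (WithLp.toLp 2 (A b p, (0 : L)) : WithLp 2 (X × L)) = D b (WithLp.toLp 2 (p, 0)) := by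
      rw [hD, map_zero]
    rw [hW, h3, hPD]
    rfl
  -- Equality of the coefficients says that `(y, -η)` is orthogonal to the subspace, so `P (y, 0) =
  -- P (0, η)`. Hence `‖P (0, η)‖² = ⟪η, W y⟫ = 0`.
  have h5 : P (WithLp.toLp 2 (0, η)) = 0 := by
    set w : WithLp 2 (X × L) := WithLp.toLp 2 (0, η) with hw
    have h6 : ⟪w, P w⟫_ℂ = 0 := by
      rw [← h2]
      have := hinner 0 (P (WithLp.toLp 2 (y, 0))).fst η (P (WithLp.toLp 2 (y, 0))).snd
      refine this.trans ?_
      rw [inner_zero_left, zero_add]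
      exact hη W hWint y
    have h7 : ⟪w - P w, P w⟫_ℂ = 0 :=
      Submodule.starProjection_inner_eq_zero _ _ (Submodule.starProjection_apply_mem _ _)
    rw [inner_sub_left, h6, zero_sub, neg_eq_zero, inner_self_eq_zero] at h7
    exact h7
  have h8 := (hperp _).1 ((Submodule.starProjection_apply_eq_zero_iff _).1 h5) a
  rw [hinner, inner_zero_right, zero_add] at h8
  rw [← inner_conj_symm, h8, map_zero]

/-- Coefficients against vectors orthogonal to the normal part are not normal unless they vanish. -/
theorem inner_rep_eq_zero {η ζ : L} (hη : η ∈ (normalPart ρ)ᗮ)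
    (h : M.IsNormalFunctional fun a => ⟪η, ρ a ζ⟫_ℂ) (a : M.Elem) : ⟪η, ρ a ζ⟫_ℂ = 0 := by
  obtain ⟨x, y, hxy⟩ := isNormalFunctional_iff.1 h
  refine inner_eq_zero_of_intertwiners (A := fun a : M.Elem => diag (a : H →L[ℂ] H))
    (B := fun a => ρ a) (fun a b x => ?_) (fun a b x => ?_) (fun a => ?_) (adjoint_rep ρ) hxy
    (fun W hW p => ?_) a
  · show diag ((a : H →L[ℂ] H) * (b : H →L[ℂ] H)) x = _
    rw [← diag_comp]
    rfl
  · rw [map_mul]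
    rfl
  · rw [adjoint_diag]
    rfl
  · have h0 : (innerSL ℂ η) ∘L W = 0 := by
      refine Amp.clm_ext fun i u => ?_
      let T : Intertwiner ρ := ⟨W ∘L lp.singleContinuousLinearMap ℂ (fun _ : ℕ => H) 2 i, fun a => by
        ext u
        show W (Amp.single i ((a : H →L[ℂ] H) u)) = ρ a (W (Amp.single i u))
        rw [← hW, diag_single]⟩
      have h1 : W (Amp.single i u) ∈ normalPart ρ :=
        apply_mem_rangeSpan (fun T : Intertwiner ρ => (T : H →L[ℂ] L)) T u
      show ⟪η, W (Amp.single i u)⟫_ℂ = 0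
      exact Submodule.inner_left_of_mem_orthogonal h1 hη
    exact congrArg (fun f => f p) h0

/-- If a coefficient functional of `ρ` is normal then it only depends on the normal parts of the
vectors. -/
theorem inner_rep_eq {η ζ : L} (h : M.IsNormalFunctional fun a => ⟪η, ρ a ζ⟫_ℂ) (a : M.Elem) :
    ⟪η, ρ a ζ⟫_ℂ = ⟪η, ρ a ((normalPart ρ).starProjection ζ)⟫_ℂ := by
  have hcomm : ∀ a : M.Elem, (normalPart ρ).starProjection (ρ a ζ)
      = ρ a ((normalPart ρ).starProjection ζ) := fun a =>
    congrArg (fun f => f ζ) (starProjection_comp_comm (rep_mem_normalPart a) (by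
      rw [adjoint_rep]; exact rep_mem_normalPart (star a)))
  have h1 := h.sub (isNormalFunctional_of_mem_normalPart (ρ := ρ)
    (Submodule.starProjection_apply_mem (normalPart ρ) ζ) η)
  have h2 : ∀ a, ⟪η, ρ a ζ⟫_ℂ - ⟪η, ρ a ((normalPart ρ).starProjection ζ)⟫_ℂ
      = ⟪η - (normalPart ρ).starProjection η, ρ a ζ⟫_ℂ := by
    intro a
    rw [inner_sub_left, ← hcomm, Submodule.inner_starProjection_left_eq_right]
  simp only [h2] at h1
  rw [← sub_eq_zero, h2]
  exact inner_rep_eq_zero (Submodule.sub_starProjection_mem_orthogonal η) h1 a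

end NormalPart

end VonNeumannAlgebra

end

/-! ### Range projections of isometries, lifts, and the embedding of the normal span. -/

noncomputable section

set_option linter.unusedSectionVars false

open scoped ComplexOrder InnerProductSpace

namespace VonNeumannAlgebra

open ContinuousLinearMap HilbertSpaceTools

universe u v w₁ w₂ w₃

variable {H : Type u} [NormedAddCommGroup H] [InnerProductSpace ℂ H] [CompleteSpace H]
variable {K : Type v} [NormedAddCommGroup K] [InnerProductSpace ℂ K] [CompleteSpace K]

/-- A projection of `N` which dominates the range projection of an isometry of `N` is the range
projection of an isometry of `N`. -/
theorem exists_isometry_range {N : VonNeumannAlgebra K} {p v : K →L[ℂ] K} (hp : IsStarProjection p)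
    (hpN : p ∈ N) (hvN : v ∈ N) (hv : star v * v = 1) (hpv : p * v = v) :
    ∃ w ∈ N, star w * w = 1 ∧ w * star w = p := by
  have hfN : 1 - p ∈ N := sub_mem (one_mem N) hpN
  have hff : (1 - p) * (1 - p) = 1 - p := hp.one_sub.isIdempotentElem.eq
  have hfs : star (1 - p) = 1 - p := hp.one_sub.isSelfAdjoint.star_eq
  have hfv : (1 - p) * v = 0 := by rw [sub_mul, one_mul, hpv, sub_self]
  have hvf : star v * (1 - p) = 0 := by
    have := congrArg star hfv
    rwa [star_mul, hfs, star_zero] at this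
  set f := 1 - p with hf
  -- Cantor–Bernstein, or Hilbert's hotel: with `Q` the projection onto the span of the ranges of `v
  -- ^ n * f`, one has `Q = f + v Q v*`. So `1 - Q + v Q` shifts `Q` past `f` and fixes the
  -- complement; its range projection is `1 - f = p`.
  let T : ℕ → K →L[ℂ] K := fun n => v ^ n * f
  have hTN : ∀ n, T n ∈ N := fun n => mul_mem (pow_mem hvN n) hfN
  have hvT : ∀ n, v * T n = T (n + 1) := fun n => by
    show v * (v ^ n * f) = v ^ (n + 1) * f
    rw [pow_succ', mul_assoc]
  have hvG : ∀ g ∈ rangeSpan T, v g ∈ rangeSpan T := rangeSpan_apply_mem fun n x => by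
    have : v (T n x) = T (n + 1) x := congrArg (fun A => A x) (hvT n)
    rw [this]
    exact apply_mem_rangeSpan T _ _
  set Q := (rangeSpan T).starProjection with hQ
  have hQN : Q ∈ N := starProjection_mem N _ fun y hy => rangeSpan_apply_mem fun n x => by
    have : y (T n x) = T n (y x) :=
      (congrArg (fun A => A x) (commutant_comm (hTN n) hy)).symm
    rw [this]
    exact apply_mem_rangeSpan T _ _
  have hQs : star Q = Q := (isStarProjection_starProjection (U := rangeSpan T)).isSelfAdjoint.star_eq
  have hQQ : Q * Q = Q := (isStarProjection_starProjection (U := rangeSpan T)).isIdempotentElem.eq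
  have hQvQ : Q * v * Q = v * Q := by
    ext x
    exact Submodule.starProjection_eq_self_iff.2 (hvG _ (Submodule.starProjection_apply_mem _ x))
  have hQvQ' : Q * star v * Q = Q * star v := by
    have := congrArg star hQvQ
    simpa only [star_mul, hQs, mul_assoc] using this
  have hE : f + v * Q * star v = Q := by
    have h1 : (f + v * Q * star v) * Q = Q := by
      have h2 : ∀ g ∈ rangeSpan T, (f + v * Q * star v) g = g := by
        have h3 : rangeSpan T ≤ LinearMap.eqLocus ((f + v * Q * star v : K →L[ℂ] K) : K →ₗ[ℂ] K)
            ((1 : K →L[ℂ] K) : K →ₗ[ℂ] K) := by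
          refine rangeSpan_le (isClosed_eq (f + v * Q * star v).continuous
            (1 : K →L[ℂ] K).continuous) fun n x => ?_
          show (f + v * Q * star v) (T n x) = T n x
          have h4 : (f + v * Q * star v) * T n = T n := by
            cases n with
            | zero =>
              show (f + v * Q * star v) * (v ^ 0 * f) = v ^ 0 * f
              rw [pow_zero, one_mul, add_mul, hff, mul_assoc, hvf, mul_zero, add_zero]
            | succ n =>
              have hQT : Q * T n = T n := by
                ext x
                exact Submodule.starProjection_eq_self_iff.2 (apply_mem_rangeSpan T n x)
              rw [← hvT, add_mul, ← mul_assoc, hfv, zero_mul, zero_add, mul_assoc,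
                ← mul_assoc (star v), hv, one_mul, mul_assoc, hQT]
          exact congrArg (fun A => A x) h4
        exact fun g hg => h3 hg
      ext x
      exact h2 _ (Submodule.starProjection_apply_mem _ x)
    have hfQ : f * Q = f := by
      have h5 : Q * f = f := by
        ext x
        refine Submodule.starProjection_eq_self_iff.2 ?_
        have := apply_mem_rangeSpan T 0 x
        rwa [show T 0 = f by show v ^ 0 * f = f; rw [pow_zero, one_mul]] at this
      have := congrArg star h5
      rwa [star_mul, hQs, hfs] at this
    have h6 : (f + v * Q * star v) * Q = f + v * Q * star v := by
      have h7 : v * Q * star v * Q = v * (Q * star v * Q) := by simp only [mul_assoc]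
      rw [add_mul, hfQ, h7, hQvQ', mul_assoc v]
    exact h6.symm.trans h1
  refine ⟨1 - Q + v * Q, add_mem (sub_mem (one_mem N) hQN) (mul_mem hvN hQN), ?_, ?_⟩
  · have e : star (1 - Q + v * Q) * (1 - Q + v * Q) = 1 - Q - Q + Q * Q + (v * Q - Q * v * Q)
        + (Q * star v - Q * star v * Q) + Q * (star v * v) * Q := by
      rw [star_add, star_sub, star_one, star_mul, hQs]
      noncomm_ring
    rw [e, hQQ, hQvQ, hQvQ', hv, mul_one, hQQ]
    abel
  · have e : (1 - Q + v * Q) * star (1 - Q + v * Q) = 1 - Q - Q + Q * Q + (v * Q - v * (Q * Q))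
        + (Q * star v - Q * Q * star v) + v * (Q * Q) * star v := by
      rw [star_add, star_sub, star_one, star_mul, hQs]
      noncomm_ring
    rw [e, hQQ, eq_sub_of_add_eq' hE, hf]
    abel

section Lift

variable {M : VonNeumannAlgebra H} {N : VonNeumannAlgebra K} {ι : Type w₁}
variable {L : Type w₃} [NormedAddCommGroup L] [InnerProductSpace ℂ L] [CompleteSpace L]

/-- `σ` commutes with `ρ` and lifts `y` along the operators `T i`. -/
structure IsLift (ρ : M.Elem →⋆ₐ[ℂ] (L →L[ℂ] L)) (T : ι → K →L[ℂ] L) (y : K →L[ℂ] K)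
    (σ : L →L[ℂ] L) : Prop where
  comm : ∀ a, σ ∘L ρ a = ρ a ∘L σ
  comp : ∀ i, σ ∘L T i = T i ∘L y
  adjoint_comp : ∀ i, adjoint σ ∘L T i = T i ∘L adjoint y

variable {ρ : M.Elem →⋆ₐ[ℂ] (L →L[ℂ] L)} {T : ι → K →L[ℂ] L} {y : K →L[ℂ] K} {σ : L →L[ℂ] L}

theorem IsLift.adjoint (h : IsLift ρ T y σ) :
    IsLift ρ T (ContinuousLinearMap.adjoint y) (ContinuousLinearMap.adjoint σ) where
  comm a := by
    have := congrArg ContinuousLinearMap.adjoint (h.comm (star a))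
    rw [ContinuousLinearMap.adjoint_comp, ContinuousLinearMap.adjoint_comp, adjoint_rep,
      star_star] at this
    exact this.symm
  comp := h.adjoint_comp
  adjoint_comp i := by rw [adjoint_adjoint, adjoint_adjoint]; exact h.comp i

theorem IsLift.starProjection_comm (h : IsLift ρ T y σ) :
    (normalPart ρ).starProjection ∘L σ = σ ∘L (normalPart ρ).starProjection :=
  starProjection_comp_comm (commutant_mem_normalPart h.comm)
    (commutant_mem_normalPart h.adjoint.comm)

theorem rep_starProjection_comm (ρ : M.Elem →⋆ₐ[ℂ] (L →L[ℂ] L)) (a : M.Elem) :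
    (normalPart ρ).starProjection ∘L ρ a = ρ a ∘L (normalPart ρ).starProjection :=
  starProjection_comp_comm (rep_mem_normalPart a) (by
    rw [adjoint_rep]; exact rep_mem_normalPart (star a))

/-- The subspace of the normal part generated by the projections of the ranges of `T i`. -/
abbrev normalSpan (ρ : M.Elem →⋆ₐ[ℂ] (L →L[ℂ] L)) (T : ι → K →L[ℂ] L) : Submodule ℂ L :=
  rangeSpan fun p : M.Elem × ι => ρ p.1 ∘L (normalPart ρ).starProjection ∘L T p.2

theorem normalSpan_le (ρ : M.Elem →⋆ₐ[ℂ] (L →L[ℂ] L)) (T : ι → K →L[ℂ] L) :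
    normalSpan ρ T ≤ normalPart ρ :=
  rangeSpan_le (Submodule.isClosed_topologicalClosure _) fun p _ =>
    rep_mem_normalPart p.1 _ (Submodule.starProjection_apply_mem _ _)

theorem rep_mem_normalSpan (a : M.Elem) : ∀ g ∈ normalSpan ρ T, ρ a g ∈ normalSpan ρ T :=
  rangeSpan_apply_mem fun p x => by
    have h1 : ρ a (ρ p.1 ((normalPart ρ).starProjection (T p.2 x)))
        = ρ (a * p.1) ((normalPart ρ).starProjection (T p.2 x)) := by
      rw [map_mul]; rfl
    have h2 := apply_mem_rangeSpan
      (fun p : M.Elem × ι => ρ p.1 ∘L (normalPart ρ).starProjection ∘L T p.2) (a * p.1, p.2) x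
    exact h1 ▸ h2

theorem starProjection_mem_normalSpan (i : ι) (x : K) :
    (normalPart ρ).starProjection (T i x) ∈ normalSpan ρ T := by
  have h2 := apply_mem_rangeSpan
    (fun p : M.Elem × ι => ρ p.1 ∘L (normalPart ρ).starProjection ∘L T p.2) (1, i) x
  have h1 : ρ 1 ((normalPart ρ).starProjection (T i x)) = (normalPart ρ).starProjection (T i x) := by
    rw [map_one]; rfl
  exact h1 ▸ h2

/-- The span of the normal part embeds into `K`, compatibly with the commutant of `N`. -/
theorem exists_normalSpan_embedding [Countable ι] [Nonempty ι] (hM : M.HasSeparablePredual)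
    {s : ℕ → K →L[ℂ] K} (hsN : ∀ n, s n ∈ N)
    (hs : ∀ i j, star (s i) * s j = if i = j then 1 else 0)
    (ρ : M.Elem →⋆ₐ[ℂ] (L →L[ℂ] L)) (T : ι → K →L[ℂ] L) :
    ∃ V : L →L[ℂ] K, adjoint V ∘L V = (normalSpan ρ T).starProjection ∧
      ∀ y ∈ N.commutant, ∀ σ, IsLift ρ T y σ → V ∘L σ = y ∘L V := by
  obtain ⟨d, hd⟩ := hM.exists_seq
  obtain ⟨g, hg⟩ := exists_surjective_nat (ℕ × ι)
  -- The elements `d n` suffice in place of all of `M`: the coefficients of vectors in the normal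
  -- part are normal, and `d` separates normal functionals.
  let T' : ℕ → K →L[ℂ] L := fun k =>
    ρ (d (g k).1) ∘L (normalPart ρ).starProjection ∘L T (g k).2
  have hspan : rangeSpan T' = normalSpan ρ T := by
    refine le_antisymm (rangeSpan_le (Submodule.isClosed_topologicalClosure _) fun k x => ?_)
      (rangeSpan_le (Submodule.isClosed_topologicalClosure _) fun p x => ?_)
    · exact apply_mem_rangeSpan
        (fun p : M.Elem × ι => ρ p.1 ∘L (normalPart ρ).starProjection ∘L T p.2)
        (d (g k).1, (g k).2) x
    · rw [mem_rangeSpan_iff]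
      intro w hw
      refine hd _ (isNormalFunctional_of_mem_normalPart (ρ := ρ)
        (Submodule.starProjection_apply_mem (normalPart ρ) (T p.2 x)) w) (fun n => ?_) p.1
      obtain ⟨k, hk⟩ := hg (n, p.2)
      have h1 : ⟪w, T' k x⟫_ℂ = 0 := by rw [← adjoint_inner_left, hw, inner_zero_left]
      have h2 : T' k x = ρ (d (g k).1) ((normalPart ρ).starProjection (T (g k).2 x)) := rfl
      rw [h2, hk] at h1
      exact h1
  obtain ⟨U, hU1, hU2⟩ := exists_amp_partial_isometry T'
  have hss : ∀ i j, adjoint (s i) ∘L s j = if i = j then 1 else 0 := hs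
  -- The row of the isometries `s i` maps `ℓ²(K)` isometrically into `K` and commutes with the
  -- commutant of `N`.
  obtain ⟨J, hJ, -⟩ := exists_row s (fun i => by
    have h1 : ‖s i‖ * ‖s i‖ ≤ 1 := by
      rw [← CStarRing.norm_star_mul_self, hs, if_pos rfl]
      exact ContinuousLinearMap.norm_id_le
    nlinarith [norm_nonneg (s i)]) fun i j hij => by rw [hss, if_neg hij]
  have hJJ : adjoint J ∘L J = 1 := by
    rw [row_adjoint_comp_row hJ hJ 1 hss, diag_one]
  refine ⟨J ∘L U, ?_, fun y hy σ hσ => ?_⟩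
  · rw [adjoint_comp, comp_assoc, ← comp_assoc (adjoint J), hJJ]
    simp only [← hspan]
    exact hU1
  · have hTy : ∀ y σ, IsLift ρ T y σ → ∀ k, T' k ∘L y = σ ∘L T' k := by
      intro y σ h k
      show (ρ (d (g k).1) ∘L (normalPart ρ).starProjection ∘L T (g k).2) ∘L y = _
      rw [comp_assoc, comp_assoc, ← h.comp, ← comp_assoc _ σ, h.starProjection_comm, comp_assoc,
        ← comp_assoc _ σ, ← h.comm, comp_assoc]
    have h1 := hU2 y σ (hTy y σ hσ) (hTy _ _ hσ.adjoint)
    have h2 := row_comp_diag hJ (A := y) (B := y) fun i => commutant_comm (hsN i) hy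
    rw [comp_assoc, h1, ← comp_assoc, h2, comp_assoc]

end Lift

/-- Compressions of a representation to its normal part are normal. -/
theorem isNormalFunctional_of_hasSum {M : VonNeumannAlgebra H} {L : Type w₃} [NormedAddCommGroup L]
    [InnerProductSpace ℂ L] [CompleteSpace L] {ρ : M.Elem →⋆ₐ[ℂ] (L →L[ℂ] L)} {B : K →L[ℂ] L}
    (hB : ∀ x, B x ∈ normalPart ρ) {ξ η : ℕ → K} (hξ : Summable fun n => ‖ξ n‖ ^ 2)
    (hη : Summable fun n => ‖η n‖ ^ 2) {φ : M.Elem → ℂ}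
    (h : ∀ a, HasSum (fun n => ⟪B (η n), ρ a (B (ξ n))⟫_ℂ) (φ a)) : M.IsNormalFunctional φ := by
  obtain ⟨U, hU, hU1, hU2⟩ := exists_amp_intertwiner (fun n => B (ξ n)) fun n => hB _
  have hsq : ∀ ζ : ℕ → K, (Summable fun n => ‖ζ n‖ ^ 2) →
      Summable fun p : ℕ × ℕ => ‖U (B (ζ p.1)) p.2‖ ^ 2 := by
    intro ζ hζ
    rw [summable_prod_of_nonneg fun p => by positivity]
    refine ⟨fun n => Amp.summable_sq (U (B (ζ n))), ?_⟩
    have h1 : ∀ n, ∑' k, ‖U (B (ζ n)) k‖ ^ 2 = ‖U (B (ζ n))‖ ^ 2 := fun n =>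
      (Amp.norm_sq (U (B (ζ n)))).symm
    simp only [h1]
    refine Summable.of_nonneg_of_le (fun n => by positivity) (fun n => ?_) (hζ.mul_left (‖B‖ ^ 2))
    rw [← mul_pow]
    gcongr
    calc ‖U (B (ζ n))‖ ≤ 1 * ‖B (ζ n)‖ := U.le_of_opNorm_le hU _
      _ ≤ ‖B‖ * ‖ζ n‖ := by rw [one_mul]; exact B.le_opNorm _
  refine IsNormalFunctional.of_countable (ι := ℕ × ℕ) (fun p => U (B (ξ p.1)) p.2)
    (fun p => U (B (η p.1)) p.2) (hsq ξ hξ) (hsq η hη) fun a => ?_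
  -- Absolute summability of the double family allows summing the fibres first, which gives `φ a`.
  have hsum : Summable fun p : ℕ × ℕ =>
      ⟪U (B (η p.1)) p.2, (a : H →L[ℂ] H) (U (B (ξ p.1)) p.2)⟫_ℂ := by
    refine Summable.of_norm_bounded (((hsq ξ hξ).add (hsq η hη)).mul_left ‖(a : H →L[ℂ] H)‖)
      fun p => ?_
    refine (norm_inner_le_norm _ _).trans ?_
    have h1 := (a : H →L[ℂ] H).le_opNorm (U (B (ξ p.1)) p.2)
    have h2 := mul_le_mul_of_nonneg_left h1 (norm_nonneg (U (B (η p.1)) p.2))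
    nlinarith [mul_nonneg (norm_nonneg (a : H →L[ℂ] H))
      (sq_nonneg (‖U (B (η p.1)) p.2‖ - ‖U (B (ξ p.1)) p.2‖)),
      mul_nonneg (norm_nonneg (a : H →L[ℂ] H)) (sq_nonneg ‖U (B (η p.1)) p.2‖),
      mul_nonneg (norm_nonneg (a : H →L[ℂ] H)) (sq_nonneg ‖U (B (ξ p.1)) p.2‖)]
  have hfib : ∀ n, HasSum (fun k => ⟪U (B (η n)) k, (a : H →L[ℂ] H) (U (B (ξ n)) k)⟫_ℂ)
      ⟪B (η n), ρ a (B (ξ n))⟫_ℂ := by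
    intro n
    have h1 := lp.hasSum_inner (𝕜 := ℂ) (G := fun _ : ℕ => H) (U (B (η n))) (diag (a : H →L[ℂ] H) (U (B (ξ n))))
    have h2 : ⟪U (B (η n)), diag (a : H →L[ℂ] H) (U (B (ξ n)))⟫_ℂ = ⟪B (η n), ρ a (B (ξ n))⟫_ℂ := by
      rw [← adjoint_inner_right, ← rep_adjoint_apply hU2, hU1]
    rw [h2] at h1
    exact h1
  have h3 := hsum.hasSum.prod_fiberwise hfib
  rw [(h a).unique h3]
  exact hsum.hasSum

end VonNeumannAlgebra

end

/-! ### Matrix amplifications and the upper bound for the completely bounded norm. -/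

noncomputable section

set_option linter.unusedSectionVars false

open scoped ComplexOrder InnerProductSpace

namespace VonNeumannAlgebra

open ContinuousLinearMap HilbertSpaceTools

universe u v w₃

variable {H : Type u} [NormedAddCommGroup H] [InnerProductSpace ℂ H] [CompleteSpace H]
variable {K : Type v} [NormedAddCommGroup K] [InnerProductSpace ℂ K] [CompleteSpace K]

section Matrix

variable {n : ℕ} (x y : Matrix (Fin n) (Fin n) (K →L[ℂ] K))

theorem matrixOp_add : matrixOp (x + y) = matrixOp x + matrixOp y := by
  ext f i
  simp [matrixOp_apply, Finset.sum_add_distrib]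

theorem matrixOp_zero : matrixOp (0 : Matrix (Fin n) (Fin n) (K →L[ℂ] K)) = 0 := by
  ext f i
  simp [matrixOp_apply]

theorem matrixOp_smul (c : ℂ) : matrixOp (c • x) = c • matrixOp x := by
  ext f i
  simp [matrixOp_apply, Finset.smul_sum]

theorem matrixOp_mul : matrixOp (x * y) = matrixOp x * matrixOp y := by
  ext f i
  show matrixOp (x * y) f i = matrixOp x (matrixOp y f) i
  simp only [matrixOp_apply, Matrix.mul_apply, _root_.sum_apply, map_sum]
  exact Finset.sum_comm

theorem matrixOp_star : matrixOp (star x) = star (matrixOp x) := by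
  rw [star_eq_adjoint, eq_adjoint_iff]
  intro f g
  rw [PiLp.inner_apply, PiLp.inner_apply]
  simp only [matrixOp_apply, sum_inner, inner_sum, Matrix.star_apply, star_eq_adjoint,
    adjoint_inner_left]
  exact Finset.sum_comm

theorem matrixOp_injective : Function.Injective (matrixOp (n := n) (H := K)) := by
  intro x y h
  ext i j ξ
  have := congrArg (fun A => A (WithLp.toLp 2 (Pi.single j ξ)) i) h
  simpa [matrixOp_apply, Pi.single_apply, apply_ite] using this

/-- The amplification of a representation to matrices. -/
def matrixRep {A : Type*} [NonUnitalRing A] [StarRing A] [Module ℂ A]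
    (ρ : A →⋆ₙₐ[ℂ] (K →L[ℂ] K)) (n : ℕ) :
    CStarMatrix (Fin n) (Fin n) A →⋆ₙₐ[ℂ]
      (PiLp 2 (fun _ : Fin n => K) →L[ℂ] PiLp 2 (fun _ : Fin n => K)) where
  toFun x := matrixOp (Matrix.of fun i j => ρ (x i j))
  map_zero' := by
    rw [← matrixOp_zero]
    congr 1
    ext1 i j
    exact map_zero ρ
  map_add' x y := by
    rw [← matrixOp_add]
    congr 1
    ext1 i j
    exact map_add ρ _ _
  map_smul' c x := by
    rw [MonoidHom.id_apply, ← matrixOp_smul]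
    congr 1
    ext1 i j
    exact map_smul ρ c _
  map_mul' x y := by
    rw [← matrixOp_mul]
    congr 1
    ext1 i j
    simp only [Matrix.of_apply, CStarMatrix.mul_apply, Matrix.mul_apply, map_sum, map_mul]
  map_star' x := by
    rw [← matrixOp_star]
    congr 1
    ext1 i j
    exact map_star ρ _

end Matrix

/-- The amplifications of a ⋆-homomorphism are contractive. -/
theorem norm_matrixOp_map_le {M : VonNeumannAlgebra H} (ρ : M.Elem →⋆ₙₐ[ℂ] (K →L[ℂ] K)) {n : ℕ}
    (x : Matrix (Fin n) (Fin n) M.Elem) : ‖matrixOp (x.map ρ)‖ ≤ M.matrixNorm x := by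
  let _ : PartialOrder M.Elem := CStarAlgebra.spectralOrder M.Elem
  let _ : StarOrderedRing M.Elem := CStarAlgebra.spectralOrderedRing M.Elem
  let ι : M.Elem →⋆ₙₐ[ℂ] (H →L[ℂ] H) := (M.toStarSubalgebra.subtype : _ →⋆ₙₐ[ℂ] (H →L[ℂ] H))
  -- The amplified inclusion is injective, hence isometric, so `matrixNorm` is the C*-norm of the
  -- matrix algebra. The amplification of `ρ` is contractive for that norm.
  have hinj : Function.Injective (matrixRep ι n) := by
    intro a b hab
    ext1 i j
    exact Subtype.ext (congrFun (congrFun (matrixOp_injective hab) i) j)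
  have h1 := NonUnitalStarAlgHom.norm_apply_le (matrixRep ρ n) (CStarMatrix.ofMatrix x)
  rwa [← NonUnitalStarAlgHom.norm_map (matrixRep ι n) hinj] at h1

/-- A map `R π(·) S` has completely bounded norm at most `‖R‖ ‖S‖`. -/
theorem cbNorm_le_of_factorization {M : VonNeumannAlgebra H} {N : VonNeumannAlgebra K}
    {α : M.Elem →ₗ[ℂ] N.Elem} (π : M.Elem →⋆ₙₐ[ℂ] N.Elem) {R S : N.Elem}
    (h : ∀ a, α a = R * π a * S) : cbNorm α ≤ ENNReal.ofReal (‖R‖ * ‖S‖) := by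
  refine iSup_le fun n => iSup_le fun x => iSup_le fun hx => ENNReal.ofReal_le_ofReal ?_
  let ρ : M.Elem →⋆ₙₐ[ℂ] (K →L[ℂ] K) :=
    (N.toStarSubalgebra.subtype : _ →⋆ₙₐ[ℂ] (K →L[ℂ] K)).comp π
  have h1 := (norm_matrixOp_map_le ρ x).trans hx
  have hd : ∀ A : K →L[ℂ] K, ‖matrixOp (n := n) (Matrix.diagonal fun _ => A)‖ ≤ ‖A‖ := by
    intro A
    refine opNorm_le_bound _ (norm_nonneg _) fun f => ?_
    have h2 : ‖matrixOp (Matrix.diagonal fun _ => A) f‖ ^ 2 ≤ (‖A‖ * ‖f‖) ^ 2 := by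
      rw [PiLp.norm_sq_eq_of_L2, mul_pow, PiLp.norm_sq_eq_of_L2, Finset.mul_sum]
      refine Finset.sum_le_sum fun i _ => ?_
      rw [← mul_pow, matrixOp_apply, Finset.sum_eq_single i]
      · rw [Matrix.diagonal_apply_eq]
        gcongr
        exact A.le_opNorm _
      · intro j _ hj
        rw [Matrix.diagonal_apply_ne _ hj.symm]; rfl
      · simp
    exact le_of_sq_le_sq h2 (by positivity)
  have h3 : matrixOp ((x.map α).map fun a => (a : K →L[ℂ] K))
      = matrixOp (Matrix.diagonal fun _ => (R : K →L[ℂ] K)) * matrixOp (x.map ρ)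
        * matrixOp (Matrix.diagonal fun _ => (S : K →L[ℂ] K)) := by
    rw [← matrixOp_mul, ← matrixOp_mul]
    congr 1
    ext1 i j
    rw [Matrix.mul_diagonal, Matrix.diagonal_mul, Matrix.map_apply, Matrix.map_apply, h]
    rfl
  calc N.matrixNorm (x.map α) = ‖_‖ := congrArg norm h3
    _ ≤ ‖(R : K →L[ℂ] K)‖ * 1 * ‖(S : K →L[ℂ] K)‖ := by
      refine (norm_mul_le _ _).trans (mul_le_mul ((norm_mul_le _ _).trans
        (mul_le_mul (hd _) h1 (norm_nonneg _) (norm_nonneg _))) (hd _) (norm_nonneg _)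
        (by positivity))
    _ = ‖R‖ * ‖S‖ := by rw [mul_one]; rfl

end VonNeumannAlgebra

end

/-! ### Compression of the dilation to `K`, and the factorization. -/

noncomputable section

set_option linter.unusedSectionVars false

open scoped ComplexOrder InnerProductSpace

namespace VonNeumannAlgebra

open ContinuousLinearMap HilbertSpaceTools

universe u v w₁ w₃

variable {H : Type u} [NormedAddCommGroup H] [InnerProductSpace ℂ H] [CompleteSpace H]
variable {K : Type v} [NormedAddCommGroup K] [InnerProductSpace ℂ K] [CompleteSpace K]

section NormalSpan

variable {M : VonNeumannAlgebra H} {N : VonNeumannAlgebra K} {ι : Type w₁}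
variable {L : Type w₃} [NormedAddCommGroup L] [InnerProductSpace ℂ L] [CompleteSpace L]
variable {ρ : M.Elem →⋆ₐ[ℂ] (L →L[ℂ] L)} {T : ι → K →L[ℂ] L}

theorem comp_of_adjoint_comp_eq_starProjection {G : Submodule ℂ L} [G.HasOrthogonalProjection]
    {V : L →L[ℂ] K} (hV : adjoint V ∘L V = G.starProjection) : V ∘L G.starProjection = V := by
  ext x
  show V (G.starProjection x) = V x
  rw [← sub_eq_zero, ← map_sub, ← inner_self_eq_zero (𝕜 := ℂ), ← adjoint_inner_right]
  have h1 : adjoint V (V (G.starProjection x - x)) = G.starProjection (G.starProjection x - x) :=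
    congrArg (fun A => A (G.starProjection x - x)) hV
  have h2 : G.starProjection (G.starProjection x) = G.starProjection x :=
    Submodule.starProjection_eq_self_iff.2 (Submodule.starProjection_apply_mem _ x)
  rw [h1, map_sub, h2, sub_self, inner_zero_right]

theorem starProjection_normalSpan_comp (i : ι) :
    (normalSpan ρ T).starProjection ∘L (normalPart ρ).starProjection ∘L T i
      = (normalPart ρ).starProjection ∘L T i := by
  ext x
  exact Submodule.starProjection_eq_self_iff.2 (starProjection_mem_normalSpan i x)

/-- A normal corner of `ρ` is a corner of its normal part. -/
theorem corner_starProjection {i j : ι} {φ : M.Elem → K →L[ℂ] K}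
    (hφ : ∀ a, adjoint (T i) ∘L ρ a ∘L T j = φ a)
    (hn : ∀ ξ η : K, M.IsNormalFunctional fun a => ⟪η, φ a ξ⟫_ℂ) (a : M.Elem) :
    adjoint (T i) ∘L ρ a ∘L (normalPart ρ).starProjection ∘L T j = φ a := by
  have h0 : ∀ (a : M.Elem) (ξ η : K), ⟪T i η, ρ a (T j ξ)⟫_ℂ = ⟪η, φ a ξ⟫_ℂ := by
    intro a ξ η
    rw [← hφ, ← adjoint_inner_right]
    rfl
  ext ξ
  refine ext_inner_left ℂ fun η => ?_
  have h1 : M.IsNormalFunctional fun a => ⟪T i η, ρ a (T j ξ)⟫_ℂ := by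
    simp only [h0]
    exact hn ξ η
  rw [← h0, inner_rep_eq h1, ← adjoint_inner_right]
  rfl

/-- If `ρ` has a corner which is a normal state then the span of its normal part is all of `K`,
compatibly with the commutant of `N`. -/
theorem exists_normalSpan_coisometry [Countable ι] (hM : M.HasSeparablePredual)
    {s : ℕ → K →L[ℂ] K} (hsN : ∀ n, s n ∈ N)
    (hs : ∀ i j, star (s i) * s j = if i = j then 1 else 0)
    (hlift : ∀ y ∈ N.commutant, ∃ σ, IsLift ρ T y σ) {i₀ : ι} {φ : M.Elem → ℂ}
    (hφ1 : φ 1 = 1)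
    (hT : ∀ a, adjoint (T i₀) ∘L ρ a ∘L T i₀ = φ a • 1)
    (hsmul : ∀ c : ℂ, M.IsNormalFunctional fun a => c * φ a) :
    ∃ V : L →L[ℂ] K, adjoint V ∘L V = (normalSpan ρ T).starProjection ∧ V ∘L adjoint V = 1 ∧
      ∀ y ∈ N.commutant, ∀ σ, IsLift ρ T y σ → V ∘L σ = y ∘L V := by
  have : Nonempty ι := ⟨i₀⟩
  obtain ⟨V, hV, hVσ⟩ := exists_normalSpan_embedding hM hsN hs ρ T
  have hVe := comp_of_adjoint_comp_eq_starProjection hV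
  set z := (normalPart ρ).starProjection with hz
  have hzz : z ∘L z = z := (isStarProjection_starProjection (U := normalPart ρ)).isIdempotentElem.eq
  have hza : adjoint z = z :=
    (isStarProjection_starProjection (U := normalPart ρ)).isSelfAdjoint.star_eq
  set e := (normalSpan ρ T).starProjection with he
  have hez : e ∘L z ∘L T i₀ = z ∘L T i₀ := starProjection_normalSpan_comp i₀
  have hp : IsStarProjection (V ∘L adjoint V) := by
    constructor
    · show (V ∘L adjoint V) ∘L (V ∘L adjoint V) = V ∘L adjoint V
      rw [comp_assoc, ← comp_assoc (adjoint V), hV, ← comp_assoc, hVe]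
    · show adjoint (V ∘L adjoint V) = V ∘L adjoint V
      rw [adjoint_comp, adjoint_adjoint]
  have hpN : V ∘L adjoint V ∈ N := mem_of_forall_commutant N fun y hy => by
    obtain ⟨σ, hσ⟩ := hlift y hy
    have h1 := hVσ y hy σ hσ
    have h2 := congrArg adjoint (hVσ _ (adjoint_mem _ hy) _ hσ.adjoint)
    rw [adjoint_comp, adjoint_comp, adjoint_adjoint, adjoint_adjoint] at h2
    show y ∘L V ∘L adjoint V = (V ∘L adjoint V) ∘L y
    rw [← comp_assoc, ← h1, comp_assoc, h2, comp_assoc]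
  have hvN : V ∘L z ∘L T i₀ ∈ N := mem_of_forall_commutant N fun y hy => by
    obtain ⟨σ, hσ⟩ := hlift y hy
    show y ∘L V ∘L z ∘L T i₀ = (V ∘L z ∘L T i₀) ∘L y
    rw [← comp_assoc, ← hVσ y hy σ hσ, comp_assoc, comp_assoc, comp_assoc, ← hσ.comp,
      ← comp_assoc σ, ← hσ.starProjection_comm, comp_assoc]
  -- The corner at `i₀` is normal, so inserting `z` does not change it. This makes `V z T i₀` an
  -- isometry in `N` whose range lies under `V V*`.
  have hcorner : adjoint (T i₀) ∘L z ∘L T i₀ = 1 := by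
    have h1 := corner_starProjection (i := i₀) (j := i₀) hT (fun ξ η => by
      have : (fun a => ⟪η, (φ a • (1 : K →L[ℂ] K)) ξ⟫_ℂ) = fun a => ⟪η, ξ⟫_ℂ * φ a := by
        funext a
        rw [_root_.smul_apply, inner_smul_right, mul_comm]
        rfl
      rw [this]
      exact hsmul _) 1
    rw [hφ1, one_smul, map_one ρ] at h1
    exact h1
  have hv : star (V ∘L z ∘L T i₀) * (V ∘L z ∘L T i₀) = 1 := by
    show adjoint (V ∘L z ∘L T i₀) ∘L (V ∘L z ∘L T i₀) = 1
    rw [adjoint_comp, adjoint_comp, hza, comp_assoc, comp_assoc, ← comp_assoc (adjoint V), hV, hez,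
      ← comp_assoc z, hzz, hcorner]
  have hpv : (V ∘L adjoint V) * (V ∘L z ∘L T i₀) = V ∘L z ∘L T i₀ := by
    show (V ∘L adjoint V) ∘L (V ∘L z ∘L T i₀) = V ∘L z ∘L T i₀
    rw [comp_assoc, ← comp_assoc (adjoint V), hV, hez]
  -- Hence `V V*` is equivalent to `1` in `N`, and `V` followed by `w*` is onto with the same
  -- initial space.
  obtain ⟨w, hwN, hw1, hw2⟩ := exists_isometry_range hp hpN hvN hv hpv
  have hw1' : adjoint w ∘L w = 1 := hw1
  have hw2' : w ∘L adjoint w = V ∘L adjoint V := hw2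
  refine ⟨adjoint w ∘L V, ?_, ?_, fun y hy σ hσ => ?_⟩
  · rw [adjoint_comp, adjoint_adjoint, comp_assoc, ← comp_assoc w, hw2', comp_assoc,
      ← comp_assoc (adjoint V), hV]
    exact (isStarProjection_starProjection (U := normalSpan ρ T)).isIdempotentElem.eq
  · rw [adjoint_comp, adjoint_adjoint, comp_assoc, ← comp_assoc V, ← hw2', comp_assoc, hw1',
      ← comp_assoc (adjoint w), hw1']
    rfl
  · have h1 : adjoint w ∘L y = y ∘L adjoint w := commutant_comm (adjoint_mem _ hwN) hy
    rw [comp_assoc, hVσ y hy σ hσ, ← comp_assoc, h1, comp_assoc]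

/-- The compression of `ρ` by a coisometry whose initial space is invariant. -/
def compressionRep (ρ : M.Elem →⋆ₐ[ℂ] (L →L[ℂ] L)) (V : L →L[ℂ] K)
    (hV : ∀ a b, V ∘L ρ a ∘L adjoint V ∘L V ∘L ρ b ∘L adjoint V = V ∘L ρ (a * b) ∘L adjoint V)
    (hVN : ∀ a, V ∘L ρ a ∘L adjoint V ∈ N) : M.Elem →⋆ₙₐ[ℂ] N.Elem where
  toFun a := ⟨V ∘L ρ a ∘L adjoint V, hVN a⟩
  map_zero' := by
    refine Subtype.ext ?_
    show V ∘L ρ 0 ∘L adjoint V = 0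
    rw [map_zero, zero_comp, comp_zero]
  map_add' a b := by
    refine Subtype.ext ?_
    show V ∘L ρ (a + b) ∘L adjoint V = V ∘L ρ a ∘L adjoint V + V ∘L ρ b ∘L adjoint V
    rw [map_add, add_comp, comp_add]
  map_smul' c a := by
    refine Subtype.ext ?_
    show V ∘L ρ (c • a) ∘L adjoint V = c • (V ∘L ρ a ∘L adjoint V)
    rw [map_smul, smul_comp, comp_smul]
  map_mul' a b := Subtype.ext (hV a b).symm
  map_star' a := by
    refine Subtype.ext ?_
    show V ∘L ρ (star a) ∘L adjoint V = adjoint (V ∘L ρ a ∘L adjoint V)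
    rw [adjoint_comp, adjoint_comp, adjoint_adjoint, adjoint_rep, comp_assoc]

end NormalSpan

/-- The factorization of a completely bounded normal map, when `M` acts on a nonzero space. -/
theorem exists_normal_factorization {M : VonNeumannAlgebra H} {N : VonNeumannAlgebra K}
    (hM : M.HasSeparablePredual) (hN : N.HasSeparablePredual) (hNinf : N.IsProperlyInfinite)
    (hNinj : N.IsInjective) (α : M.Elem →ₗ[ℂ] N.Elem) (hα : IsNormalMap α) {c : ℝ} (hc0 : 0 ≤ c)
    (hc : ∀ (n : ℕ) (x : Matrix (Fin n) (Fin n) M.Elem), M.matrixNorm x ≤ 1 →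
      N.matrixNorm (x.map α) ≤ c) {h₀ : H} (hh₀ : ‖h₀‖ = 1) :
    ∃ (π : M.Elem →⋆ₙₐ[ℂ] N.Elem) (R S : N.Elem), IsNormalMap π ∧ π 1 = 1 ∧
      (∀ a : M.Elem, α a = R * π a * S) ∧ ‖R‖ * ‖S‖ ≤ c := by
  obtain ⟨s, hsN, hs⟩ := exists_isometry_seq hN hNinf
  obtain ⟨L, _, _, _, T, ρ, hTN, hTc, hTα, hTφ, htot⟩ :=
    exists_injective_dilation hNinj hsN hs α hc0 hc hh₀
  have hlift : ∀ y ∈ N.commutant, ∃ σ, IsLift ρ T y σ := fun y hy =>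
    have ⟨σ, h1, h2, h3⟩ := exists_commutant_lift htot hTN hy
    ⟨σ, h3, h1, h2⟩
  have hφ1 : ⟪h₀, ((1 : M.Elem) : H →L[ℂ] H) h₀⟫_ℂ = 1 := by
    show ⟪h₀, h₀⟫_ℂ = 1
    rw [inner_self_eq_ofReal, hh₀]
    simp
  obtain ⟨V, hV, hV1, hVσ⟩ := exists_normalSpan_coisometry hM hsN hs hlift
    hφ1 hTφ (fun k => by
      have := isNormalFunctional_inner M h₀ ((starRingEnd ℂ) k • h₀)
      simpa only [inner_smul_left, Complex.conj_conj] using this)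
  have hVe := comp_of_adjoint_comp_eq_starProjection hV
  set z := (normalPart ρ).starProjection with hz
  have hzz : z ∘L z = z := (isStarProjection_starProjection (U := normalPart ρ)).isIdempotentElem.eq
  have hza : adjoint z = z :=
    (isStarProjection_starProjection (U := normalPart ρ)).isSelfAdjoint.star_eq
  set e := (normalSpan ρ T).starProjection with he
  have hea : adjoint e = e :=
    (isStarProjection_starProjection (U := normalSpan ρ T)).isSelfAdjoint.star_eq
  have heV : e ∘L adjoint V = adjoint V := by
    have := congrArg adjoint hVe
    rwa [adjoint_comp, hea] at this
  have hez : ∀ i, e ∘L z ∘L T i = z ∘L T i := starProjection_normalSpan_comp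
  have heρ : ∀ a, e ∘L ρ a = ρ a ∘L e := fun a =>
    starProjection_comp_comm (rep_mem_normalSpan a) (by
      rw [adjoint_rep]; exact rep_mem_normalSpan (star a))
  have hzρ : ∀ a, z ∘L ρ a = ρ a ∘L z := rep_starProjection_comm ρ
  have hσV : ∀ y ∈ N.commutant, ∀ σ, IsLift ρ T y σ → σ ∘L adjoint V = adjoint V ∘L y := by
    intro y hy σ hσ
    have h2 := congrArg adjoint (hVσ _ (adjoint_mem _ hy) _ hσ.adjoint)
    rwa [adjoint_comp, adjoint_comp, adjoint_adjoint, adjoint_adjoint] at h2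
  have hπN : ∀ a, V ∘L ρ a ∘L adjoint V ∈ N := fun a => mem_of_forall_commutant N fun y hy => by
    obtain ⟨σ, hσ⟩ := hlift y hy
    show y ∘L V ∘L ρ a ∘L adjoint V = (V ∘L ρ a ∘L adjoint V) ∘L y
    rw [← comp_assoc, ← hVσ y hy σ hσ, comp_assoc, comp_assoc, comp_assoc, ← hσV y hy σ hσ,
      ← comp_assoc σ, hσ.comm, comp_assoc]
  have hSN : ∀ i, V ∘L z ∘L T i ∈ N := fun i => mem_of_forall_commutant N fun y hy => by
    obtain ⟨σ, hσ⟩ := hlift y hy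
    show y ∘L V ∘L z ∘L T i = (V ∘L z ∘L T i) ∘L y
    rw [← comp_assoc, ← hVσ y hy σ hσ, comp_assoc, comp_assoc, comp_assoc, ← hσ.comp,
      ← comp_assoc σ, ← hσ.starProjection_comm, comp_assoc]
  have hVV : ∀ A : K →L[ℂ] L, adjoint V ∘L V ∘L A = e ∘L A := fun A => by
    rw [← comp_assoc, hV]
  have hmul : ∀ a b, V ∘L ρ a ∘L adjoint V ∘L V ∘L ρ b ∘L adjoint V
      = V ∘L ρ (a * b) ∘L adjoint V := fun a b => by
    rw [hVV, ← comp_assoc e, heρ, comp_assoc, heV, map_mul, ← comp_assoc (ρ a)]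
    rfl
  have hSnorm : ∀ b, ‖V ∘L z ∘L T (some b)‖ ≤ √c := by
    intro b
    have hVn : ‖V‖ ≤ 1 := by
      have h1 := norm_adjoint_comp_self V
      rw [hV] at h1
      have h2 : ‖e‖ ≤ 1 := Submodule.starProjection_norm_le _
      nlinarith [norm_nonneg V]
    have hzn : ‖z‖ ≤ 1 := Submodule.starProjection_norm_le _
    -- The constant `c` is split evenly: each of the two legs of the corner has squared norm at most
    -- `c`.
    have hTn : ‖T (some b)‖ ≤ √c := by
      refine Real.le_sqrt_of_sq_le ?_
      rw [sq, ← norm_adjoint_comp_self, hTc, norm_smul, Complex.norm_of_nonneg hc0]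
      exact mul_le_of_le_one_right hc0 norm_id_le
    calc ‖V ∘L z ∘L T (some b)‖ ≤ ‖V‖ * (‖z‖ * ‖T (some b)‖) :=
          (opNorm_comp_le _ _).trans (mul_le_mul_of_nonneg_left (opNorm_comp_le _ _) (norm_nonneg _))
      _ ≤ 1 * (1 * √c) := by gcongr
      _ = √c := by ring
  refine ⟨compressionRep ρ V hmul hπN, star ⟨_, hSN (some false)⟩, ⟨_, hSN (some true)⟩, ?_, ?_,
    fun a => ?_, ?_⟩
  · rintro φ ⟨ξ, η, hξ, hη, hφ⟩
    -- Normality of the compression: `V*` takes its values in the normal span, hence in the normal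
    -- part of `ρ`.
    refine isNormalFunctional_of_hasSum (ρ := ρ) (B := adjoint V) (fun x => ?_) hξ hη fun a => ?_
    · rw [← heV]
      exact normalSpan_le ρ T (Submodule.starProjection_apply_mem _ _)
    · refine (hφ (compressionRep ρ V hmul hπN a)).congr_fun fun n => ?_
      exact adjoint_inner_left V _ _
  · refine Subtype.ext ?_
    show V ∘L ρ 1 ∘L adjoint V = 1
    rw [map_one ρ]
    exact hV1
  · refine Subtype.ext ?_
    show (α a : K →L[ℂ] K) = (adjoint (V ∘L z ∘L T (some false)) ∘L (V ∘L ρ a ∘L adjoint V)) ∘L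
      (V ∘L z ∘L T (some true))
    have h1 := corner_starProjection (i := some false) (j := some true)
      (φ := fun a => (α a : K →L[ℂ] K)) hTα
      (fun ξ η => hα _ (isNormalFunctional_inner N ξ η)) a
    rw [adjoint_comp, adjoint_comp, hza]
    simp only [comp_assoc]
    -- Each `V* V` is the projection `e`, which commutes with `ρ` and fixes the ranges of `z T i`.
    -- The remaining two copies of `z` merge, leaving the normal corner.
    rw [hVV, hVV, hez, ← comp_assoc e, heρ, comp_assoc, hez, ← comp_assoc z, hzρ, comp_assoc,
      ← comp_assoc z, hzz, h1]
  · rw [norm_star]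
    calc _ ≤ √c * √c := mul_le_mul (hSnorm false) (hSnorm true) (norm_nonneg _) (Real.sqrt_nonneg _)
      _ = c := Real.mul_self_sqrt hc0

theorem matrixNorm_map_le_cbNorm {M : VonNeumannAlgebra H} {N : VonNeumannAlgebra K}
    {α : M.Elem →ₗ[ℂ] N.Elem} (hα : IsCompletelyBounded α) {n : ℕ}
    {x : Matrix (Fin n) (Fin n) M.Elem} (hx : M.matrixNorm x ≤ 1) :
    N.matrixNorm (x.map α) ≤ (cbNorm α).toReal := by
  refine (ENNReal.ofReal_le_iff_le_toReal (ne_of_lt hα)).1 ?_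
  unfold cbNorm
  exact le_iSup_of_le n (le_iSup_of_le x (le_iSup_of_le hx le_rfl))

theorem isNormalFunctional_zero (M : VonNeumannAlgebra H) : M.IsNormalFunctional fun _ => 0 :=
  ⟨0, 0, by simp, by simp, fun a => by simp⟩

end VonNeumannAlgebra

end

theorem theorem2p4 {H : Type*} [NormedAddCommGroup H] [InnerProductSpace ℂ H] [CompleteSpace H]
    {K : Type*} [NormedAddCommGroup K] [InnerProductSpace ℂ K] [CompleteSpace K]
    (M : VonNeumannAlgebra H) (N : VonNeumannAlgebra K)
    (hM : M.HasSeparablePredual) (hN : N.HasSeparablePredual)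
    (hNinf : N.IsProperlyInfinite) (hNinj : N.IsInjective)
    (α : M.Elem →ₗ[ℂ] N.Elem)
    (hα : VonNeumannAlgebra.IsNormalMap α) (hαcb : VonNeumannAlgebra.IsCompletelyBounded α) :
    ∃ (π : M.Elem →⋆ₙₐ[ℂ] N.Elem) (R S : N.Elem),
      VonNeumannAlgebra.IsNormalMap π ∧ (Nontrivial M.Elem → π 1 = 1) ∧
      (∀ a : M.Elem, α a = R * π a * S) ∧
      ENNReal.ofReal (‖R‖ * ‖S‖) = VonNeumannAlgebra.cbNorm α := by
  -- The argument needs a unit vector of `H`. If `H = 0`, then `M = 0` and the zero factorization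
  -- works, with nothing to check about the unit.
  rcases subsingleton_or_nontrivial H with hH | hH
  · have hM0 : Subsingleton M.Elem :=
      ⟨fun a b => Subtype.ext (ContinuousLinearMap.ext fun x => Subsingleton.elim _ _)⟩
    have hfac : ∀ a : M.Elem, α a = 0 * (0 : M.Elem →⋆ₙₐ[ℂ] N.Elem) a * 0 := fun a => by
      rw [Subsingleton.elim a 0, map_zero, mul_zero]
    refine ⟨0, 0, 0, fun φ hφ => ?_, fun h => (not_nontrivial _ h).elim, hfac, ?_⟩
    · obtain ⟨ξ, η, -, -, h⟩ := hφ
      have h0 : φ 0 = 0 := (h 0).unique (by simp)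
      have : φ ∘ (0 : M.Elem →⋆ₙₐ[ℂ] N.Elem) = fun _ => 0 := funext fun a => h0
      rw [this]
      exact M.isNormalFunctional_zero
    · refine le_antisymm (by simp) (VonNeumannAlgebra.cbNorm_le_of_factorization _ hfac)
  · obtain ⟨h₀, hh₀⟩ := exists_norm_eq H (zero_le_one' ℝ)
    obtain ⟨π, R, S, hπ, hπ1, hfac, hRS⟩ := VonNeumannAlgebra.exists_normal_factorization hM hN
      hNinf hNinj α hα ENNReal.toReal_nonneg
      (fun n x hx => VonNeumannAlgebra.matrixNorm_map_le_cbNorm hαcb hx) hh₀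
    exact ⟨π, R, S, hπ, fun _ => hπ1, hfac, le_antisymm
      (ENNReal.ofReal_le_of_le_toReal hRS)
      (VonNeumannAlgebra.cbNorm_le_of_factorization π hfac)⟩
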